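/- Let $\mathbf{Set}_*$ be the (strictified) symmetric monoidal category of sets and partial functions, and $\mathbf{Span}$ the (strictified) symmetric monoidal $1$-category of sets and isomorphism classes of spans, both with tensor product given by the cartesian product of sets. For a Petri net $N$ let $\mathfrak F(N)$ be the free strict symmetric monoidal category on $N$ (objects: words in the places; morphisms generated by the transitions); for a free strict symmetric monoidal category $\mathcal C$ let $\mathfrak U(\mathcal C)$ be a Petri net with $\mathfrak F(\mathfrak U(\mathcal C))\cong\mathcal C$. All functors below are strict symmetric monoidal. For $\mathcal S\in\{\mathbf{Set}_*,\mathbf{Span}, \mathbf 1\}$ ($\mathbf 1$ terminal), a net with $\mathcal S$-semantics is a pair $(N,N^\sharp)$ of a net $N$ and a functor $N^\sharp:\mathfrak F(N)\to\mathcal S$; for $\mathcal S=\mathbf 1$ this is just a net. *Addition of generating morphisms.* $(M,M^\sharp)$ is an addition of generating morphisms to $(K,K^\sharp)$ via a net $W$ and a functor $w:\mathfrak F(W)\to\mathfrak F(K)$ if $w$ sends generating objects to generating objects, is injective on objects and faithful, and, writing $\overline W$ for the net with the places of $W$ and no transitions, $\mathfrak F(M)$ is the pushout of $\mathfrak F(\overline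 W)\hookrightarrow\mathfrak F(W)\xrightarrow{w}\mathfrak F(K)$ and $\mathfrak F(\overline W)\hookrightarrow\mathfrak F(W)$ (as strict symmetric monoidal categories), with $M^\sharp$ restricting along the two pushout injections to $K^\sharp$ and to $w;K^\sharp$. *Internalization.* For a strict symmetric monoidal functor $G:\mathcal C\to\mathbf{Set}_*$, $\int G$ has as objects the pairs $(X,x)$ with $X\in\mathcal C$, $x\in GX$, and as morphisms $(X,x)\to(Y,y)$ the morphisms $f:X\to Y$ of $\mathcal C$ such that $Gf$ is defined at $x$ with $Gf(x)=y$. For $G:\mathcal C\to\mathbf{Span}$, choose for each $f:X\to Y$ a span $GX\leftarrow S_f\to GY$ representing $Gf$, and isomorphisms of spans $S_f\times_{GY}S_g\cong S_{f;g}$ and $S_f\times S_{f'}\cong S_{f\otimes f'}$ that are coherent (associative, unital, satisfying the interchange law, and natural with respect to the symmetries); relative to such a choice, $\int G$ has the same objects, and as morphisms $(X,x)\to(Y,y)$ the pairs $(f,s)$ with $f:X\to Y$ and $s\in S_f$ lying over $(x,y)$. In both cases $\int G$ is a strict symmetric monoidal category with $(X,x)\otimes(Y,y)=(X\otimes Y,(x,y))$.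 For a functor $w:\mathcal D\to\mathcal C$, the lift $\hat w:\int(w;G)\to\int G$ is $(X,x)\mapsto(wX,x)$ and $f\mapsto wf$ (respectively $(f,s)\mapsto(wf,s)$, where for $w;G$ the choice induced from the one for $G$, with $S_f:=S_{wf}$, is used). **Lemma.** Let $(M,M^\sharp)$ be an addition of generating morphisms to $(K,K^\sharp)$ via $W,w$, where $M$ and $K$ are nets with $\mathbf{Set}_*$-semantics. Then $\int M^\sharp$, $\int K^\sharp$ and $\int(w;K^\sharp)$ are free strict symmetric monoidal categories on Petri nets, and (the net $\mathfrak U(\int M^\sharp)$ of) $\int M^\sharp$ is an addition of generating morphisms to (the net $\mathfrak U(\int K^\sharp)$ of) $\int K^\sharp$ via $\mathfrak U(\int(w;K^\sharp))$ and $\hat w$, all with semantics in $\mathbf 1$, for every choice of the nets $\mathfrak U(-)$ and of the identifications $\mathfrak F(\mathfrak U(\mathcal C))\cong\mathcal C$. The same holds for $\mathbf{Span}$-semantics, for all coherent choices of apexes for $M^\sharp$ and for $K^\sharp$. -/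

import Mathlib

open CategoryTheory

universe v u v₁ u₁ v₂ u₂ v₃ u₃

/-! ### Strict symmetric monoidal categories and strict symmetric monoidal functors -/

/-- A strict symmetric monoidal category: a category whose objects form a monoid, with a functorial
tensor product on morphisms that is strictly associative and unital, and a symmetry.  Equalities
between morphisms whose types agree only up to an equality of objects are heterogeneous. -/
structure StrictSymMonCat : Type (max (u + 1) (v + 1)) where
  Obj : Type u
  [cat : Category.{v} Obj]
  [mon : Monoid Obj]
  tensor : ∀ {X Y X' Y' : Obj}, (X ⟶ Y) → (X' ⟶ Y') → (X * X' ⟶ Y * Y')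
  braid : ∀ X Y : Obj, X * Y ⟶ Y * X
  tensor_id : ∀ X Y : Obj, tensor (𝟙 X) (𝟙 Y) = 𝟙 (X * Y)
  tensor_comp : ∀ {X Y Z X' Y' Z' : Obj} (f : X ⟶ Y) (g : Y ⟶ Z) (f' : X' ⟶ Y') (g' : Y' ⟶ Z'),
    tensor (f ≫ g) (f' ≫ g') = tensor f f' ≫ tensor g g'
  tensor_assoc : ∀ {X Y X' Y' X'' Y'' : Obj} (f : X ⟶ Y) (g : X' ⟶ Y') (h : X'' ⟶ Y''),
    HEq (tensor (tensor f g) h) (tensor f (tensor g h))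
  one_tensor : ∀ {X Y : Obj} (f : X ⟶ Y), HEq (tensor (𝟙 1) f) f
  tensor_one : ∀ {X Y : Obj} (f : X ⟶ Y), HEq (tensor f (𝟙 1)) f
  braid_naturality : ∀ {X Y X' Y' : Obj} (f : X ⟶ Y) (g : X' ⟶ Y'),
    tensor f g ≫ braid Y Y' = braid X X' ≫ tensor g f
  braid_symmetry : ∀ X Y : Obj, braid X Y ≫ braid Y X = 𝟙 (X * Y)
  hexagon : ∀ X Y Z : Obj,
    braid X (Y * Z) = eqToHom (mul_assoc X Y Z).symm ≫ tensor (braid X Y) (𝟙 Z) ≫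
      eqToHom (mul_assoc Y X Z) ≫ tensor (𝟙 Y) (braid X Z) ≫ eqToHom (mul_assoc Y Z X).symm

attribute [instance] StrictSymMonCat.cat StrictSymMonCat.mon

/-- A strict symmetric monoidal functor. -/
structure StrictSymMonFunctor (C : StrictSymMonCat.{v₁, u₁}) (D : StrictSymMonCat.{v₂, u₂})
    extends C.Obj ⥤ D.Obj where
  obj_one : obj 1 = 1
  obj_mul : ∀ X Y : C.Obj, obj (X * Y) = obj X * obj Y
  map_tensor : ∀ {X Y X' Y' : C.Obj} (f : X ⟶ Y) (g : X' ⟶ Y'),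
    HEq (map (C.tensor f g)) (D.tensor (map f) (map g))
  map_braid : ∀ X Y : C.Obj, HEq (map (C.braid X Y)) (D.braid (obj X) (obj Y))

namespace StrictSymMonFunctor

/-- The identity functor. -/
def id (C : StrictSymMonCat.{v, u}) : StrictSymMonFunctor C C where
  toFunctor := 𝟭 C.Obj
  obj_one := rfl
  obj_mul _ _ := rfl
  map_tensor _ _ := HEq.rfl
  map_braid _ _ := HEq.rfl

theorem functor_map_heq {C : Type u₁} [Category.{v₁} C] {D : Type u₂} [Category.{v₂} D]
    (F : C ⥤ D) {X Y X' Y' : C} (hX : X = X') (hY : Y = Y')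
    {f : X ⟶ Y} {f' : X' ⟶ Y'} (h : HEq f f') : HEq (F.map f) (F.map f') := by
  subst hX hY; cases h; rfl

/-- Composition, in diagrammatic order. -/
def comp {C : StrictSymMonCat.{v₁, u₁}} {D : StrictSymMonCat.{v₂, u₂}}
    {E : StrictSymMonCat.{v₃, u₃}} (F : StrictSymMonFunctor C D) (G : StrictSymMonFunctor D E) :
    StrictSymMonFunctor C E where
  toFunctor := F.toFunctor ⋙ G.toFunctor
  obj_one := (congrArg G.obj F.obj_one).trans G.obj_one
  obj_mul X Y := (congrArg G.obj (F.obj_mul X Y)).trans (G.obj_mul _ _)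
  map_tensor f g :=
    (functor_map_heq G.toFunctor (F.obj_mul _ _) (F.obj_mul _ _) (F.map_tensor f g)).trans
      (G.map_tensor _ _)
  map_braid X Y :=
    (functor_map_heq G.toFunctor (F.obj_mul _ _) (F.obj_mul _ _) (F.map_braid X Y)).trans
      (G.map_braid _ _)

end StrictSymMonFunctor

instance : Category StrictSymMonCat.{v, u} where
  Hom C D := StrictSymMonFunctor C D
  id C := StrictSymMonFunctor.id C
  comp F G := F.comp G

/-- The terminal symmetric monoidal category: one object, one morphism. -/
def StrictSymMonCat.terminal : StrictSymMonCat.{v, u} where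
  Obj := PUnit
  cat := { Hom := fun _ _ => PUnit, id := fun _ => ⟨⟩, comp := fun _ _ => ⟨⟩ }
  mon := inferInstance
  tensor _ _ := ⟨⟩
  braid _ _ := ⟨⟩
  tensor_id _ _ := rfl
  tensor_comp _ _ _ _ := rfl
  tensor_assoc _ _ _ := HEq.rfl
  one_tensor _ := HEq.rfl
  tensor_one _ := HEq.rfl
  braid_naturality _ _ := rfl
  braid_symmetry _ _ := rfl
  hexagon _ _ _ := rfl

/-- The unique functor to the terminal symmetric monoidal category. -/
def StrictSymMonFunctor.toTerminal (C : StrictSymMonCat.{v₁, u₁}) :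
    StrictSymMonFunctor C StrictSymMonCat.terminal.{v₂, u₂} where
  obj _ := PUnit.unit
  map _ := PUnit.unit
  map_id _ := rfl
  map_comp _ _ := rfl
  obj_one := rfl
  obj_mul _ _ := rfl
  map_tensor _ _ := HEq.rfl
  map_braid _ _ := HEq.rfl

/-! ### Petri nets and free strict symmetric monoidal categories -/

/-- A Petri net: each transition has a finite multiset of input places and a finite multiset of
output places. -/
structure PetriNet : Type (u + 1) where
  place : Type u
  transition : Type u
  pre : transition → Multiset place
  post : transition → Multiset place

/-- Generators of a free strict symmetric monoidal category: objects `place`, and morphisms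
`transition` whose source and target are words in the generating objects. -/
structure TensorScheme : Type (u + 1) where
  place : Type u
  transition : Type u
  source : transition → FreeMonoid place
  target : transition → FreeMonoid place

namespace TensorScheme

/-- Formal composites of generating morphisms, identities and symmetries. -/
inductive Term (N : TensorScheme.{u}) : FreeMonoid N.place → FreeMonoid N.place → Type u
  | gen (t : N.transition) : Term N (N.source t) (N.target t)
  | id (X : FreeMonoid N.place) : Term N X X
  | comp {X Y Z : FreeMonoid N.place} (f : Term N X Y) (g : Term N Y Z) : Term N X Z
  | tensor {X Y X' Y' : FreeMonoid N.place} (f : Term N X Y) (g : Term N X' Y') :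
      Term N (X * X') (Y * Y')
  | braid (X Y : FreeMonoid N.place) : Term N (X * Y) (Y * X)

/-- The identity, for endpoints that are equal only propositionally. -/
def Term.ofEq {N : TensorScheme.{u}} {X Y : FreeMonoid N.place} (h : X = Y) : Term N X Y :=
  h ▸ Term.id X

/-- The congruence generated by the axioms of strict symmetric monoidal categories. -/
inductive Term.Rel (N : TensorScheme.{u}) :
    ∀ {X Y : FreeMonoid N.place}, Term N X Y → Term N X Y → Prop
  | refl {X Y : FreeMonoid N.place} (f : Term N X Y) : Rel N f f
  | symm {X Y : FreeMonoid N.place} {f g : Term N X Y} (h : Rel N f g) : Rel N g f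
  | trans {X Y : FreeMonoid N.place} {f g k : Term N X Y} (h : Rel N f g) (h' : Rel N g k) :
      Rel N f k
  | comp_congr {X Y Z : FreeMonoid N.place} {f f' : Term N X Y} {g g' : Term N Y Z}
      (h : Rel N f f') (h' : Rel N g g') : Rel N (f.comp g) (f'.comp g')
  | tensor_congr {X Y X' Y' : FreeMonoid N.place} {f f' : Term N X Y} {g g' : Term N X' Y'}
      (h : Rel N f f') (h' : Rel N g g') : Rel N (f.tensor g) (f'.tensor g')
  | id_comp {X Y : FreeMonoid N.place} (f : Term N X Y) : Rel N ((Term.id X).comp f) f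
  | comp_id {X Y : FreeMonoid N.place} (f : Term N X Y) : Rel N (f.comp (Term.id Y)) f
  | assoc {X Y Z W : FreeMonoid N.place} (f : Term N X Y) (g : Term N Y Z) (h : Term N Z W) :
      Rel N ((f.comp g).comp h) (f.comp (g.comp h))
  | tensor_id (X Y : FreeMonoid N.place) :
      Rel N ((Term.id X).tensor (Term.id Y)) (Term.id (X * Y))
  | tensor_comp {X Y Z X' Y' Z' : FreeMonoid N.place} (f : Term N X Y) (g : Term N Y Z)
      (f' : Term N X' Y') (g' : Term N Y' Z') :
      Rel N ((f.comp g).tensor (f'.comp g')) ((f.tensor f').comp (g.tensor g'))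
  | tensor_assoc {X Y X' Y' X'' Y'' : FreeMonoid N.place} (f : Term N X Y) (g : Term N X' Y')
      (h : Term N X'' Y'') :
      Rel N (((f.tensor g).tensor h).comp (Term.ofEq (mul_assoc Y Y' Y'')))
        ((Term.ofEq (mul_assoc X X' X'')).comp (f.tensor (g.tensor h)))
  | one_tensor {X Y : FreeMonoid N.place} (f : Term N X Y) :
      Rel N (((Term.id 1).tensor f).comp (Term.ofEq (one_mul Y)))
        ((Term.ofEq (one_mul X)).comp f)
  | tensor_one {X Y : FreeMonoid N.place} (f : Term N X Y) :
      Rel N ((f.tensor (Term.id 1)).comp (Term.ofEq (mul_one Y)))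
        ((Term.ofEq (mul_one X)).comp f)
  | braid_naturality {X Y X' Y' : FreeMonoid N.place} (f : Term N X Y) (g : Term N X' Y') :
      Rel N ((f.tensor g).comp (Term.braid Y Y')) ((Term.braid X X').comp (g.tensor f))
  | braid_symmetry (X Y : FreeMonoid N.place) :
      Rel N ((Term.braid X Y).comp (Term.braid Y X)) (Term.id (X * Y))
  | hexagon (X Y Z : FreeMonoid N.place) :
      Rel N (Term.braid X (Y * Z))
        ((Term.ofEq (mul_assoc X Y Z).symm).comp (((Term.braid X Y).tensor (Term.id Z)).comp
          ((Term.ofEq (mul_assoc Y X Z)).comp (((Term.id Y).tensor (Term.braid X Z)).comp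
            (Term.ofEq (mul_assoc Y Z X).symm)))))

/-- Terms up to the axioms of strict symmetric monoidal categories. -/
def termSetoid (N : TensorScheme.{u}) (X Y : FreeMonoid N.place) : Setoid (Term N X Y) where
  r := Term.Rel N
  iseqv := ⟨Term.Rel.refl, Term.Rel.symm, Term.Rel.trans⟩

/-- Morphisms of the free strict symmetric monoidal category. -/
def FreeHom (N : TensorScheme.{u}) (X Y : FreeMonoid N.place) : Type u :=
  Quotient (N.termSetoid X Y)

/-- The class of a term. -/
def Term.cls {N : TensorScheme.{u}} {X Y : FreeMonoid N.place} (f : Term N X Y) :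
    N.FreeHom X Y :=
  Quotient.mk (N.termSetoid X Y) f

theorem Term.cls_eq {N : TensorScheme.{u}} {X Y : FreeMonoid N.place} {f g : Term N X Y}
    (h : Term.Rel N f g) : f.cls = g.cls :=
  Quotient.sound h

/-- The underlying category of the free strict symmetric monoidal category. -/
abbrev freeCategory (N : TensorScheme.{u}) : Category.{u} (FreeMonoid N.place) where
  Hom X Y := N.FreeHom X Y
  id X := (Term.id X).cls
  comp f g := Quotient.map₂ Term.comp (fun _ _ h _ _ h' => Term.Rel.comp_congr h h') f g
  id_comp := by rintro X Y ⟨f⟩; exact Term.cls_eq (.id_comp f)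
  comp_id := by rintro X Y ⟨f⟩; exact Term.cls_eq (.comp_id f)
  assoc := by rintro X Y Z W ⟨f⟩ ⟨g⟩ ⟨h⟩; exact Term.cls_eq (.assoc f g h)

section

attribute [local instance] freeCategory

/-- A term as a morphism of the free strict symmetric monoidal category. -/
def Term.hom {N : TensorScheme.{u}} {X Y : FreeMonoid N.place} (f : Term N X Y) : X ⟶ Y :=
  f.cls

theorem Term.hom_comp {N : TensorScheme.{u}} {X Y Z : FreeMonoid N.place} (f : Term N X Y)
    (g : Term N Y Z) : (f.comp g).hom = f.hom ≫ g.hom := rfl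

theorem Term.hom_ofEq {N : TensorScheme.{u}} {X Y : FreeMonoid N.place} (h : X = Y) :
    (Term.ofEq (N := N) h).hom = eqToHom h := by
  subst h; rfl

/-- Tensor product of morphisms. -/
def freeTensor (N : TensorScheme.{u}) {X Y X' Y' : FreeMonoid N.place} (f : X ⟶ Y)
    (g : X' ⟶ Y') : X * X' ⟶ Y * Y' :=
  Quotient.map₂ Term.tensor (fun _ _ h _ _ h' => Term.Rel.tensor_congr h h') f g

theorem heq_of_comp_eqToHom {C : Type u₁} [Category.{v₁} C] {X Y X' Y' : C} {f : X ⟶ Y}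
    {g : X' ⟶ Y'} (hX : X = X') (hY : Y = Y') (h : f ≫ eqToHom hY = eqToHom hX ≫ g) :
    HEq f g := by
  subst hX hY; simpa using h

/-- The free strict symmetric monoidal category on the given generators. -/
def free (N : TensorScheme.{u}) : StrictSymMonCat.{u, u} where
  Obj := FreeMonoid N.place
  cat := N.freeCategory
  mon := inferInstance
  tensor f g := N.freeTensor f g
  braid X Y := (Term.braid X Y).hom
  tensor_id X Y := Term.cls_eq (.tensor_id X Y)
  tensor_comp := by
    rintro X Y Z X' Y' Z' ⟨f⟩ ⟨g⟩ ⟨f'⟩ ⟨g'⟩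
    exact Term.cls_eq (.tensor_comp f g f' g')
  tensor_assoc := by
    rintro X Y X' Y' X'' Y'' ⟨f⟩ ⟨g⟩ ⟨h⟩
    refine heq_of_comp_eqToHom (mul_assoc _ _ _) (mul_assoc _ _ _) ?_
    rw [← Term.hom_ofEq, ← Term.hom_ofEq]
    exact Term.cls_eq (.tensor_assoc f g h)
  one_tensor := by
    rintro X Y ⟨f⟩
    refine heq_of_comp_eqToHom (one_mul _) (one_mul _) ?_
    rw [← Term.hom_ofEq, ← Term.hom_ofEq]
    exact Term.cls_eq (.one_tensor f)
  tensor_one := by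
    rintro X Y ⟨f⟩
    refine heq_of_comp_eqToHom (mul_one _) (mul_one _) ?_
    rw [← Term.hom_ofEq, ← Term.hom_ofEq]
    exact Term.cls_eq (.tensor_one f)
  braid_naturality := by
    rintro X Y X' Y' ⟨f⟩ ⟨g⟩
    exact Term.cls_eq (.braid_naturality f g)
  braid_symmetry X Y := Term.cls_eq (.braid_symmetry X Y)
  hexagon X Y Z := by
    rw [← Term.hom_ofEq, ← Term.hom_ofEq, ← Term.hom_ofEq]
    exact Term.cls_eq (.hexagon X Y Z)

end

end TensorScheme

namespace PetriNet

/-- The generators given by a Petri net, the input and output multisets of each transition being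
listed in some order. -/
noncomputable def scheme (N : PetriNet.{u}) : TensorScheme.{u} where
  place := N.place
  transition := N.transition
  source t := FreeMonoid.ofList (N.pre t).toList
  target t := FreeMonoid.ofList (N.post t).toList

/-- The free strict symmetric monoidal category associated to a Petri net. -/
noncomputable def free (N : PetriNet.{u}) : StrictSymMonCat.{u, u} := N.scheme.free

/-- The net with the same places and no transitions. -/
def discrete (N : PetriNet.{u}) : PetriNet.{u} where
  place := N.place
  transition := PEmpty
  pre := PEmpty.elim
  post := PEmpty.elim

/-- A formal composite of identities and symmetries, as a formal composite over `N`. -/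
def inclTerm (N : PetriNet.{u}) : ∀ {X Y : FreeMonoid N.place},
    TensorScheme.Term N.discrete.scheme X Y → TensorScheme.Term N.scheme X Y
  | _, _, .gen t => PEmpty.elim t
  | _, _, .id X => TensorScheme.Term.id (N := N.scheme) X
  | _, _, .comp f g => .comp (inclTerm N f) (inclTerm N g)
  | _, _, .tensor f g => .tensor (inclTerm N f) (inclTerm N g)
  | _, _, .braid X Y => TensorScheme.Term.braid (N := N.scheme) X Y

theorem inclTerm_ofEq (N : PetriNet.{u}) {X Y : FreeMonoid N.discrete.scheme.place} (h : X = Y) :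
    N.inclTerm (TensorScheme.Term.ofEq (N := N.discrete.scheme) h) =
      TensorScheme.Term.ofEq (N := N.scheme) h := by
  subst h; rfl

theorem inclTerm_rel (N : PetriNet.{u}) {X Y : FreeMonoid N.discrete.scheme.place}
    {f g : TensorScheme.Term N.discrete.scheme X Y} (h : TensorScheme.Term.Rel _ f g) :
    TensorScheme.Term.Rel N.scheme (N.inclTerm f) (N.inclTerm g) := by
  induction h with
  | refl f => exact .refl _
  | symm _ ih => exact .symm ih
  | trans _ _ ih ih' => exact .trans ih ih'
  | comp_congr _ _ ih ih' => exact .comp_congr ih ih'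
  | tensor_congr _ _ ih ih' => exact .tensor_congr ih ih'
  | id_comp f => exact .id_comp _
  | comp_id f => exact .comp_id _
  | assoc f g h => exact .assoc _ _ _
  | tensor_id X Y => exact .tensor_id (N := N.scheme) X Y
  | tensor_comp f g f' g' => exact .tensor_comp _ _ _ _
  | tensor_assoc f g h =>
    simp only [inclTerm]
    erw [inclTerm_ofEq, inclTerm_ofEq]
    exact .tensor_assoc _ _ _
  | one_tensor f =>
    simp only [inclTerm]
    erw [inclTerm_ofEq, inclTerm_ofEq]
    exact .one_tensor _
  | tensor_one f =>
    simp only [inclTerm]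
    erw [inclTerm_ofEq, inclTerm_ofEq]
    exact .tensor_one _
  | braid_naturality f g => exact .braid_naturality _ _
  | braid_symmetry X Y => exact .braid_symmetry (N := N.scheme) X Y
  | hexagon X Y Z =>
    simp only [inclTerm]
    erw [inclTerm_ofEq, inclTerm_ofEq, inclTerm_ofEq]
    exact .hexagon (N := N.scheme) X Y Z

/-- The inclusion of the free category on the net without its transitions. -/
noncomputable def incl (N : PetriNet.{u}) : StrictSymMonFunctor N.discrete.free N.free where
  obj X := X
  map {X Y} f := Quotient.map (sa := N.discrete.scheme.termSetoid X Y)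
    (sb := N.scheme.termSetoid X Y) N.inclTerm (fun _ _ h => N.inclTerm_rel h) f
  map_id _ := rfl
  map_comp := by rintro X Y Z ⟨f⟩ ⟨g⟩; rfl
  obj_one := rfl
  obj_mul _ _ := rfl
  map_tensor := by rintro X Y X' Y' ⟨f⟩ ⟨g⟩; exact HEq.rfl
  map_braid _ _ := HEq.rfl

end PetriNet
/-! ### Words of sets and their elements -/

/-- The elements of a word of sets: tuples with one entry for each letter. -/
def Tuple (A : FreeMonoid (Type u)) : Type u := A.toList.TProd fun α => α

namespace Tuple

/-- Concatenation of tuples. -/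
def append : ∀ {A B : FreeMonoid (Type u)}, Tuple A → Tuple B → Tuple (A * B)
  | [], _, _, y => y
  | _ :: A, _, x, y => (x.1, append (A := A) x.2 y)

/-- The first part of a tuple. -/
def fst : ∀ {A B : FreeMonoid (Type u)}, Tuple (A * B) → Tuple A
  | [], _, _ => PUnit.unit
  | _ :: A, _, z => (z.1, fst (A := A) z.2)

/-- The second part of a tuple. -/
def snd : ∀ {A B : FreeMonoid (Type u)}, Tuple (A * B) → Tuple B
  | [], _, z => z
  | _ :: A, _, z => snd (A := A) z.2

theorem append_fst_snd : ∀ {A B : FreeMonoid (Type u)} (z : Tuple (A * B)),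
    append z.fst z.snd = z
  | [], _, _ => rfl
  | _ :: A, _, z => Prod.ext rfl (append_fst_snd (A := A) z.2)

theorem fst_append : ∀ {A B : FreeMonoid (Type u)} (x : Tuple A) (y : Tuple B),
    (append x y).fst = x
  | [], _, _, _ => rfl
  | _ :: A, _, x, y => Prod.ext rfl (fst_append (A := A) x.2 y)

theorem snd_append : ∀ {A B : FreeMonoid (Type u)} (x : Tuple A) (y : Tuple B),
    (append x y).snd = y
  | [], _, _, _ => rfl
  | _ :: A, _, x, y => snd_append (A := A) x.2 y

theorem append_inj {A B : FreeMonoid (Type u)} {x x' : Tuple A} {y y' : Tuple B} :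
    append x y = append x' y' ↔ x = x' ∧ y = y' := by
  constructor
  · intro h
    exact ⟨by rw [← fst_append x y, h, fst_append], by rw [← snd_append x y, h, snd_append]⟩
  · rintro ⟨rfl, rfl⟩; rfl

theorem exists_append {A B : FreeMonoid (Type u)} (z : Tuple (A * B)) :
    ∃ x y, z = append x y := ⟨z.fst, z.snd, (append_fst_snd z).symm⟩

theorem append_heq {A B A' B' : FreeMonoid (Type u)} {x : Tuple A} {y : Tuple B} {x' : Tuple A'}
    {y' : Tuple B'} (hA : A = A') (hB : B = B') (hx : HEq x x') (hy : HEq y y') :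
    HEq (append x y) (append x' y') := by
  subst hA hB; cases hx; cases hy; rfl

theorem cons_heq {α : Type u} {A B : FreeMonoid (Type u)} (a : α) {x : Tuple A} {y : Tuple B}
    (hA : A = B) (h : HEq x y) :
    HEq (show Tuple (FreeMonoid.ofList (α :: A.toList)) from (a, x))
      (show Tuple (FreeMonoid.ofList (α :: B.toList)) from (a, y)) := by
  subst hA; cases h; rfl

theorem append_assoc : ∀ {A B C : FreeMonoid (Type u)} (x : Tuple A) (y : Tuple B) (z : Tuple C),
    HEq (append (append x y) z) (append x (append y z))
  | [], _, _, _, _, _ => HEq.rfl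
  | _ :: A, B, C, x, y, z =>
    cons_heq x.1 (mul_assoc (FreeMonoid.ofList A) B C) (append_assoc (A := A) x.2 y z)

theorem one_append {A : FreeMonoid (Type u)} (e : Tuple 1) (x : Tuple A) :
    HEq (append e x) x := HEq.rfl

theorem append_one : ∀ {A : FreeMonoid (Type u)} (x : Tuple A) (e : Tuple 1),
    HEq (append x e) x
  | [], _, _ => HEq.rfl
  | _ :: A, x, e => cons_heq x.1 (mul_one (FreeMonoid.ofList A)) (append_one (A := A) x.2 e)

instance : Unique (Tuple 1) := inferInstanceAs (Unique PUnit)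

end Tuple

/-! ### Sets and partial functions -/

/-- A partial function between the products of two words of sets. -/
@[ext]
structure PartialMap (A B : FreeMonoid (Type u)) : Type u where
  toPFun : Tuple A →. Tuple B

namespace PartialMap

/-- `f.Sends x y`: the partial function is defined at `x`, with value `y`. -/
def Sends {A B : FreeMonoid (Type u)} (f : PartialMap A B) (x : Tuple A) (y : Tuple B) : Prop :=
  y ∈ f.toPFun x

theorem ext_sends {A B : FreeMonoid (Type u)} {f g : PartialMap A B}
    (h : ∀ x y, f.Sends x y ↔ g.Sends x y) : f = g :=
  PartialMap.ext (PFun.ext h)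

theorem heq_of_sends {A B A' B' : FreeMonoid (Type u)} (hA : A = A') (hB : B = B')
    {f : PartialMap A B} {g : PartialMap A' B'}
    (h : ∀ x y x' y', HEq x x' → HEq y y' → (f.Sends x y ↔ g.Sends x' y')) : HEq f g := by
  subst hA hB
  exact heq_of_eq (ext_sends fun x y => h x y x y HEq.rfl HEq.rfl)

theorem sends_iff_of_heq {A B A' B' : FreeMonoid (Type u)} (hA : A = A') (hB : B = B')
    {f : PartialMap A B} {g : PartialMap A' B'} {x : Tuple A} {y : Tuple B} {x' : Tuple A'}
    {y' : Tuple B'} (hf : HEq f g) (hx : HEq x x') (hy : HEq y y') :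
    f.Sends x y ↔ g.Sends x' y' := by
  subst hA hB; cases hf; cases hx; cases hy; rfl

/-- Identity partial function. -/
protected def id (A : FreeMonoid (Type u)) : PartialMap A A := ⟨PFun.id _⟩

/-- Composition of partial functions, in diagrammatic order. -/
def comp {A B C : FreeMonoid (Type u)} (f : PartialMap A B) (g : PartialMap B C) :
    PartialMap A C := ⟨g.toPFun.comp f.toPFun⟩

/-- The product of partial functions: defined where both factors are. -/
def prod {A B A' B' : FreeMonoid (Type u)} (f : PartialMap A B) (g : PartialMap A' B') :
    PartialMap (A * A') (B * B') :=
  ⟨fun z => (f.toPFun z.fst).bind fun y => (g.toPFun z.snd).map fun y' => y.append y'⟩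

/-- Exchange of the two factors. -/
def swap (A B : FreeMonoid (Type u)) : PartialMap (A * B) (B * A) :=
  ⟨fun z => Part.some (z.snd.append z.fst)⟩

theorem sends_id {A : FreeMonoid (Type u)} {x y : Tuple A} :
    (PartialMap.id A).Sends x y ↔ x = y := by
  simp [Sends, PartialMap.id, PFun.id, eq_comm]

theorem sends_comp {A B C : FreeMonoid (Type u)} {f : PartialMap A B} {g : PartialMap B C}
    {x : Tuple A} {z : Tuple C} : (f.comp g).Sends x z ↔ ∃ y, f.Sends x y ∧ g.Sends y z := by
  exact Part.mem_bind_iff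

theorem sends_prod {A B A' B' : FreeMonoid (Type u)} {f : PartialMap A B}
    {g : PartialMap A' B'} {x : Tuple A} {y : Tuple B} {x' : Tuple A'} {y' : Tuple B'} :
    (f.prod g).Sends (x.append x') (y.append y') ↔ f.Sends x y ∧ g.Sends x' y' := by
  simp [Sends, prod, Tuple.fst_append, Tuple.snd_append, Tuple.append_inj]

theorem sends_swap {A B : FreeMonoid (Type u)} {x x' : Tuple A} {y y' : Tuple B} :
    (swap A B).Sends (x.append y) (y'.append x') ↔ x = x' ∧ y = y' := by
  simp [Sends, swap, Tuple.fst_append, Tuple.snd_append, Tuple.append_inj, eq_comm, and_comm]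

/-- The category of words of sets and partial functions. -/
abbrev category : Category.{u} (FreeMonoid (Type u)) where
  Hom := PartialMap
  id := PartialMap.id
  comp := comp
  id_comp f := ext_sends fun x y => by
    rw [sends_comp]; simp only [sends_id, exists_eq_left']
  comp_id f := ext_sends fun x y => by
    rw [sends_comp]; simp only [sends_id, exists_eq_right]
  assoc f g h := ext_sends fun x y => by
    simp only [sends_comp]
    grind

section

attribute [local instance] category

theorem sends_eqToHom {A B : FreeMonoid (Type u)} (h : A = B) {x : Tuple A} {y : Tuple B} :
    PartialMap.Sends (eqToHom h) x y ↔ HEq x y := by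
  subst h
  exact sends_id.trans heq_iff_eq.symm

/-- The strict symmetric monoidal category of sets and partial functions, with the cartesian
product of sets as tensor product: its objects are words of sets, a word standing for the product
of its letters. -/
def _root_.SetPartial : StrictSymMonCat.{u, u + 1} where
  Obj := FreeMonoid (Type u)
  cat := category
  mon := inferInstance
  tensor f g := prod f g
  braid := swap
  tensor_id A B := ext_sends fun z w => by
    obtain ⟨x, y, rfl⟩ := z.exists_append
    obtain ⟨x', y', rfl⟩ := w.exists_append
    refine sends_prod.trans ((and_congr sends_id sends_id).trans ?_)
    exact Tuple.append_inj.symm.trans sends_id.symm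
  tensor_comp f g f' g' := ext_sends fun z w => by
    obtain ⟨x, y, rfl⟩ := z.exists_append
    obtain ⟨x', y', rfl⟩ := w.exists_append
    refine sends_prod.trans ((and_congr sends_comp sends_comp).trans (Iff.trans ?_ sends_comp.symm))
    constructor
    · rintro ⟨⟨a, h1, h2⟩, ⟨b, h3, h4⟩⟩
      exact ⟨a.append b, sends_prod.2 ⟨h1, h3⟩, sends_prod.2 ⟨h2, h4⟩⟩
    · rintro ⟨c, h1, h2⟩
      obtain ⟨a, b, rfl⟩ := c.exists_append
      have h1 := sends_prod.1 h1
      have h2 := sends_prod.1 h2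
      exact ⟨⟨a, h1.1, h2.1⟩, ⟨b, h1.2, h2.2⟩⟩
  tensor_assoc f g h := heq_of_sends (mul_assoc _ _ _) (mul_assoc _ _ _) fun x y x' y' hx hy => by
    obtain ⟨x, x₃, rfl⟩ := x.exists_append
    obtain ⟨x₁, x₂, rfl⟩ := x.exists_append
    obtain ⟨y, y₃, rfl⟩ := y.exists_append
    obtain ⟨y₁, y₂, rfl⟩ := y.exists_append
    obtain rfl := eq_of_heq (hx.symm.trans (Tuple.append_assoc _ _ _))
    obtain rfl := eq_of_heq (hy.symm.trans (Tuple.append_assoc _ _ _))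
    simp only [sends_prod, and_assoc]
  one_tensor f := heq_of_sends (one_mul _) (one_mul _) fun x y x' y' hx hy => by
    obtain ⟨e, x, rfl⟩ := x.exists_append
    obtain ⟨e', y, rfl⟩ := y.exists_append
    obtain rfl := eq_of_heq (hx.symm.trans (Tuple.one_append e _))
    obtain rfl := eq_of_heq (hy.symm.trans (Tuple.one_append e' _))
    exact (sends_prod (x := e) (y := e')).trans
      (and_iff_right (sends_id.2 (Subsingleton.elim e e')))
  tensor_one f := heq_of_sends (mul_one _) (mul_one _) fun x y x' y' hx hy => by
    obtain ⟨x, e, rfl⟩ := x.exists_append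
    obtain ⟨y, e', rfl⟩ := y.exists_append
    obtain rfl := eq_of_heq (hx.symm.trans (Tuple.append_one _ _))
    obtain rfl := eq_of_heq (hy.symm.trans (Tuple.append_one _ _))
    refine sends_prod.trans (and_iff_left (sends_id.2 (Subsingleton.elim _ _)))
  braid_naturality f g := ext_sends fun z w => by
    obtain ⟨x, x', rfl⟩ := z.exists_append
    obtain ⟨y', y, rfl⟩ := w.exists_append
    refine sends_comp.trans (Iff.trans ?_ sends_comp.symm)
    constructor
    · rintro ⟨c, h1, h2⟩
      obtain ⟨a, b, rfl⟩ := c.exists_append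
      obtain ⟨h1, h1'⟩ := sends_prod.1 h1
      obtain ⟨rfl, rfl⟩ := sends_swap.1 h2
      exact ⟨x'.append x, sends_swap.2 ⟨rfl, rfl⟩, sends_prod.2 ⟨h1', h1⟩⟩
    · rintro ⟨c, h1, h2⟩
      obtain ⟨a, b, rfl⟩ := c.exists_append
      obtain ⟨rfl, rfl⟩ := sends_swap.1 h1
      obtain ⟨h2, h2'⟩ := sends_prod.1 h2
      exact ⟨y.append y', sends_prod.2 ⟨h2', h2⟩, sends_swap.2 ⟨rfl, rfl⟩⟩
  braid_symmetry A B := ext_sends fun z w => by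
    obtain ⟨x, y, rfl⟩ := z.exists_append
    obtain ⟨x', y', rfl⟩ := w.exists_append
    refine sends_comp.trans (Iff.trans ?_ (Tuple.append_inj.symm.trans sends_id.symm))
    constructor
    · rintro ⟨c, h1, h2⟩
      obtain ⟨a, b, rfl⟩ := c.exists_append
      obtain ⟨rfl, rfl⟩ := sends_swap.1 h1
      obtain ⟨rfl, rfl⟩ := sends_swap.1 h2
      exact ⟨rfl, rfl⟩
    · rintro ⟨rfl, rfl⟩
      exact ⟨y.append x, sends_swap.2 ⟨rfl, rfl⟩, sends_swap.2 ⟨rfl, rfl⟩⟩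
  hexagon A B C := ext_sends fun z w => by
    obtain ⟨x, z, rfl⟩ := z.exists_append
    obtain ⟨y, z, rfl⟩ := z.exists_append
    obtain ⟨w, x', rfl⟩ := w.exists_append
    obtain ⟨y', z', rfl⟩ := w.exists_append
    refine sends_swap.trans (Iff.trans ?_ sends_comp.symm)
    rw [Tuple.append_inj]
    constructor
    · rintro ⟨rfl, rfl, rfl⟩
      refine ⟨(x.append y).append z, (sends_eqToHom _).2 (Tuple.append_assoc _ _ _).symm,
        sends_comp.2 ⟨(y.append x).append z, ?_, sends_comp.2 ⟨y.append (x.append z), ?_,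
          sends_comp.2 ⟨y.append (z.append x), ?_, ?_⟩⟩⟩⟩
      · exact sends_prod.2 ⟨sends_swap.2 ⟨rfl, rfl⟩, sends_id.2 rfl⟩
      · exact (sends_eqToHom _).2 (Tuple.append_assoc _ _ _)
      · exact sends_prod.2 ⟨sends_id.2 rfl, sends_swap.2 ⟨rfl, rfl⟩⟩
      · exact (sends_eqToHom _).2 (Tuple.append_assoc _ _ _).symm
    · rintro ⟨a, h1, h⟩
      obtain ⟨b, h2, h⟩ := sends_comp.1 h
      obtain ⟨c, h3, h⟩ := sends_comp.1 h
      obtain ⟨d, h4, h5⟩ := sends_comp.1 h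
      obtain rfl := eq_of_heq (((sends_eqToHom _).1 h1).symm.trans (Tuple.append_assoc _ _ _).symm)
      obtain ⟨b, b₃, rfl⟩ := b.exists_append
      obtain ⟨b₁, b₂, rfl⟩ := b.exists_append
      obtain ⟨h2, h2'⟩ := sends_prod.1 h2
      obtain ⟨rfl, rfl⟩ := sends_swap.1 h2
      obtain rfl := sends_id.1 h2'
      obtain rfl := eq_of_heq (((sends_eqToHom _).1 h3).symm.trans (Tuple.append_assoc _ _ _))
      obtain ⟨d₁, d, rfl⟩ := d.exists_append
      obtain ⟨d₂, d₃, rfl⟩ := d.exists_append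
      obtain ⟨h4, h4'⟩ := sends_prod.1 h4
      obtain rfl := sends_id.1 h4
      obtain ⟨rfl, rfl⟩ := sends_swap.1 h4'
      have h5 := eq_of_heq (((sends_eqToHom _).1 h5).symm.trans (Tuple.append_assoc _ _ _).symm)
      obtain ⟨h5, h6⟩ := Tuple.append_inj.1 h5
      obtain ⟨h5, h7⟩ := Tuple.append_inj.1 h5
      exact ⟨h6.symm, h5.symm, h7.symm⟩

end

end PartialMap
/-! ### Sets and spans -/

/-- A span of sets between the products of two words of sets. -/
structure SetSpan (A B : FreeMonoid (Type u)) : Type (u + 1) where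
  apex : Type u
  left : apex → Tuple A
  right : apex → Tuple B

namespace SetSpan

/-- Isomorphism of spans. -/
def Iso {A B : FreeMonoid (Type u)} (S T : SetSpan A B) : Prop :=
  ∃ e : S.apex ≃ T.apex, ∀ s, T.left (e s) = S.left s ∧ T.right (e s) = S.right s

/-- Spans up to isomorphism. -/
def isoSetoid (A B : FreeMonoid (Type u)) : Setoid (SetSpan A B) where
  r := Iso
  iseqv := by
    refine ⟨fun S => ⟨Equiv.refl _, fun _ => ⟨rfl, rfl⟩⟩, ?_, ?_⟩
    · rintro S T ⟨e, h⟩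
      refine ⟨e.symm, fun s => ?_⟩
      have := h (e.symm s)
      rw [e.apply_symm_apply] at this
      exact ⟨this.1.symm, this.2.symm⟩
    · rintro S T U ⟨e, h⟩ ⟨e', h'⟩
      exact ⟨e.trans e', fun s => ⟨(h' _).1.trans (h s).1, (h' _).2.trans (h s).2⟩⟩

/-- The identity span. -/
protected def id (A : FreeMonoid (Type u)) : SetSpan A A := ⟨Tuple A, fun x => x, fun x => x⟩

/-- Composition of spans by pullback, in diagrammatic order. -/
def comp {A B C : FreeMonoid (Type u)} (S : SetSpan A B) (T : SetSpan B C) : SetSpan A C where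
  apex := { p : S.apex × T.apex // S.right p.1 = T.left p.2 }
  left p := S.left p.1.1
  right p := T.right p.1.2

/-- The product of spans. -/
def prod {A B A' B' : FreeMonoid (Type u)} (S : SetSpan A B) (T : SetSpan A' B') :
    SetSpan (A * A') (B * B') where
  apex := S.apex × T.apex
  left p := (S.left p.1).append (T.left p.2)
  right p := (S.right p.1).append (T.right p.2)

/-- The span of the bijection exchanging two factors. -/
def swap (A B : FreeMonoid (Type u)) : SetSpan (A * B) (B * A) where
  apex := Tuple A × Tuple B
  left p := p.1.append p.2
  right p := p.2.append p.1

/-- Morphisms of the 1-category of sets and spans: isomorphism classes of spans. -/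
def Class (A B : FreeMonoid (Type u)) : Type (u + 1) := Quotient (isoSetoid A B)

/-- The isomorphism class of a span. -/
def cls {A B : FreeMonoid (Type u)} (S : SetSpan A B) : Class A B := Quotient.mk (isoSetoid A B) S

theorem cls_eq {A B : FreeMonoid (Type u)} {S T : SetSpan A B} (e : S.apex ≃ T.apex)
    (h : ∀ s, T.left (e s) = S.left s ∧ T.right (e s) = S.right s) : S.cls = T.cls :=
  Quotient.sound (s := isoSetoid A B) ⟨e, h⟩

theorem iso_of_cls_eq {A B : FreeMonoid (Type u)} {S T : SetSpan A B} (h : S.cls = T.cls) :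
    S.Iso T :=
  Quotient.exact (s := isoSetoid A B) h

theorem cls_heq {A B A' B' : FreeMonoid (Type u)} (hA : A = A') (hB : B = B') {S : SetSpan A B}
    {T : SetSpan A' B'} (e : S.apex ≃ T.apex)
    (h : ∀ s, HEq (T.left (e s)) (S.left s) ∧ HEq (T.right (e s)) (S.right s)) :
    HEq S.cls T.cls := by
  subst hA hB
  exact heq_of_eq (cls_eq e fun s => ⟨eq_of_heq (h s).1, eq_of_heq (h s).2⟩)

/-- Composition of isomorphism classes of spans. -/
def Class.comp {A B C : FreeMonoid (Type u)} (S : Class A B) (T : Class B C) : Class A C :=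
  Quotient.map₂ (sa := isoSetoid A B) (sb := isoSetoid B C) (sc := isoSetoid A C) SetSpan.comp (by
    rintro S S' ⟨e, h⟩ T T' ⟨e', h'⟩
    exact ⟨(Equiv.prodCongr e e').subtypeEquiv fun p => by
      simp [(h p.1).2, (h' p.2).1], fun p => ⟨(h p.1.1).1, (h' p.1.2).2⟩⟩) S T

/-- The product of isomorphism classes of spans. -/
def Class.prod {A B A' B' : FreeMonoid (Type u)} (S : Class A B) (T : Class A' B') :
    Class (A * A') (B * B') :=
  Quotient.map₂ (sa := isoSetoid A B) (sb := isoSetoid A' B') (sc := isoSetoid (A * A') (B * B'))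
    SetSpan.prod (by
    rintro S S' ⟨e, h⟩ T T' ⟨e', h'⟩
    refine ⟨Equiv.prodCongr e e', fun p => ⟨?_, ?_⟩⟩
    · exact congrArg₂ Tuple.append (h p.1).1 (h' p.2).1
    · exact congrArg₂ Tuple.append (h p.1).2 (h' p.2).2) S T

theorem cls_comp_id {A B : FreeMonoid (Type u)} (S : SetSpan A B) :
    (S.comp (SetSpan.id B)).cls = S.cls :=
  cls_eq ⟨fun p => p.1.1, fun s => ⟨(s, S.right s), rfl⟩,
    fun p => Subtype.ext (Prod.ext rfl p.2), fun _ => rfl⟩ fun p => ⟨rfl, p.2⟩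

theorem cls_id_comp {A B : FreeMonoid (Type u)} (S : SetSpan A B) :
    ((SetSpan.id A).comp S).cls = S.cls :=
  cls_eq ⟨fun p => p.1.2, fun s => ⟨(S.left s, s), rfl⟩,
    fun p => Subtype.ext (Prod.ext p.2.symm rfl), fun _ => rfl⟩ fun p => ⟨p.2.symm, rfl⟩

/-- The category of words of sets and isomorphism classes of spans. -/
abbrev category : Category.{u + 1} (FreeMonoid (Type u)) where
  Hom := Class
  id A := (SetSpan.id A).cls
  comp := Class.comp
  id_comp := by rintro A B ⟨S⟩; exact cls_id_comp S
  comp_id := by rintro A B ⟨S⟩; exact cls_comp_id S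
  assoc := by
    rintro A B C D ⟨S⟩ ⟨T⟩ ⟨U⟩
    exact cls_eq (S := (S.comp T).comp U) (T := S.comp (T.comp U))
      ⟨fun p => ⟨(p.1.1.1.1, ⟨(p.1.1.1.2, p.1.2), p.2⟩), p.1.1.2⟩,
        fun p => ⟨(⟨(p.1.1, p.1.2.1.1), p.2⟩, p.1.2.1.2), p.1.2.2⟩,
        fun _ => rfl, fun _ => rfl⟩ fun _ => ⟨rfl, rfl⟩

section

attribute [local instance] category

theorem cls_eqToHom_comp {A A' B : FreeMonoid (Type u)} (h : A = A') (S : SetSpan A' B)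
    (T : SetSpan A B) (e : S.apex ≃ T.apex)
    (he : ∀ s, HEq (T.left (e s)) (S.left s) ∧ T.right (e s) = S.right s) :
    eqToHom h ≫ (show A' ⟶ B from S.cls) = T.cls := by
  subst h
  rw [eqToHom_refl, Category.id_comp]
  exact cls_eq e fun s => ⟨eq_of_heq (he s).1, (he s).2⟩

theorem cls_comp_eqToHom {A B B' : FreeMonoid (Type u)} (h : B = B') (S : SetSpan A B)
    (T : SetSpan A B') (e : S.apex ≃ T.apex)
    (he : ∀ s, T.left (e s) = S.left s ∧ HEq (T.right (e s)) (S.right s)) :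
    (show A ⟶ B from S.cls) ≫ eqToHom h = T.cls := by
  subst h
  rw [eqToHom_refl, Category.comp_id]
  exact cls_eq e fun s => ⟨(he s).1, eq_of_heq (he s).2⟩

/-- The strict symmetric monoidal 1-category of sets and isomorphism classes of spans, with the
cartesian product of sets as tensor product: its objects are words of sets, a word standing for the
product of its letters. -/
def _root_.SpanCat : StrictSymMonCat.{u + 1, u + 1} where
  Obj := FreeMonoid (Type u)
  cat := category
  mon := inferInstance
  tensor f g := Class.prod f g
  braid A B := (swap A B).cls
  tensor_id A B := cls_eq (S := (SetSpan.id A).prod (SetSpan.id B))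
    ⟨fun p => Tuple.append p.1 p.2, fun z => (z.fst, z.snd),
      fun p => Prod.ext (Tuple.fst_append _ _) (Tuple.snd_append _ _),
      fun z => Tuple.append_fst_snd z⟩ fun _ => ⟨rfl, rfl⟩
  tensor_comp := by
    rintro A B C A' B' C' ⟨S⟩ ⟨T⟩ ⟨S'⟩ ⟨T'⟩
    exact cls_eq (S := (S.comp T).prod (S'.comp T')) (T := (S.prod S').comp (T.prod T'))
      ⟨fun p => ⟨((p.1.1.1, p.2.1.1), (p.1.1.2, p.2.1.2)),
          Tuple.append_inj.2 ⟨p.1.2, p.2.2⟩⟩,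
        fun p => (⟨(p.1.1.1, p.1.2.1), (Tuple.append_inj.1 p.2).1⟩,
          ⟨(p.1.1.2, p.1.2.2), (Tuple.append_inj.1 p.2).2⟩),
        fun _ => rfl, fun _ => rfl⟩ fun _ => ⟨rfl, rfl⟩
  tensor_assoc := by
    rintro A B A' B' A'' B'' ⟨S⟩ ⟨T⟩ ⟨U⟩
    exact cls_heq (S := (S.prod T).prod U) (T := S.prod (T.prod U)) (mul_assoc _ _ _)
      (mul_assoc _ _ _) (Equiv.prodAssoc _ _ _) fun _ =>
        ⟨(Tuple.append_assoc _ _ _).symm, (Tuple.append_assoc _ _ _).symm⟩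
  one_tensor := by
    rintro A B ⟨S⟩
    exact cls_heq (S := (SetSpan.id 1).prod S) (one_mul _) (one_mul _)
      ⟨fun p => p.2, fun s => ((default : Tuple 1), s),
        fun p => Prod.ext (Subsingleton.elim (α := Tuple 1) _ _) rfl, fun _ => rfl⟩
      fun p => ⟨(Tuple.one_append p.1 _).symm, (Tuple.one_append p.1 _).symm⟩
  tensor_one := by
    rintro A B ⟨S⟩
    exact cls_heq (S := S.prod (SetSpan.id 1)) (mul_one _) (mul_one _)
      ⟨fun p => p.1, fun s => (s, (default : Tuple 1)),
        fun p => Prod.ext rfl (Subsingleton.elim (α := Tuple 1) _ _), fun _ => rfl⟩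
      fun p => ⟨(Tuple.append_one _ p.2).symm, (Tuple.append_one _ p.2).symm⟩
  braid_naturality := by
    rintro A B A' B' ⟨S⟩ ⟨T⟩
    exact cls_eq (S := (S.prod T).comp (swap B B')) (T := (swap A A').comp (T.prod S))
      ⟨fun p => ⟨((S.left p.1.1.1, T.left p.1.1.2), (p.1.1.2, p.1.1.1)), rfl⟩,
        fun p => ⟨((p.1.2.2, p.1.2.1), (S.right p.1.2.2, T.right p.1.2.1)), rfl⟩,
        fun p => by
          obtain ⟨⟨⟨s, t⟩, ⟨b, b'⟩⟩, h⟩ := p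
          have h' : S.right s = b ∧ T.right t = b' := Tuple.append_inj.1 h
          obtain ⟨rfl, rfl⟩ := h'
          rfl,
        fun p => by
          obtain ⟨⟨⟨a, a'⟩, ⟨t, s⟩⟩, h⟩ := p
          have h' : a' = T.left t ∧ a = S.left s := Tuple.append_inj.1 h
          obtain ⟨rfl, rfl⟩ := h'
          rfl⟩
      fun p => by
        obtain ⟨⟨⟨s, t⟩, ⟨b, b'⟩⟩, h⟩ := p
        have h' : S.right s = b ∧ T.right t = b' := Tuple.append_inj.1 h
        obtain ⟨rfl, rfl⟩ := h'
        exact ⟨rfl, rfl⟩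
  braid_symmetry A B := cls_eq (S := (swap A B).comp (swap B A)) (T := SetSpan.id (A * B))
      ⟨fun p => p.1.1.1.append p.1.1.2, fun z => ⟨((z.fst, z.snd), (z.snd, z.fst)), rfl⟩,
        fun p => by
          obtain ⟨⟨⟨a, b⟩, ⟨b', a'⟩⟩, h⟩ := p
          have h' : b = b' ∧ a = a' := Tuple.append_inj.1 h
          obtain ⟨rfl, rfl⟩ := h'
          simp only [Tuple.fst_append, Tuple.snd_append]
          rfl,
        fun z => Tuple.append_fst_snd z⟩
      fun p => by
        obtain ⟨⟨⟨a, b⟩, ⟨b', a'⟩⟩, h⟩ := p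
        have h' : b = b' ∧ a = a' := Tuple.append_inj.1 h
        obtain ⟨rfl, rfl⟩ := h'
        exact ⟨rfl, rfl⟩
  hexagon A B C := by
    let T₃ : SetSpan (B * (A * C)) ((B * C) * A) :=
      ⟨Tuple B × (Tuple A × Tuple C), fun p => p.1.append (p.2.1.append p.2.2),
        fun p => (p.1.append p.2.2).append p.2.1⟩
    let T₂ : SetSpan ((B * A) * C) ((B * C) * A) :=
      ⟨Tuple B × (Tuple A × Tuple C), fun p => (p.1.append p.2.1).append p.2.2,
        fun p => (p.1.append p.2.2).append p.2.1⟩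
    let T₁ : SetSpan ((A * B) * C) ((B * C) * A) :=
      ⟨Tuple B × (Tuple A × Tuple C), fun p => (p.2.1.append p.1).append p.2.2,
        fun p => (p.1.append p.2.2).append p.2.1⟩
    have h₃ : Class.comp (Class.prod (SetSpan.id B).cls (swap A C).cls)
        (eqToHom (mul_assoc B C A).symm) = T₃.cls :=
      cls_comp_eqToHom (mul_assoc B C A).symm ((SetSpan.id B).prod (swap A C)) T₃ (Equiv.refl _)
        fun p => ⟨rfl, Tuple.append_assoc _ _ _⟩
    have h₂ : Class.comp (eqToHom (mul_assoc B A C)) T₃.cls = T₂.cls :=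
      cls_eqToHom_comp (mul_assoc B A C) T₃ T₂ (Equiv.refl _)
        fun p => ⟨Tuple.append_assoc _ _ _, rfl⟩
    have h₁ : Class.comp (Class.prod (swap A B).cls (SetSpan.id C).cls) T₂.cls = T₁.cls :=
      cls_eq (S := ((swap A B).prod (SetSpan.id C)).comp T₂) (T := T₁)
        ⟨fun p => p.1.2, fun q => ⟨(((q.2.1, q.1), q.2.2), q), rfl⟩,
          fun p => by
            obtain ⟨⟨⟨⟨a, b⟩, c⟩, ⟨b', a', c'⟩⟩, h⟩ := p
            have h' : b.append a = b'.append a' ∧ c = c' := Tuple.append_inj.1 h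
            obtain ⟨h', rfl⟩ := h'
            obtain ⟨rfl, rfl⟩ := Tuple.append_inj.1 h'
            rfl,
          fun _ => rfl⟩
        fun p => by
          obtain ⟨⟨⟨⟨a, b⟩, c⟩, ⟨b', a', c'⟩⟩, h⟩ := p
          have h' : b.append a = b'.append a' ∧ c = c' := Tuple.append_inj.1 h
          obtain ⟨h', rfl⟩ := h'
          obtain ⟨rfl, rfl⟩ := Tuple.append_inj.1 h'
          exact ⟨rfl, rfl⟩
    have h₀ : Class.comp (eqToHom (mul_assoc A B C).symm) T₁.cls = (swap A (B * C)).cls :=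
      cls_eqToHom_comp (mul_assoc A B C).symm T₁ (swap A (B * C))
        ⟨fun p => (p.2.1, p.1.append p.2.2), fun p => (p.2.fst, (p.1, p.2.snd)),
          fun p => Prod.ext (Tuple.fst_append _ _) (Prod.ext rfl (Tuple.snd_append _ _)),
          fun p => Prod.ext rfl (Tuple.append_fst_snd _)⟩
        fun p => ⟨(Tuple.append_assoc _ _ _).symm, rfl⟩
    exact (h₀.symm.trans (congrArg _ (h₁.symm.trans (congrArg _ (h₂.symm.trans
      (congrArg _ h₃.symm))))))

end

end SetSpan
/-! ### Internalization -/

/-- Pairs of an object and one of its elements, for a monoid of objects labelled multiplicatively by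
words of sets. -/
structure Marking {M : Type v₁} [Monoid M] (φ : M →* FreeMonoid (Type u)) : Type (max v₁ u) where
  base : M
  elem : Tuple (φ base)

namespace Marking

variable {M : Type v₁} [Monoid M] {φ : M →* FreeMonoid (Type u)}

theorem ext_heq {X Y : Marking φ} (h : X.base = Y.base) (h' : HEq X.elem Y.elem) : X = Y := by
  cases X; cases Y; cases h; cases h'; rfl

/-- The element of a product given by a pair of elements. -/
def pair {X Y : M} (x : Tuple (φ X)) (y : Tuple (φ Y)) : Tuple (φ (X * Y)) :=
  cast (congrArg Tuple (φ.map_mul X Y).symm) (x.append y)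

theorem pair_heq {X Y : M} (x : Tuple (φ X)) (y : Tuple (φ Y)) :
    HEq (pair x y) (x.append y) := cast_heq _ _

theorem pair_congr_heq {X Y X' Y' : M} {x : Tuple (φ X)} {y : Tuple (φ Y)} {x' : Tuple (φ X')}
    {y' : Tuple (φ Y')} (hX : X = X') (hY : Y = Y') (hx : HEq x x') (hy : HEq y y') :
    HEq (pair x y) (pair x' y') := by
  subst hX hY; cases hx; cases hy; rfl

/-- The unique element of the unit object. -/
def point (φ : M →* FreeMonoid (Type u)) : Tuple (φ 1) :=
  cast (congrArg Tuple φ.map_one.symm) (default : Tuple 1)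

theorem eq_point (x : Tuple (φ 1)) : x = point φ := by
  have : Subsingleton (Tuple (φ 1)) := by rw [φ.map_one]; infer_instance
  exact Subsingleton.elim _ _

theorem pair_assoc {X Y Z : M} (x : Tuple (φ X)) (y : Tuple (φ Y)) (z : Tuple (φ Z)) :
    HEq (pair (pair x y) z) (pair x (pair y z)) := by
  refine (pair_heq _ _).trans (HEq.trans ?_ (pair_heq _ _).symm)
  refine (Tuple.append_heq (φ.map_mul _ _) rfl (pair_heq _ _) HEq.rfl).trans ?_
  refine (Tuple.append_assoc x y z).trans ?_
  exact Tuple.append_heq rfl (φ.map_mul _ _).symm HEq.rfl (pair_heq _ _).symm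

theorem pair_point_left {X : M} (x : Tuple (φ X)) : HEq (pair (point φ) x) x :=
  (pair_heq _ _).trans ((Tuple.append_heq φ.map_one rfl (cast_heq _ _) HEq.rfl).trans
    (Tuple.one_append (default : Tuple 1) x))

theorem pair_point_right {X : M} (x : Tuple (φ X)) : HEq (pair x (point φ)) x :=
  (pair_heq _ _).trans ((Tuple.append_heq rfl φ.map_one HEq.rfl (cast_heq _ _)).trans
    (Tuple.append_one x (default : Tuple 1)))

/-- Marked objects are multiplied componentwise. -/
instance : Monoid (Marking φ) where
  mul X Y := ⟨X.base * Y.base, pair X.elem Y.elem⟩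
  one := ⟨1, point φ⟩
  mul_assoc X Y Z := ext_heq (mul_assoc _ _ _) (pair_assoc _ _ _)
  one_mul X := ext_heq (one_mul _) (pair_point_left _)
  mul_one X := ext_heq (mul_one _) (pair_point_right _)

end Marking

namespace SetPartial

variable {C : StrictSymMonCat.{v₁, u₁}} (G : StrictSymMonFunctor C SetPartial.{u})

/-- The words of sets assigned to objects. -/
def words : C.Obj →* FreeMonoid (Type u) where
  toFun := G.obj
  map_one' := G.obj_one
  map_mul' := G.obj_mul

/-- `Sends G f x y`: the partial function assigned to `f` is defined at `x`, with value `y`. -/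
def Sends {X Y : C.Obj} (f : X ⟶ Y) (x : Tuple (G.obj X)) (y : Tuple (G.obj Y)) : Prop :=
  PartialMap.Sends (A := G.obj X) (B := G.obj Y) (G.map f) x y

theorem sends_id {X : C.Obj} {x y : Tuple (G.obj X)} : Sends G (𝟙 X) x y ↔ x = y := by
  unfold Sends
  rw [G.map_id]
  exact PartialMap.sends_id

theorem sends_comp {X Y Z : C.Obj} {f : X ⟶ Y} {g : Y ⟶ Z} {x : Tuple (G.obj X)}
    {z : Tuple (G.obj Z)} :
    Sends G (f ≫ g) x z ↔ ∃ y, Sends G f x y ∧ Sends G g y z := by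
  unfold Sends
  rw [G.map_comp]
  exact PartialMap.sends_comp

theorem sends_tensor {X Y X' Y' : C.Obj} {f : X ⟶ Y} {g : X' ⟶ Y'} {x : Tuple (G.obj X)}
    {y : Tuple (G.obj Y)} {x' : Tuple (G.obj X')} {y' : Tuple (G.obj Y')} :
    Sends G (C.tensor f g) (Marking.pair (φ := words G) x x') (Marking.pair (φ := words G) y y') ↔
      Sends G f x y ∧ Sends G g x' y' :=
  (PartialMap.sends_iff_of_heq (G.obj_mul _ _) (G.obj_mul _ _) (G.map_tensor f g)
    (Marking.pair_heq (φ := words G) x x') (Marking.pair_heq (φ := words G) y y')).trans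
    PartialMap.sends_prod

theorem sends_braid {X Y : C.Obj} (x : Tuple (G.obj X)) (y : Tuple (G.obj Y)) :
    Sends G (C.braid X Y) (Marking.pair (φ := words G) x y)
      (Marking.pair (φ := words G) y x) :=
  (PartialMap.sends_iff_of_heq (G.obj_mul _ _) (G.obj_mul _ _) (G.map_braid X Y)
    (Marking.pair_heq (φ := words G) x y) (Marking.pair_heq (φ := words G) y x)).2
    (PartialMap.sends_swap.2 ⟨rfl, rfl⟩)

/-- Morphisms `(X, x) ⟶ (Y, y)` of the internalization: morphisms `f : X ⟶ Y` whose partial function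
is defined at `x` with value `y`. -/
@[ext]
structure IntHom (X Y : Marking (words G)) : Type v₁ where
  hom : X.base ⟶ Y.base
  sends : Sends G hom X.elem Y.elem

theorem intHom_heq {X Y X' Y' : Marking (words G)} (hX : X = X') (hY : Y = Y') {f : IntHom G X Y}
    {g : IntHom G X' Y'} (h : HEq f.hom g.hom) : HEq f g := by
  subst hX hY
  exact heq_of_eq (IntHom.ext (eq_of_heq h))

/-- The category of elements of a functor to sets and partial functions. -/
abbrev intCategory : Category.{v₁} (Marking (words G)) where
  Hom := IntHom G
  id X := ⟨𝟙 X.base, (sends_id G).2 rfl⟩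
  comp f g := ⟨f.hom ≫ g.hom, (sends_comp G).2 ⟨_, f.sends, g.sends⟩⟩
  id_comp f := IntHom.ext (Category.id_comp f.hom)
  comp_id f := IntHom.ext (Category.comp_id f.hom)
  assoc f g h := IntHom.ext (Category.assoc f.hom g.hom h.hom)

section

attribute [local instance] intCategory

theorem hom_eqToHom {X Y : Marking (words G)} (h : X = Y) :
    IntHom.hom (eqToHom h) = eqToHom (congrArg Marking.base h) := by
  subst h; rfl

/-- The internalization of a functor to sets and partial functions. -/
def internalization : StrictSymMonCat.{v₁, max u₁ u} where
  Obj := Marking (words G)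
  cat := intCategory G
  mon := inferInstance
  tensor f g := ⟨C.tensor (IntHom.hom f) (IntHom.hom g),
    (sends_tensor G).2 ⟨IntHom.sends f, IntHom.sends g⟩⟩
  braid X Y := ⟨C.braid X.base Y.base, sends_braid G X.elem Y.elem⟩
  tensor_id X Y := IntHom.ext (C.tensor_id _ _)
  tensor_comp f g f' g' := IntHom.ext (C.tensor_comp _ _ _ _)
  tensor_assoc f g h := intHom_heq G (mul_assoc _ _ _) (mul_assoc _ _ _) (C.tensor_assoc _ _ _)
  one_tensor f := intHom_heq G (one_mul _) (one_mul _) (C.one_tensor _)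
  tensor_one f := intHom_heq G (mul_one _) (mul_one _) (C.tensor_one _)
  braid_naturality f g := IntHom.ext (C.braid_naturality _ _)
  braid_symmetry X Y := IntHom.ext (C.braid_symmetry _ _)
  hexagon X Y Z := IntHom.ext <| by
    refine (C.hexagon X.base Y.base Z.base).trans ?_
    rw [← hom_eqToHom G (mul_assoc X Y Z).symm, ← hom_eqToHom G (mul_assoc Y X Z),
      ← hom_eqToHom G (mul_assoc Y Z X).symm]
    rfl

end

/-- The lift of `F` to internalizations, `(X, x) ↦ (F X, x)` and `f ↦ F f`. -/
def lift {D : StrictSymMonCat.{v₂, u₂}} (F : StrictSymMonFunctor D C) :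
    StrictSymMonFunctor (internalization (F.comp G)) (internalization G) where
  obj X := ⟨F.obj X.base, X.elem⟩
  map f := ⟨F.map (IntHom.hom f), IntHom.sends f⟩
  map_id _ := IntHom.ext (F.map_id _)
  map_comp _ _ := IntHom.ext (F.map_comp _ _)
  obj_one := Marking.ext_heq F.obj_one
    ((cast_heq _ _).trans (cast_heq _ _).symm)
  obj_mul X Y := Marking.ext_heq (F.obj_mul _ _)
    ((Marking.pair_heq (φ := words (F.comp G)) _ _).trans
      (Marking.pair_heq (φ := words G) X.elem Y.elem).symm)
  map_tensor _ _ := intHom_heq G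
    (Marking.ext_heq (F.obj_mul _ _) ((Marking.pair_heq (φ := words (F.comp G)) _ _).trans
      (Marking.pair_heq (φ := words G) _ _).symm))
    (Marking.ext_heq (F.obj_mul _ _) ((Marking.pair_heq (φ := words (F.comp G)) _ _).trans
      (Marking.pair_heq (φ := words G) _ _).symm))
    (F.map_tensor _ _)
  map_braid _ _ := intHom_heq G
    (Marking.ext_heq (F.obj_mul _ _) ((Marking.pair_heq (φ := words (F.comp G)) _ _).trans
      (Marking.pair_heq (φ := words G) _ _).symm))
    (Marking.ext_heq (F.obj_mul _ _) ((Marking.pair_heq (φ := words (F.comp G)) _ _).trans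
      (Marking.pair_heq (φ := words G) _ _).symm))
    (F.map_braid _ _)

end SetPartial
/-- The elements of the apex of a span that connect `x` to `y`. -/
def SetSpan.Fiber {A B : FreeMonoid (Type u)} (S : SetSpan A B) (x : Tuple A) (y : Tuple B) :
    Type u :=
  { s : S.apex // S.left s = x ∧ S.right s = y }

theorem SetSpan.fiber_equiv_of_heq {A B A' B' : FreeMonoid (Type u)} (hA : A = A') (hB : B = B')
    {S : SetSpan A B} {T : SetSpan A' B'} (h : HEq S.cls T.cls) {x : Tuple A} {y : Tuple B}
    {x' : Tuple A'} {y' : Tuple B'} (hx : HEq x x') (hy : HEq y y') :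
    Nonempty (S.Fiber x y ≃ T.Fiber x' y') := by
  subst hA hB; cases hx; cases hy
  obtain ⟨e, he⟩ := SetSpan.iso_of_cls_eq (eq_of_heq h)
  exact ⟨e.subtypeEquiv fun s => by rw [(he s).1, (he s).2]⟩

namespace SpanCat

/-- The words of sets assigned to objects. -/
def words {C : StrictSymMonCat.{v₁, u₁}} (G : StrictSymMonFunctor C SpanCat.{u}) :
    C.Obj →* FreeMonoid (Type u) where
  toFun := G.obj
  map_one' := G.obj_one
  map_mul' := G.obj_mul

/-- A coherent choice of apexes for a strict symmetric monoidal functor `G` to the 1-category of sets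
and spans.  Since a morphism there is only an isomorphism class of spans, it has an apex only once a
representing span has been chosen, and the apex of `f ≫ g` (of a tensor product) is only abstractly
isomorphic to the pullback (the product) of the apexes of the factors.  The data consist of a
representing span for every `G f` and of such isomorphisms, given fibrewise over pairs of elements
`(x, y)`, which are required to be associative, unital, functorial and compatible with symmetries. -/
structure ApexChoice {C : StrictSymMonCat.{v₁, u₁}} (G : StrictSymMonFunctor C SpanCat.{u}) :
    Type (max u₁ v₁ (u + 1)) where
  span : ∀ {X Y : C.Obj}, (X ⟶ Y) → SetSpan (words G X) (words G Y)
  cls_span : ∀ {X Y : C.Obj} (f : X ⟶ Y), (span f).cls = G.map f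
  /-- `S_f ×_Y S_g ≃ S_{f ≫ g}` -/
  comp : ∀ {X Y Z : C.Obj} {f : X ⟶ Y} {g : Y ⟶ Z} {x : Tuple (words G X)} {y : Tuple (words G Y)}
    {z : Tuple (words G Z)},
    (span f).Fiber x y → (span g).Fiber y z → (span (f ≫ g)).Fiber x z
  comp_bijective : ∀ {X Y Z : C.Obj} (f : X ⟶ Y) (g : Y ⟶ Z) (x : Tuple (words G X))
    (z : Tuple (words G Z)),
    Function.Bijective fun p : Σ y : Tuple (words G Y), (span f).Fiber x y × (span g).Fiber y z =>
      comp p.2.1 p.2.2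
  /-- `S_f × S_g ≃ S_{f ⊗ g}` -/
  tensor : ∀ {X Y X' Y' : C.Obj} {f : X ⟶ Y} {g : X' ⟶ Y'} {x : Tuple (words G X)}
    {y : Tuple (words G Y)} {x' : Tuple (words G X')} {y' : Tuple (words G Y')},
    (span f).Fiber x y → (span g).Fiber x' y' →
      (span (C.tensor f g)).Fiber (Marking.pair x x') (Marking.pair y y')
  tensor_bijective : ∀ {X Y X' Y' : C.Obj} (f : X ⟶ Y) (g : X' ⟶ Y') (x : Tuple (words G X))
    (y : Tuple (words G Y)) (x' : Tuple (words G X')) (y' : Tuple (words G Y')),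
    Function.Bijective fun p : (span f).Fiber x y × (span g).Fiber x' y' => tensor p.1 p.2
  id_comp : ∀ {X Y : C.Obj} {f : X ⟶ Y} {x : Tuple (words G X)} {y : Tuple (words G Y)}
    (e : (span (𝟙 X)).Fiber x x) (s : (span f).Fiber x y), HEq (comp e s) s
  comp_id : ∀ {X Y : C.Obj} {f : X ⟶ Y} {x : Tuple (words G X)} {y : Tuple (words G Y)}
    (s : (span f).Fiber x y) (e : (span (𝟙 Y)).Fiber y y), HEq (comp s e) s
  comp_assoc : ∀ {X Y Z W : C.Obj} {f : X ⟶ Y} {g : Y ⟶ Z} {h : Z ⟶ W} {x : Tuple (words G X)}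
    {y : Tuple (words G Y)} {z : Tuple (words G Z)} {w : Tuple (words G W)}
    (r : (span f).Fiber x y) (s : (span g).Fiber y z) (t : (span h).Fiber z w),
    HEq (comp (comp r s) t) (comp r (comp s t))
  tensor_comp : ∀ {X Y Z X' Y' Z' : C.Obj} {f : X ⟶ Y} {g : Y ⟶ Z} {f' : X' ⟶ Y'} {g' : Y' ⟶ Z'}
    {x : Tuple (words G X)} {y : Tuple (words G Y)} {z : Tuple (words G Z)}
    {x' : Tuple (words G X')} {y' : Tuple (words G Y')} {z' : Tuple (words G Z')}
    (s : (span f).Fiber x y) (t : (span g).Fiber y z) (s' : (span f').Fiber x' y')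
    (t' : (span g').Fiber y' z'),
    HEq (tensor (comp s t) (comp s' t')) (comp (tensor s s') (tensor t t'))
  tensor_assoc : ∀ {X Y X' Y' X'' Y'' : C.Obj} {f : X ⟶ Y} {g : X' ⟶ Y'} {h : X'' ⟶ Y''}
    {x : Tuple (words G X)} {y : Tuple (words G Y)} {x' : Tuple (words G X')}
    {y' : Tuple (words G Y')} {x'' : Tuple (words G X'')} {y'' : Tuple (words G Y'')}
    (r : (span f).Fiber x y) (s : (span g).Fiber x' y') (t : (span h).Fiber x'' y''),
    HEq (tensor (tensor r s) t) (tensor r (tensor s t))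
  one_tensor : ∀ {X Y : C.Obj} {f : X ⟶ Y} {x : Tuple (words G X)} {y : Tuple (words G Y)}
    (e : (span (𝟙 1)).Fiber (Marking.point (words G)) (Marking.point (words G)))
    (s : (span f).Fiber x y), HEq (tensor e s) s
  tensor_one : ∀ {X Y : C.Obj} {f : X ⟶ Y} {x : Tuple (words G X)} {y : Tuple (words G Y)}
    (s : (span f).Fiber x y)
    (e : (span (𝟙 1)).Fiber (Marking.point (words G)) (Marking.point (words G))),
    HEq (tensor s e) s
  braid_naturality : ∀ {X Y X' Y' : C.Obj} {f : X ⟶ Y} {g : X' ⟶ Y'}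
    {x : Tuple (words G X)} {y : Tuple (words G Y)} {x' : Tuple (words G X')}
    {y' : Tuple (words G Y')} (s : (span f).Fiber x y) (t : (span g).Fiber x' y')
    (b : (span (C.braid Y Y')).Fiber (Marking.pair y y') (Marking.pair y' y))
    (b' : (span (C.braid X X')).Fiber (Marking.pair x x') (Marking.pair x' x)),
    HEq (comp (tensor s t) b) (comp b' (tensor t s))

namespace ApexChoice

variable {C : StrictSymMonCat.{v₁, u₁}} {G : StrictSymMonFunctor C SpanCat.{u}} (R : ApexChoice G)

theorem fiber_id (X : C.Obj) (x y : Tuple (words G X)) :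
    Nonempty ((R.span (𝟙 X)).Fiber x y ≃ (SetSpan.id (words G X)).Fiber x y) :=
  SetSpan.fiber_equiv_of_heq rfl rfl (heq_of_eq ((R.cls_span (𝟙 X)).trans (G.map_id X)))
    HEq.rfl HEq.rfl

theorem fiber_braid (X Y : C.Obj) (x : Tuple (words G X)) (y : Tuple (words G Y)) :
    Nonempty ((R.span (C.braid X Y)).Fiber (Marking.pair x y) (Marking.pair y x) ≃
      (SetSpan.swap (words G X) (words G Y)).Fiber (x.append y) (y.append x)) :=
  SetSpan.fiber_equiv_of_heq ((words G).map_mul _ _) ((words G).map_mul _ _)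
    ((heq_of_eq (R.cls_span (C.braid X Y))).trans (G.map_braid X Y))
    (Marking.pair_heq _ _) (Marking.pair_heq _ _)

instance subsingleton_fiber_id (X : C.Obj) (x y : Tuple (words G X)) : Subsingleton ((R.span (𝟙 X)).Fiber x y) := by
  obtain ⟨e⟩ := R.fiber_id X x y
  refine e.subsingleton_congr.2 ⟨fun s t => Subtype.ext ?_⟩
  exact s.2.1.trans t.2.1.symm

instance subsingleton_fiber_braid (X Y : C.Obj) (x : Tuple (words G X)) (y : Tuple (words G Y)) :
    Subsingleton ((R.span (C.braid X Y)).Fiber (Marking.pair x y) (Marking.pair y x)) := by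
  obtain ⟨e⟩ := R.fiber_braid X Y x y
  refine e.subsingleton_congr.2 ⟨fun s t => Subtype.ext ?_⟩
  obtain ⟨h, h'⟩ := Tuple.append_inj.1 (s.2.1.trans t.2.1.symm)
  exact Prod.ext h h'

/-- The element of the apex of an identity at `x`. -/
noncomputable def unit (X : C.Obj) (x : Tuple (words G X)) : (R.span (𝟙 X)).Fiber x x :=
  (R.fiber_id X x x).some.symm ⟨x, rfl, rfl⟩

/-- The element of the apex of a symmetry at `(x, y)`. -/
noncomputable def braid (X Y : C.Obj) (x : Tuple (words G X)) (y : Tuple (words G Y)) :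
    (R.span (C.braid X Y)).Fiber (Marking.pair x y) (Marking.pair y x) :=
  (R.fiber_braid X Y x y).some.symm ⟨(x, y), rfl, rfl⟩

/-- Morphisms `(X, x) ⟶ (Y, y)` of the internalization: pairs of a morphism `f : X ⟶ Y` and an
element of the apex of the span of `f` connecting `x` to `y`. -/
structure IntHom (X Y : Marking (words G)) : Type (max v₁ u) where
  hom : X.base ⟶ Y.base
  point : (R.span hom).Fiber X.elem Y.elem

theorem intHom_ext {X Y : Marking (words G)} {f g : R.IntHom X Y} (h : f.hom = g.hom)
    (h' : HEq f.point g.point) : f = g := by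
  cases f; cases g; cases h; cases h'; rfl

theorem intHom_ext_of_subsingleton {X Y : Marking (words G)} {f g : R.IntHom X Y}
    (h : f.hom = g.hom) (h' : Subsingleton ((R.span f.hom).Fiber X.elem Y.elem)) : f = g := by
  obtain ⟨f, s⟩ := f
  obtain ⟨g, t⟩ := g
  obtain rfl : f = g := h
  exact R.intHom_ext rfl (heq_of_eq (h'.elim s t))

theorem intHom_heq {X Y X' Y' : Marking (words G)} (hX : X = X') (hY : Y = Y')
    {f : R.IntHom X Y} {g : R.IntHom X' Y'} (h : HEq f.hom g.hom) (h' : HEq f.point g.point) :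
    HEq f g := by
  subst hX hY
  exact heq_of_eq (R.intHom_ext (eq_of_heq h) h')

/-- The category of elements of a functor to sets and spans. -/
noncomputable abbrev intCategory : Category.{max v₁ u} (Marking (words G)) where
  Hom := R.IntHom
  id X := ⟨𝟙 X.base, R.unit X.base X.elem⟩
  comp f g := ⟨f.hom ≫ g.hom, R.comp f.point g.point⟩
  id_comp f := R.intHom_ext (Category.id_comp f.hom) (R.id_comp _ _)
  comp_id f := R.intHom_ext (Category.comp_id f.hom) (R.comp_id _ _)
  assoc f g h := R.intHom_ext (Category.assoc f.hom g.hom h.hom) (R.comp_assoc _ _ _)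

theorem hom_eqToHom {X Y : Marking (words G)} (h : X = Y) :
    letI := R.intCategory
    IntHom.hom (eqToHom h) = eqToHom (congrArg Marking.base h) := by
  subst h; rfl

/-- The internalization of a functor to sets and spans. -/
noncomputable def internalization : StrictSymMonCat.{max v₁ u, max u₁ u} where
  Obj := Marking (words G)
  cat := R.intCategory
  mon := inferInstance
  tensor f g := ⟨C.tensor (IntHom.hom f) (IntHom.hom g),
    R.tensor (IntHom.point f) (IntHom.point g)⟩
  braid X Y := ⟨C.braid X.base Y.base, R.braid X.base Y.base X.elem Y.elem⟩
  tensor_id X Y := (R.intHom_ext_of_subsingleton (C.tensor_id X.base Y.base).symm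
    (inferInstanceAs (Subsingleton ((R.span (𝟙 (X.base * Y.base))).Fiber _ _)))).symm
  tensor_comp f g f' g' := R.intHom_ext (C.tensor_comp _ _ _ _) (R.tensor_comp _ _ _ _)
  tensor_assoc f g h := R.intHom_heq (mul_assoc _ _ _) (mul_assoc _ _ _) (C.tensor_assoc _ _ _)
    (R.tensor_assoc _ _ _)
  one_tensor f := R.intHom_heq (one_mul _) (one_mul _) (C.one_tensor _) (R.one_tensor _ _)
  tensor_one f := R.intHom_heq (mul_one _) (mul_one _) (C.tensor_one _) (R.tensor_one _ _)
  braid_naturality f g := R.intHom_ext (C.braid_naturality _ _) (R.braid_naturality _ _ _ _)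
  braid_symmetry X Y := (R.intHom_ext_of_subsingleton (C.braid_symmetry X.base Y.base).symm
    (inferInstanceAs (Subsingleton ((R.span (𝟙 (X.base * Y.base))).Fiber _ _)))).symm
  hexagon X Y Z := by
    refine R.intHom_ext_of_subsingleton ?_ (inferInstanceAs (Subsingleton
      ((R.span (C.braid X.base (Y * Z).base)).Fiber (Marking.pair X.elem (Y * Z).elem)
        (Marking.pair (Y * Z).elem X.elem))))
    refine (C.hexagon X.base Y.base Z.base).trans ?_
    rw [← R.hom_eqToHom (mul_assoc X Y Z).symm, ← R.hom_eqToHom (mul_assoc Y X Z),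
      ← R.hom_eqToHom (mul_assoc Y Z X).symm]
    rfl

theorem fiber_congr {X Y X' Y' : C.Obj} (hX : X = X') (hY : Y = Y') {f : X ⟶ Y} {f' : X' ⟶ Y'}
    (hf : HEq f f') {x : Tuple (words G X)} {y : Tuple (words G Y)} {x' : Tuple (words G X')}
    {y' : Tuple (words G Y')} (hx : HEq x x') (hy : HEq y y') :
    (R.span f).Fiber x y = (R.span f').Fiber x' y' := by
  subst hX hY; cases hf; cases hx; cases hy; rfl

theorem comp_congr_heq {X Y Z X' Y' Z' : C.Obj} (hX : X = X') (hY : Y = Y') (hZ : Z = Z')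
    {f : X ⟶ Y} {g : Y ⟶ Z} {f' : X' ⟶ Y'} {g' : Y' ⟶ Z'} (hf : HEq f f') (hg : HEq g g')
    {x : Tuple (words G X)} {y : Tuple (words G Y)} {z : Tuple (words G Z)}
    {x' : Tuple (words G X')} {y' : Tuple (words G Y')} {z' : Tuple (words G Z')}
    (hx : HEq x x') (hy : HEq y y') (hz : HEq z z')
    {s : (R.span f).Fiber x y} {t : (R.span g).Fiber y z} {s' : (R.span f').Fiber x' y'}
    {t' : (R.span g').Fiber y' z'} (hs : HEq s s') (ht : HEq t t') :
    HEq (R.comp s t) (R.comp s' t') := by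
  subst hX hY hZ; cases hf; cases hg; cases hx; cases hy; cases hz; cases hs; cases ht; rfl

theorem tensor_congr_heq {X₁ Y₁ X₁' Y₁' X₂ Y₂ X₂' Y₂' : C.Obj} (hX₁ : X₁ = X₁') (hY₁ : Y₁ = Y₁')
    (hX₂ : X₂ = X₂') (hY₂ : Y₂ = Y₂')
    {f : X₁ ⟶ Y₁} {g : X₂ ⟶ Y₂} {f' : X₁' ⟶ Y₁'} {g' : X₂' ⟶ Y₂'} (hf : HEq f f') (hg : HEq g g')
    {x₁ : Tuple (words G X₁)} {y₁ : Tuple (words G Y₁)} {x₂ : Tuple (words G X₂)}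
    {y₂ : Tuple (words G Y₂)} {x₁' : Tuple (words G X₁')} {y₁' : Tuple (words G Y₁')}
    {x₂' : Tuple (words G X₂')} {y₂' : Tuple (words G Y₂')}
    (hx₁ : HEq x₁ x₁') (hy₁ : HEq y₁ y₁') (hx₂ : HEq x₂ x₂') (hy₂ : HEq y₂ y₂')
    {s : (R.span f).Fiber x₁ y₁} {t : (R.span g).Fiber x₂ y₂} {s' : (R.span f').Fiber x₁' y₁'}
    {t' : (R.span g').Fiber x₂' y₂'} (hs : HEq s s') (ht : HEq t t') :
    HEq (R.tensor s t) (R.tensor s' t') := by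
  subst hX₁ hY₁ hX₂ hY₂
  cases hf; cases hg; cases hx₁; cases hy₁; cases hx₂; cases hy₂; cases hs; cases ht; rfl

section pullback

variable {D : StrictSymMonCat.{v₂, u₂}} (F : StrictSymMonFunctor D C)

theorem pair_comp_heq {X Y : D.Obj} (x : Tuple (words (F.comp G) X))
    (y : Tuple (words (F.comp G) Y)) :
    HEq (Marking.pair x y)
      (Marking.pair (φ := words G) (X := F.obj X) (Y := F.obj Y) x y) :=
  (Marking.pair_heq x y).trans (Marking.pair_heq (φ := words G) _ _).symm

theorem point_comp_heq : HEq (Marking.point (words (F.comp G))) (Marking.point (words G)) :=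
  (cast_heq _ _).trans (cast_heq _ _).symm

/-- The choice of apexes for `F ⋙ G` induced by one for `G`: the span of `f` is that of `F f`. -/
def pullback : ApexChoice (F.comp G) where
  span f := R.span (F.map f)
  cls_span f := R.cls_span (F.map f)
  comp {X Y Z f g x y z} s t := cast (R.fiber_congr (X := F.obj X) (Y := F.obj Z) rfl rfl
    (heq_of_eq (F.map_comp f g).symm) HEq.rfl HEq.rfl) (R.comp s t)
  comp_bijective f g x z := (cast_bijective _).comp
    (R.comp_bijective (F.map f) (F.map g) x z)
  tensor {X Y X' Y' f g x y x' y'} s t := cast (R.fiber_congr (F.obj_mul _ _).symm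
    (F.obj_mul _ _).symm (F.map_tensor f g).symm (pair_comp_heq F x x').symm
    (pair_comp_heq F y y').symm) (R.tensor s t)
  tensor_bijective f g x y x' y' := (cast_bijective _).comp
    (R.tensor_bijective (F.map f) (F.map g) x y x' y')
  id_comp {X Y f x y} e s := by
    have h := R.fiber_congr (X := F.obj X) (Y := F.obj X) rfl rfl (heq_of_eq (F.map_id X))
      (x := x) (y := x) HEq.rfl HEq.rfl
    exact (cast_heq _ _).trans ((R.comp_congr_heq (X := F.obj X) (Y := F.obj X) (Z := F.obj Y)
      rfl rfl rfl (heq_of_eq (F.map_id X)) HEq.rfl HEq.rfl HEq.rfl HEq.rfl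
      (cast_heq h e).symm HEq.rfl).trans (R.id_comp (cast h e) s))
  comp_id {X Y f x y} s e := by
    have h := R.fiber_congr (X := F.obj Y) (Y := F.obj Y) rfl rfl (heq_of_eq (F.map_id Y))
      (x := y) (y := y) HEq.rfl HEq.rfl
    exact (cast_heq _ _).trans ((R.comp_congr_heq (X := F.obj X) (Y := F.obj Y) (Z := F.obj Y)
      rfl rfl rfl HEq.rfl (heq_of_eq (F.map_id Y)) HEq.rfl HEq.rfl HEq.rfl
      HEq.rfl (cast_heq h e).symm).trans (R.comp_id s (cast h e)))
  comp_assoc {X Y Z W f g h x y z w} r s t := by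
    refine (cast_heq _ _).trans (HEq.trans ?_ (cast_heq _ _).symm)
    refine (R.comp_congr_heq (X := F.obj X) (Y := F.obj Z) (Z := F.obj W) rfl rfl rfl
      (heq_of_eq (F.map_comp f g)) HEq.rfl HEq.rfl HEq.rfl HEq.rfl (cast_heq _ _) HEq.rfl).trans ?_
    refine (R.comp_assoc r s t).trans (HEq.symm ?_)
    exact R.comp_congr_heq (X := F.obj X) (Y := F.obj Y) (Z := F.obj W) rfl rfl rfl
      HEq.rfl (heq_of_eq (F.map_comp g h)) HEq.rfl HEq.rfl HEq.rfl HEq.rfl (cast_heq _ _)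
  tensor_comp {X Y Z X' Y' Z' f g f' g' x y z x' y' z'} s t s' t' := by
    refine (cast_heq _ _).trans (HEq.trans ?_ (cast_heq _ _).symm)
    refine (R.tensor_congr_heq (X₁ := F.obj X) (Y₁ := F.obj Z) (X₂ := F.obj X') (Y₂ := F.obj Z')
      rfl rfl rfl rfl (heq_of_eq (F.map_comp f g)) (heq_of_eq (F.map_comp f' g')) HEq.rfl HEq.rfl
      HEq.rfl HEq.rfl (cast_heq _ _) (cast_heq _ _)).trans ?_
    refine (R.tensor_comp s t s' t').trans (HEq.symm ?_)
    exact R.comp_congr_heq (F.obj_mul _ _) (F.obj_mul _ _) (F.obj_mul _ _) (F.map_tensor _ _)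
      (F.map_tensor _ _) (pair_comp_heq F _ _) (pair_comp_heq F _ _) (pair_comp_heq F _ _)
      (cast_heq _ _) (cast_heq _ _)
  tensor_assoc {X Y X' Y' X'' Y'' f g h x y x' y' x'' y''} r s t := by
    refine (cast_heq _ _).trans (HEq.trans ?_ (cast_heq _ _).symm)
    refine (R.tensor_congr_heq (F.obj_mul _ _) (F.obj_mul _ _) rfl rfl (F.map_tensor _ _) HEq.rfl
      (pair_comp_heq F _ _) (pair_comp_heq F _ _) HEq.rfl HEq.rfl (cast_heq _ _) HEq.rfl).trans ?_
    refine (R.tensor_assoc r s t).trans (HEq.symm ?_)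
    exact R.tensor_congr_heq rfl rfl (F.obj_mul _ _) (F.obj_mul _ _) HEq.rfl (F.map_tensor _ _)
      HEq.rfl HEq.rfl (pair_comp_heq F _ _) (pair_comp_heq F _ _) HEq.rfl (cast_heq _ _)
  one_tensor {X Y f x y} e s := by
    have hf : HEq (F.map (𝟙 (1 : D.Obj))) (𝟙 (1 : C.Obj)) := by
      rw [F.map_id, F.obj_one]
    have h := R.fiber_congr F.obj_one F.obj_one hf (point_comp_heq (G := G) F)
      (point_comp_heq (G := G) F)
    exact (cast_heq _ _).trans ((R.tensor_congr_heq F.obj_one F.obj_one rfl rfl hf HEq.rfl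
      (point_comp_heq (G := G) F) (point_comp_heq (G := G) F) HEq.rfl HEq.rfl
      (cast_heq h e).symm HEq.rfl).trans (R.one_tensor (cast h e) s))
  tensor_one {X Y f x y} s e := by
    have hf : HEq (F.map (𝟙 (1 : D.Obj))) (𝟙 (1 : C.Obj)) := by
      rw [F.map_id, F.obj_one]
    have h := R.fiber_congr F.obj_one F.obj_one hf (point_comp_heq (G := G) F)
      (point_comp_heq (G := G) F)
    exact (cast_heq _ _).trans ((R.tensor_congr_heq rfl rfl F.obj_one F.obj_one HEq.rfl hf
      HEq.rfl HEq.rfl (point_comp_heq (G := G) F) (point_comp_heq (G := G) F)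
      HEq.rfl (cast_heq h e).symm).trans (R.tensor_one s (cast h e)))
  braid_naturality {X Y X' Y' f g x y x' y'} s t b b' := by
    have h := R.fiber_congr (F.obj_mul Y Y') (F.obj_mul Y' Y) (F.map_braid Y Y')
      (pair_comp_heq (G := G) F y y') (pair_comp_heq (G := G) F y' y)
    have h' := R.fiber_congr (F.obj_mul X X') (F.obj_mul X' X) (F.map_braid X X')
      (pair_comp_heq (G := G) F x x') (pair_comp_heq (G := G) F x' x)
    refine (cast_heq _ _).trans (HEq.trans ?_ (cast_heq _ _).symm)
    refine (R.comp_congr_heq (F.obj_mul _ _) (F.obj_mul _ _) (F.obj_mul _ _) (F.map_tensor _ _)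
      (F.map_braid _ _) (pair_comp_heq F _ _) (pair_comp_heq F _ _) (pair_comp_heq F _ _)
      (cast_heq _ _) (cast_heq h b).symm).trans ?_
    refine (R.braid_naturality s t (cast h b) (cast h' b')).trans (HEq.symm ?_)
    exact R.comp_congr_heq (F.obj_mul _ _) (F.obj_mul _ _) (F.obj_mul _ _) (F.map_braid _ _)
      (F.map_tensor _ _) (pair_comp_heq F _ _) (pair_comp_heq F _ _) (pair_comp_heq F _ _)
      (cast_heq h' b').symm (cast_heq _ _)

/-- The lift of `F` to internalizations, `(X, x) ↦ (F X, x)` and `(f, s) ↦ (F f, s)`. -/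
noncomputable def lift :
    StrictSymMonFunctor (R.pullback F).internalization R.internalization where
  obj X := ⟨F.obj X.base, X.elem⟩
  map f := ⟨F.map (IntHom.hom f), IntHom.point f⟩
  map_id X := R.intHom_ext_of_subsingleton (f := (⟨𝟙 _, R.unit _ _⟩ : R.IntHom _ _))
    (F.map_id X.base).symm
    (inferInstanceAs (Subsingleton ((R.span (𝟙 (F.obj X.base))).Fiber _ _))) |>.symm
  map_comp f g := R.intHom_ext (F.map_comp _ _) (cast_heq _ _)
  obj_one := Marking.ext_heq F.obj_one (point_comp_heq F)
  obj_mul X Y := Marking.ext_heq (F.obj_mul _ _) (pair_comp_heq F _ _)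
  map_tensor f g := R.intHom_heq (Marking.ext_heq (F.obj_mul _ _) (pair_comp_heq F _ _))
    (Marking.ext_heq (F.obj_mul _ _) (pair_comp_heq F _ _)) (F.map_tensor _ _) (cast_heq _ _)
  map_braid X Y := by
    refine R.intHom_heq (Marking.ext_heq (F.obj_mul _ _) (pair_comp_heq F _ _))
      (Marking.ext_heq (F.obj_mul _ _) (pair_comp_heq F _ _)) (F.map_braid _ _) ?_
    have h := R.fiber_congr (F.obj_mul X.base Y.base) (F.obj_mul Y.base X.base)
      (F.map_braid X.base Y.base) (pair_comp_heq (G := G) F X.elem Y.elem)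
      (pair_comp_heq (G := G) F Y.elem X.elem)
    exact (cast_heq h _).symm.trans (heq_of_eq
      ((R.subsingleton_fiber_braid (F.obj X.base) (F.obj Y.base) X.elem Y.elem).elim _ _))

end pullback

end ApexChoice

end SpanCat
/-! ### Addition of generating morphisms -/

/-- A Petri net with `S`-semantics. -/
structure NetWithSemantics (S : StrictSymMonCat.{v, u₁}) : Type (max v u₁ (u + 1)) where
  net : PetriNet.{u}
  sem : StrictSymMonFunctor net.free S

/-- `M` is an addition of generating morphisms to `K` via `W` and `w`. -/
structure NetWithSemantics.IsAddition {S : StrictSymMonCat.{v, u₁}}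
    (M K : NetWithSemantics.{v, u, u₁} S) (W : PetriNet.{u})
    (w : StrictSymMonFunctor W.free K.net.free) : Prop where
  map_generator : ∀ p : W.place, ∃ q : K.net.place,
    w.obj (FreeMonoid.of p : FreeMonoid W.place) = (FreeMonoid.of q : FreeMonoid K.net.place)
  injective : Function.Injective w.obj
  faithful : w.toFunctor.Faithful
  /-- `M` is the pushout of the inclusion of the net without transitions followed by `w` and of that
  inclusion, with the semantics induced by that of `K` and by `w ⋙ K.sem`. -/
  exists_pushout : ∃ (ι₁ : StrictSymMonFunctor K.net.free M.net.free)
    (ι₂ : StrictSymMonFunctor W.free M.net.free),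
    IsPushout (C := StrictSymMonCat.{u, u}) (W.incl.comp w) W.incl ι₁ ι₂ ∧
      ι₁.comp M.sem = K.sem ∧ ι₂.comp M.sem = w.comp K.sem

/-- A Petri net whose free strict symmetric monoidal category is `C`, up to isomorphism. -/
structure NetPresentation (C : StrictSymMonCat.{u, u}) : Type (u + 1) where
  net : PetriNet.{u}
  iso : net.free ≅ C

/-- The presenting net, regarded as a net with semantics in the terminal category. -/
noncomputable def NetPresentation.plain {C : StrictSymMonCat.{u, u}} (P : NetPresentation C) :
    NetWithSemantics.{0, u, 0} StrictSymMonCat.terminal.{0, 0} :=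
  ⟨P.net, StrictSymMonFunctor.toTerminal _⟩

/-- The categories `A`, `B`, `D` are free strict symmetric monoidal categories on Petri nets, and the
net of `A` is an addition of generating morphisms to the net of `B` via the net of `D` and the
functor `h`. -/
def StrictSymMonCat.IsAddition (A B D : StrictSymMonCat.{u, u}) (h : StrictSymMonFunctor D B) :
    Prop :=
  Nonempty (NetPresentation A) ∧ Nonempty (NetPresentation B) ∧ Nonempty (NetPresentation D) ∧
    ∀ (P : NetPresentation A) (Q : NetPresentation B) (V : NetPresentation D),
      P.plain.IsAddition Q.plain V.net
        ((StrictSymMonFunctor.comp V.iso.hom h).comp Q.iso.inv)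

/-! Fix a functor `G` from `C` to spans with a coherent choice `R` of apexes. By coherence, every
element of the apex of `f ≫ g` or of `f ⊗ g` factors uniquely into elements of the apexes of the
factors. Thanks to this, every strict symmetric monoidal category `T` has a category `R.families T`
over `C`: an object is an `X` in `C` with a family of objects of `T` indexed by the elements of `G
X`, and a morphism is an `f` with a family of morphisms of `T` indexed by the apex of `f`. For `h :
H → C`, functors `∫(h;G) → T` are the same as functors `H → R.families T` over `C` (`transpose`,
`transpose_injective`, `exists_transpose_eq`). Internalization thus behaves like a left adjoint on
categories over `C`, and universal properties of `H` pass to `∫(h;G)`.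

This has two consequences. (1) If `C` is free, then `∫G` is free on places with an element and
transitions with an apex element (`exists_iso_scheme`); the order of the letters in sources and
targets is immaterial, so it is free on a Petri net (`exists_free_iso`). Hence, up to an isomorphism
fixing objects, `∫G` does not depend on the choice of apexes (`exists_iso_of_choices`). (2) If `M`
is a pushout of `K` and `W` over the places of `W`, then functors out of `∫M` are pairs of functors
out of the internalizations over `K` and over `W` that agree on objects (`existsUnique_desc`).

In the lemma, the choices for `K` and `W` pulled back from `M` may differ from the prescribed ones.
By (1) the internalizations are isomorphic by isomorphisms fixing objects. No compatibility of these
with the lift of `w` on morphisms is needed: the corner of the pushout square is free on places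
alone, and functors out of it are determined by objects. Arbitrary presenting nets are handled by
recognizing generating objects as the indecomposable elements of the monoid of objects. Injectivity
and faithfulness of the lift come directly from those of `w`.

Partial functions reduce to spans through their graphs, whose fibres have at most one element
(`SetPartial.internalizationIso`). -/

/-! ### Heterogeneous equalities in strict symmetric monoidal categories -/

/-- A morphism with its endpoints replaced by equal objects. -/
def castHom {C : Type u} [Category.{v} C] {X Y X' Y' : C} (hX : X' = X) (hY : Y' = Y)
    (f : X ⟶ Y) : X' ⟶ Y' := eqToHom hX ≫ f ≫ eqToHom hY.symm

theorem castHom_heq {C : Type u} [Category.{v} C] {X Y X' Y' : C} (hX : X' = X) (hY : Y' = Y)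
    (f : X ⟶ Y) : HEq (castHom hX hY f) f := by
  subst hX hY; simp [castHom]

theorem id_heq {C : Type u} [Category.{v} C] {X Y : C} (h : X = Y) : HEq (𝟙 X) (𝟙 Y) := by
  subst h; rfl

namespace StrictSymMonCat

variable {C : StrictSymMonCat.{v, u}}

theorem tensor_heq {X Y X' Y' A B A' B' : C.Obj} {f : X ⟶ Y} {g : X' ⟶ Y'} {f' : A ⟶ B}
    {g' : A' ⟶ B'} (h₁ : X = A) (h₂ : Y = B) (h₃ : X' = A') (h₄ : Y' = B') (hf : HEq f f')
    (hg : HEq g g') : HEq (C.tensor f g) (C.tensor f' g') := by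
  subst h₁ h₂ h₃ h₄; cases hf; cases hg; rfl

theorem braid_heq {X Y A B : C.Obj} (h₁ : X = A) (h₂ : Y = B) :
    HEq (C.braid X Y) (C.braid A B) := by
  subst h₁ h₂; rfl

/-- The reassociations in the axiom are absorbed into `p` and `q`, each of which is forced to be the
corresponding `castHom`. In this form the hexagon can be transported along equalities of objects
factor by factor. -/
theorem hexagon_of_heq (X Y Z : C.Obj) {p : X * (Y * Z) ⟶ Y * (X * Z)}
    {q : Y * (X * Z) ⟶ Y * Z * X} (hp : HEq p (C.tensor (C.braid X Y) (𝟙 Z)))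
    (hq : HEq q (C.tensor (𝟙 Y) (C.braid X Z))) : C.braid X (Y * Z) = p ≫ q := by
  have hp' : p = castHom (mul_assoc X Y Z).symm (mul_assoc Y X Z).symm
      (C.tensor (C.braid X Y) (𝟙 Z)) := eq_of_heq (hp.trans (castHom_heq _ _ _).symm)
  have hq' : q = castHom rfl (mul_assoc Y Z X) (C.tensor (𝟙 Y) (C.braid X Z)) :=
    eq_of_heq (hq.trans (castHom_heq _ _ _).symm)
  rw [C.hexagon, hp', hq']
  simp [castHom]

end StrictSymMonCat

/-- The functor underlying a morphism. -/
abbrev StrictSymMonCat.toFun {C D : StrictSymMonCat.{v, u}} (F : C ⟶ D) :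
    StrictSymMonFunctor C D := F

namespace StrictSymMonFunctor

theorem ext_heq {C : StrictSymMonCat.{v₁, u₁}} {D : StrictSymMonCat.{v₂, u₂}}
    {F G : StrictSymMonFunctor C D} (h : ∀ X, F.obj X = G.obj X)
    (h' : ∀ {X Y : C.Obj} (f : X ⟶ Y), HEq (F.map f) (G.map f)) : F = G := by
  have : F.toFunctor = G.toFunctor := Functor.hext h fun _ _ f => h' f
  cases F; cases G; cases this; rfl

theorem obj_congr {C : StrictSymMonCat.{v₁, u₁}} {D : StrictSymMonCat.{v₂, u₂}}
    {F G : StrictSymMonFunctor C D} (h : F = G) (X : C.Obj) : F.obj X = G.obj X := by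
  rw [h]

theorem map_congr {C : StrictSymMonCat.{v₁, u₁}} {D : StrictSymMonCat.{v₂, u₂}}
    {F G : StrictSymMonFunctor C D} (h : F = G) {X Y : C.Obj} (f : X ⟶ Y) :
    HEq (F.map f) (G.map f) := by
  rw [h]

/-- The homomorphism between the monoids of objects. -/
def objHom {C : StrictSymMonCat.{v₁, u₁}} {D : StrictSymMonCat.{v₂, u₂}}
    (F : StrictSymMonFunctor C D) : C.Obj →* D.Obj where
  toFun := F.obj
  map_one' := F.obj_one
  map_mul' := F.obj_mul

end StrictSymMonFunctor

/-! ### The universal property of free strict symmetric monoidal categories -/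

namespace TensorScheme

variable {N : TensorScheme.{u}} {T : StrictSymMonCat.{v₁, u₁}}

/-- Interpretation of formal composites in a strict symmetric monoidal category. -/
def Term.eval (m : FreeMonoid N.place →* T.Obj) (g : ∀ t, m (N.source t) ⟶ m (N.target t)) :
    ∀ {X Y : FreeMonoid N.place}, Term N X Y → (m X ⟶ m Y)
  | _, _, .gen t => g t
  | _, _, .id X => 𝟙 (m X)
  | _, _, .comp p q => p.eval m g ≫ q.eval m g
  | _, _, .tensor p q => castHom (m.map_mul _ _) (m.map_mul _ _)
      (T.tensor (p.eval m g) (q.eval m g))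
  | _, _, .braid X Y => castHom (m.map_mul _ _) (m.map_mul _ _) (T.braid (m X) (m Y))

variable (m : FreeMonoid N.place →* T.Obj) (g : ∀ t, m (N.source t) ⟶ m (N.target t))

theorem Term.eval_ofEq {X Y : FreeMonoid N.place} (h : X = Y) :
    (Term.ofEq (N := N) h).eval m g = eqToHom (congrArg m h) := by
  subst h; rfl

theorem Term.eval_tensor_heq {X Y X' Y' : FreeMonoid N.place} (p : Term N X Y)
    (q : Term N X' Y') :
    HEq ((p.tensor q).eval m g) (T.tensor (p.eval m g) (q.eval m g)) :=
  castHom_heq _ _ _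

theorem Term.eval_braid_heq (X Y : FreeMonoid N.place) :
    HEq ((Term.braid X Y).eval m g) (T.braid (m X) (m Y)) :=
  castHom_heq _ _ _

theorem comp_eqToHom_eq_eqToHom_comp {C : Type u} [Category.{v} C] {X Y X' Y' : C} {f : X ⟶ Y}
    {g : X' ⟶ Y'} (hX : X = X') (hY : Y = Y') (h : HEq f g) :
    f ≫ eqToHom hY = eqToHom hX ≫ g := by
  subst hX hY; simpa using h

/-- Each relation becomes the axiom of the same name in `T`. The only work is that `m` is
multiplicative up to propositional equality, so tensors and braidings carry casts, which
heterogeneous equality removes. -/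
theorem Term.eval_rel {X Y : FreeMonoid N.place} {p q : Term N X Y} (h : Term.Rel N p q) :
    p.eval m g = q.eval m g := by
  induction h with
  | refl f => rfl
  | symm _ ih => exact ih.symm
  | trans _ _ ih ih' => exact ih.trans ih'
  | comp_congr _ _ ih ih' => simp only [eval, ih, ih']
  | tensor_congr _ _ ih ih' => simp only [eval, ih, ih']
  | id_comp f => exact Category.id_comp _
  | comp_id f => exact Category.comp_id _
  | assoc f g h => exact Category.assoc _ _ _
  | tensor_id X Y =>
    refine eq_of_heq ((eval_tensor_heq m g _ _).trans ?_)
    exact (heq_of_eq (T.tensor_id _ _)).trans (id_heq (m.map_mul _ _).symm)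
  | tensor_comp f k f' k' =>
    refine eq_of_heq ((eval_tensor_heq m g _ _).trans ?_)
    refine (heq_of_eq (T.tensor_comp _ _ _ _)).trans ?_
    exact heq_comp (m.map_mul _ _).symm (m.map_mul _ _).symm (m.map_mul _ _).symm
      (eval_tensor_heq m g _ _).symm (eval_tensor_heq m g _ _).symm
  | tensor_assoc f k h =>
    simp only [eval, eval_ofEq]
    refine comp_eqToHom_eq_eqToHom_comp _ _ ?_
    refine (castHom_heq _ _ _).trans (HEq.trans ?_ (castHom_heq _ _ _).symm)
    refine (StrictSymMonCat.tensor_heq (m.map_mul _ _) (m.map_mul _ _) rfl rfl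
      (castHom_heq _ _ _) HEq.rfl).trans ?_
    refine (T.tensor_assoc _ _ _).trans ?_
    exact (StrictSymMonCat.tensor_heq rfl rfl (m.map_mul _ _).symm (m.map_mul _ _).symm HEq.rfl
      (castHom_heq _ _ _).symm)
  | one_tensor f =>
    simp only [eval, eval_ofEq]
    refine comp_eqToHom_eq_eqToHom_comp _ _ ?_
    refine (castHom_heq _ _ _).trans ?_
    exact (StrictSymMonCat.tensor_heq m.map_one m.map_one rfl rfl (id_heq m.map_one)
      HEq.rfl).trans (T.one_tensor _)
  | tensor_one f =>
    simp only [eval, eval_ofEq]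
    refine comp_eqToHom_eq_eqToHom_comp _ _ ?_
    refine (castHom_heq _ _ _).trans ?_
    exact (StrictSymMonCat.tensor_heq rfl rfl m.map_one m.map_one HEq.rfl
      (id_heq m.map_one)).trans (T.tensor_one _)
  | braid_naturality f k =>
    refine eq_of_heq (HEq.trans (heq_comp (m.map_mul _ _) (m.map_mul _ _) (m.map_mul _ _)
      (eval_tensor_heq m g _ _) (eval_braid_heq m g _ _)) ?_)
    refine (heq_of_eq (T.braid_naturality _ _)).trans ?_
    exact heq_comp (m.map_mul _ _).symm (m.map_mul _ _).symm (m.map_mul _ _).symm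
      (eval_braid_heq m g _ _).symm (eval_tensor_heq m g _ _).symm
  | braid_symmetry X Y =>
    refine eq_of_heq (HEq.trans (heq_comp (m.map_mul _ _) (m.map_mul _ _) (m.map_mul _ _)
      (eval_braid_heq m g _ _) (eval_braid_heq m g _ _)) ?_)
    exact (heq_of_eq (T.braid_symmetry _ _)).trans (id_heq (m.map_mul _ _).symm)
  | hexagon X Y Z =>
    simp only [eval, eval_ofEq]
    have hX : m (X * (Y * Z)) = m X * (m Y * m Z) := by simp only [m.map_mul]
    have hY : m (Y * (X * Z)) = m Y * (m X * m Z) := by simp only [m.map_mul]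
    have hZ : m (Y * Z * X) = m Y * m Z * m X := by simp only [m.map_mul]
    -- The hexagon is applied in `T` at `m X`, `m Y`, `m Z`; its two factors are then matched with
    -- the two halves of the interpreted composite.
    have key := StrictSymMonCat.hexagon_of_heq (m X) (m Y) (m Z)
      (castHom_heq (mul_assoc _ _ _).symm (mul_assoc _ _ _).symm _)
      (castHom_heq rfl (mul_assoc _ _ _) _)
    have e₁ := (castHom_heq (m.map_mul X (Y * Z)) (m.map_mul (Y * Z) X)
      (T.braid (m X) (m (Y * Z)))).trans (StrictSymMonCat.braid_heq rfl (m.map_mul Y Z))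
    refine eq_of_heq (e₁.trans ((heq_of_eq key).trans ?_))
    rw [← Category.assoc, ← Category.assoc]
    refine heq_comp hX.symm hY.symm hZ.symm ?_ ?_
    · refine (castHom_heq _ _ _).trans ?_
      rw [Category.assoc, heq_eqToHom_comp_iff, heq_comp_eqToHom_iff]
      exact (StrictSymMonCat.tensor_heq (m.map_mul _ _).symm (m.map_mul _ _).symm rfl rfl
        (castHom_heq _ _ _).symm HEq.rfl).trans (castHom_heq _ _ _).symm
    · refine (castHom_heq _ _ _).trans ?_
      rw [heq_comp_eqToHom_iff]
      exact (StrictSymMonCat.tensor_heq rfl rfl (m.map_mul _ _).symm (m.map_mul _ _).symm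
        HEq.rfl (castHom_heq _ _ _).symm).trans (castHom_heq _ _ _).symm

/-- The functor from a free strict symmetric monoidal category given by a homomorphism on objects
and values on the generating morphisms. -/
def freeLift : StrictSymMonFunctor N.free T where
  obj X := m X
  map {X Y} f := Quotient.lift (s := N.termSetoid X Y) (fun p => p.eval m g)
    (fun _ _ h => Term.eval_rel m g h) f
  map_id _ := rfl
  map_comp := by rintro X Y Z ⟨f⟩ ⟨k⟩; rfl
  obj_one := m.map_one
  obj_mul := m.map_mul
  map_tensor := by rintro X Y X' Y' ⟨f⟩ ⟨k⟩; exact Term.eval_tensor_heq m g f k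
  map_braid X Y := Term.eval_braid_heq m g X Y

/-- A generating object of the free strict symmetric monoidal category. -/
def freePlace (N : TensorScheme.{u}) (p : N.place) : N.free.Obj := FreeMonoid.of p

/-- A generating morphism of the free strict symmetric monoidal category. -/
def freeGen (N : TensorScheme.{u}) (t : N.transition) :
    @Quiver.Hom N.free.Obj _ (N.source t) (N.target t) :=
  (Term.gen t).cls

theorem free_obj_ext {F G : StrictSymMonFunctor N.free T}
    (h : ∀ p, F.obj (N.freePlace p) = G.obj (N.freePlace p)) (X : N.free.Obj) :
    F.obj X = G.obj X :=
  DFunLike.congr_fun (FreeMonoid.hom_eq (f := F.objHom) (g := G.objHom) h) X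

/-- Strict functors preserve composites, tensors and symmetries, so induction on formal composites
suffices. Over a scheme without generating morphisms the second condition is empty: such functors
are determined by their values on objects. -/
theorem free_hom_ext {F G : StrictSymMonFunctor N.free T}
    (h : ∀ p, F.obj (N.freePlace p) = G.obj (N.freePlace p))
    (h' : ∀ t, HEq (F.map (N.freeGen t)) (G.map (N.freeGen t))) : F = G := by
  have ho := free_obj_ext h
  suffices key : ∀ {X Y : FreeMonoid N.place} (p : Term N X Y),
      HEq (F.map (X := X) (Y := Y) p.cls) (G.map (X := X) (Y := Y) p.cls) by
    refine StrictSymMonFunctor.ext_heq ho ?_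
    rintro X Y ⟨p⟩
    exact key p
  intro X Y p
  induction p with
  | gen t => exact h' t
  | id X => exact (heq_of_eq (F.map_id X)).trans ((id_heq (ho X)).trans
      (heq_of_eq (G.map_id X).symm))
  | comp p q ihp ihq =>
    exact (heq_of_eq (F.map_comp (X := _) p.cls q.cls)).trans
      ((heq_comp (ho _) (ho _) (ho _) ihp ihq).trans (heq_of_eq (G.map_comp p.cls q.cls).symm))
  | tensor p q ihp ihq =>
    exact (F.map_tensor p.cls q.cls).trans
      ((StrictSymMonCat.tensor_heq (ho _) (ho _) (ho _) (ho _) ihp ihq).trans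
        (G.map_tensor p.cls q.cls).symm)
  | braid X Y =>
    exact (F.map_braid X Y).trans ((StrictSymMonCat.braid_heq (ho _) (ho _)).trans
      (G.map_braid X Y).symm)

/-! ### Reordering sources and targets -/

/-- The generators without morphisms. -/
def ofPlaces (P : Type u) : TensorScheme.{u} := ⟨P, PEmpty, PEmpty.elim, PEmpty.elim⟩

/-- The functor from the free category on objects given by a homomorphism on objects. -/
def symmetries {P : Type u} (m : FreeMonoid P →* T.Obj) :
    StrictSymMonFunctor (ofPlaces P).free T :=
  freeLift (N := ofPlaces P) m fun t => PEmpty.elim t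

/-- Tensor product of isomorphisms. -/
def _root_.StrictSymMonCat.tensorIso {C : StrictSymMonCat.{v, u}} {X Y X' Y' : C.Obj}
    (i : X ≅ Y) (j : X' ≅ Y') : X * X' ≅ Y * Y' where
  hom := C.tensor i.hom j.hom
  inv := C.tensor i.inv j.inv
  hom_inv_id := by rw [← C.tensor_comp, i.hom_inv_id, j.hom_inv_id, C.tensor_id]
  inv_hom_id := by rw [← C.tensor_comp, i.inv_hom_id, j.inv_hom_id, C.tensor_id]

/-- The symmetry as an isomorphism. -/
def _root_.StrictSymMonCat.braidIso {C : StrictSymMonCat.{v, u}} (X Y : C.Obj) :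
    X * Y ≅ Y * X where
  hom := C.braid X Y
  inv := C.braid Y X
  hom_inv_id := C.braid_symmetry X Y
  inv_hom_id := C.braid_symmetry Y X

/-- A permutation is built from adjacent exchanges, each realized by a symmetry tensored with an
identity. -/
theorem nonempty_iso_of_perm {P : Type u} {l l' : List P} (h : l.Perm l') :
    Nonempty (@Iso (ofPlaces P).free.Obj _ (FreeMonoid.ofList l) (FreeMonoid.ofList l')) := by
  induction h with
  | nil => exact ⟨Iso.refl _⟩
  | cons x _ ih =>
    exact ih.map fun i => StrictSymMonCat.tensorIso (C := (ofPlaces P).free)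
      (Iso.refl ((ofPlaces P).freePlace x)) i
  | swap x y l =>
    exact ⟨StrictSymMonCat.tensorIso (C := (ofPlaces P).free)
      (StrictSymMonCat.braidIso ((ofPlaces P).freePlace y) ((ofPlaces P).freePlace x))
      (Iso.refl (show (ofPlaces P).free.Obj from FreeMonoid.ofList l))⟩
  | trans _ _ ih ih' => exact ih.elim fun i => ih'.map fun j => i.trans j

/-- Cancels a conjugation. It serves both composites in `exists_free_iso`, where each functor sends
a generator to a conjugate of a generator by symmetries. -/
theorem map_conj {C : StrictSymMonCat.{v₁, u₁}} {D : StrictSymMonCat.{v₂, u₂}}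
    (G : StrictSymMonFunctor C D) {X X' Y Y' : C.Obj} {a : X ⟶ X'} {f : X' ⟶ Y'} {b : Y' ⟶ Y}
    {i : G.obj X' ⟶ G.obj X} {j : G.obj Y ⟶ G.obj Y'} {k : G.obj X ⟶ G.obj Y}
    (h : G.map f = i ≫ k ≫ j) (ha : G.map a ≫ i = 𝟙 _) (hb : j ≫ G.map b = 𝟙 _) :
    G.map (a ≫ f ≫ b) = k := by
  rw [G.map_comp, G.map_comp, h]
  simp only [Category.assoc, hb, Category.comp_id]
  rw [← Category.assoc, ha, Category.id_comp]

/-- Reordering the sources and targets of the generating morphisms does not change the free strict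
symmetric monoidal category. -/
theorem exists_free_iso {P T T' : Type u} (s t : T → FreeMonoid P) (s' t' : T' → FreeMonoid P)
    (e : T ≃ T') (hs : ∀ a, (s a).toList.Perm (s' (e a)).toList)
    (ht : ∀ a, (t a).toList.Perm (t' (e a)).toList) :
    ∃ i : (TensorScheme.mk P T s t).free ≅ (TensorScheme.mk P T' s' t').free,
      ∀ X : FreeMonoid P, (StrictSymMonCat.toFun i.hom).obj X = X := by
  have σ := fun a => (nonempty_iso_of_perm (hs a)).some
  have τ := fun a => (nonempty_iso_of_perm (ht a)).some
  let A := TensorScheme.mk P T s t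
  let B := TensorScheme.mk P T' s' t'
  let α : StrictSymMonFunctor (ofPlaces P).free A.free := symmetries (MonoidHom.id _)
  let β : StrictSymMonFunctor (ofPlaces P).free B.free := symmetries (MonoidHom.id _)
  -- `F` and `G` fix objects and conjugate each generator by the chosen permutation isomorphisms, in
  -- opposite directions. The cast in `G` is there because `e (e.symm b) = b` is not definitional.
  let F : StrictSymMonFunctor A.free B.free := freeLift (N := A) (T := B.free)
    (MonoidHom.id (FreeMonoid P)) fun a =>
      (β.map (σ a).hom ≫ B.freeGen (e a) ≫ β.map (τ a).inv : _)
  let G : StrictSymMonFunctor B.free A.free := freeLift (N := B) (T := A.free)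
    (MonoidHom.id (FreeMonoid P)) fun b => castHom (congrArg s' (e.apply_symm_apply b).symm)
      (congrArg t' (e.apply_symm_apply b).symm)
      (α.map (σ (e.symm b)).inv ≫ A.freeGen (e.symm b) ≫ α.map (τ (e.symm b)).hom : _)
  -- Both functors preserve symmetries, hence carry the permutation isomorphisms of one side to
  -- those of the other.
  have hF : α.comp F = β := free_hom_ext (fun _ => rfl) (fun t => t.elim)
  have hG : β.comp G = α := free_hom_ext (fun _ => rfl) (fun t => t.elim)
  have hGe : ∀ a, G.map (B.freeGen (e a)) =
      (α.map (σ a).inv ≫ A.freeGen a ≫ α.map (τ a).hom : _) := by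
    intro a
    -- With `e.symm (e a)` generalized to `c`, the equation can be substituted and the cast becomes
    -- trivial.
    have key : ∀ c (h : c = a) (h₁ : s' (e a) = s' (e c)) (h₂ : t' (e a) = t' (e c)),
        castHom (C := A.free.Obj) h₁ h₂
          (α.map (σ c).inv ≫ A.freeGen c ≫ α.map (τ c).hom : _) =
        (α.map (σ a).inv ≫ A.freeGen a ≫ α.map (τ a).hom : _) := by
      rintro _ rfl _ _
      exact eq_of_heq (castHom_heq _ _ _)
    exact key (e.symm (e a)) (e.symm_apply_apply a) _
      (congrArg t' (e.apply_symm_apply (e a)).symm)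
  have hF' : ∀ {X Y : (ofPlaces P).free.Obj} (f : X ⟶ Y), F.map (α.map f) = β.map f := fun f =>
    eq_of_heq (StrictSymMonFunctor.map_congr hF f)
  have hG' : ∀ {X Y : (ofPlaces P).free.Obj} (f : X ⟶ Y), G.map (β.map f) = α.map f := fun f =>
    eq_of_heq (StrictSymMonFunctor.map_congr hG f)
  have hFe : ∀ a, F.map (A.freeGen a) =
      (β.map (σ a).hom ≫ B.freeGen (e a) ≫ β.map (τ a).inv : _) := fun _ => rfl
  have hFG : F.comp G = StrictSymMonFunctor.id _ := by
    refine free_hom_ext (fun _ => rfl) fun a => heq_of_eq ?_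
    change G.map (F.map (A.freeGen a)) = A.freeGen a
    exact map_conj G (hGe a)
      ((congrArg (· ≫ α.map (σ a).inv) (hG' (σ a).hom)).trans
        (α.toFunctor.mapIso (σ a)).hom_inv_id)
      ((congrArg (α.map (τ a).hom ≫ ·) (hG' (τ a).inv)).trans
        (α.toFunctor.mapIso (τ a)).hom_inv_id)
  have hGF : G.comp F = StrictSymMonFunctor.id _ := by
    refine free_hom_ext (fun _ => rfl) fun b => ?_
    obtain ⟨a, rfl⟩ := e.surjective b
    refine heq_of_eq ((congrArg F.map (hGe a)).trans ?_)
    exact map_conj F (hFe a)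
      ((congrArg (· ≫ β.map (σ a).hom) (hF' (σ a).inv)).trans
        (β.toFunctor.mapIso (σ a)).inv_hom_id)
      ((congrArg (β.map (τ a).inv ≫ ·) (hF' (τ a).hom)).trans
        (β.toFunctor.mapIso (τ a)).inv_hom_id)
  exact ⟨⟨F, G, hFG, hGF⟩, fun X => rfl⟩

end TensorScheme

/-- Every free strict symmetric monoidal category is free on a Petri net. -/
theorem TensorScheme.nonempty_netPresentation (N : TensorScheme.{u}) :
    Nonempty (NetPresentation N.free) := by
  -- The net keeps only the multisets of letters; `PetriNet.scheme` lists them again in some order,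
  -- a permutation of the original word.
  obtain ⟨i, -⟩ := TensorScheme.exists_free_iso
    (fun t : N.transition => FreeMonoid.ofList
      (Multiset.toList (N.source t).toList : List N.place))
    (fun t : N.transition => FreeMonoid.ofList
      (Multiset.toList (N.target t).toList : List N.place)) N.source N.target (Equiv.refl _)
    (fun t => Multiset.coe_eq_coe.1 (Multiset.coe_toList ((N.source t).toList : Multiset N.place)))
    (fun t => Multiset.coe_eq_coe.1 (Multiset.coe_toList ((N.target t).toList : Multiset N.place)))
  exact ⟨⟨⟨N.place, N.transition, fun t => ((N.source t).toList : Multiset N.place),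
    fun t => ((N.target t).toList : Multiset N.place)⟩, i⟩⟩

/-! ### Splitting tuples and elements of apexes -/

namespace Marking

variable {M : Type v₁} [Monoid M] {φ : M →* FreeMonoid (Type u)}

/-- The first part of an element of a product. -/
def fst {X Y : M} (z : Tuple (φ (X * Y))) : Tuple (φ X) :=
  Tuple.fst (cast (congrArg Tuple (φ.map_mul X Y)) z)

/-- The second part of an element of a product. -/
def snd {X Y : M} (z : Tuple (φ (X * Y))) : Tuple (φ Y) :=
  Tuple.snd (cast (congrArg Tuple (φ.map_mul X Y)) z)

theorem pair_fst_snd {X Y : M} (z : Tuple (φ (X * Y))) : pair (fst z) (snd z) = z := by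
  simp only [pair, fst, snd, Tuple.append_fst_snd, cast_cast, cast_eq]

theorem fst_pair {X Y : M} (x : Tuple (φ X)) (y : Tuple (φ Y)) : fst (pair x y) = x := by
  simp only [pair, fst, cast_cast, cast_eq, Tuple.fst_append]

theorem snd_pair {X Y : M} (x : Tuple (φ X)) (y : Tuple (φ Y)) : snd (pair x y) = y := by
  simp only [pair, snd, cast_cast, cast_eq, Tuple.snd_append]

theorem exists_pair {X Y : M} (z : Tuple (φ (X * Y))) : ∃ x y, z = pair x y :=
  ⟨fst z, snd z, (pair_fst_snd z).symm⟩

theorem pair_inj {X Y : M} {x x' : Tuple (φ X)} {y y' : Tuple (φ Y)}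
    (h : pair x y = pair x' y') : x = x' ∧ y = y' :=
  ⟨by rw [← fst_pair x y, h, fst_pair], by rw [← snd_pair x y, h, snd_pair]⟩

end Marking

namespace SpanCat.ApexChoice

open Marking

variable {C : StrictSymMonCat.{v₁, u₁}} {G : StrictSymMonFunctor C SpanCat.{u}} (R : ApexChoice G)

theorem eq_of_fiber_id {X : C.Obj} {x y : Tuple (words G X)} (s : (R.span (𝟙 X)).Fiber x y) :
    x = y := by
  obtain ⟨e⟩ := R.fiber_id X x y
  exact (e s).2.1.symm.trans (e s).2.2

theorem eq_of_fiber_braid {X Y : C.Obj} {x : Tuple (words G X)} {y : Tuple (words G Y)}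
    {w : Tuple (words G (Y * X))} (s : (R.span (C.braid X Y)).Fiber (pair x y) w) :
    w = pair y x := by
  obtain ⟨y', x', rfl⟩ := exists_pair w
  obtain ⟨e⟩ := SetSpan.fiber_equiv_of_heq (T := SetSpan.swap (words G X) (words G Y))
    ((words G).map_mul _ _) ((words G).map_mul _ _)
    ((heq_of_eq (R.cls_span (C.braid X Y))).trans (G.map_braid X Y))
    (pair_heq x y) (pair_heq y' x')
  obtain ⟨⟨p, q⟩, h₁, h₂⟩ := e s
  obtain ⟨rfl, rfl⟩ := Tuple.append_inj.1 h₁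
  obtain ⟨rfl, rfl⟩ := Tuple.append_inj.1 h₂
  rfl

/-- The factors of an element of the apex of a composite. -/
noncomputable def splitComp {X Y Z : C.Obj} {f : X ⟶ Y} {g : Y ⟶ Z} {x : Tuple (words G X)}
    {z : Tuple (words G Z)} (s : (R.span (f ≫ g)).Fiber x z) :
    Σ y : Tuple (words G Y), (R.span f).Fiber x y × (R.span g).Fiber y z :=
  (Equiv.ofBijective _ (R.comp_bijective f g x z)).symm s

theorem splitComp_comp {X Y Z : C.Obj} {f : X ⟶ Y} {g : Y ⟶ Z} {x : Tuple (words G X)}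
    {y : Tuple (words G Y)} {z : Tuple (words G Z)} (s : (R.span f).Fiber x y)
    (t : (R.span g).Fiber y z) : R.splitComp (R.comp s t) = ⟨y, s, t⟩ :=
  (Equiv.ofBijective _ (R.comp_bijective f g x z)).symm_apply_apply ⟨y, s, t⟩

theorem exists_comp {X Y Z : C.Obj} {f : X ⟶ Y} {g : Y ⟶ Z} {x : Tuple (words G X)}
    {z : Tuple (words G Z)} (s : (R.span (f ≫ g)).Fiber x z) :
    ∃ (y : Tuple (words G Y)) (p : (R.span f).Fiber x y) (q : (R.span g).Fiber y z),
      s = R.comp p q := by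
  obtain ⟨⟨y, p, q⟩, h⟩ := (R.comp_bijective f g x z).2 s
  exact ⟨y, p, q, h.symm⟩

theorem exists_tensor {X Y X' Y' : C.Obj} {f : X ⟶ Y} {g : X' ⟶ Y'} {x : Tuple (words G X)}
    {y : Tuple (words G Y)} {x' : Tuple (words G X')} {y' : Tuple (words G Y')}
    (s : (R.span (C.tensor f g)).Fiber (pair x x') (pair y y')) :
    ∃ (p : (R.span f).Fiber x y) (q : (R.span g).Fiber x' y'), s = R.tensor p q := by
  obtain ⟨⟨p, q⟩, h⟩ := (R.tensor_bijective f g x y x' y').2 s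
  exact ⟨p, q, h.symm⟩

/-- The factors of an element of the apex of a tensor product. -/
noncomputable def splitTensor {X Y X' Y' : C.Obj} {f : X ⟶ Y} {g : X' ⟶ Y'}
    {z : Tuple (words G (X * X'))} {w : Tuple (words G (Y * Y'))}
    (s : (R.span (C.tensor f g)).Fiber z w) :
    (R.span f).Fiber (fst z) (fst w) × (R.span g).Fiber (snd z) (snd w) :=
  (Equiv.ofBijective _ (R.tensor_bijective f g (fst z) (fst w) (snd z) (snd w))).symm
    (cast (by rw [pair_fst_snd, pair_fst_snd]) s)

theorem tensor_splitTensor {X Y X' Y' : C.Obj} {f : X ⟶ Y} {g : X' ⟶ Y'}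
    {z : Tuple (words G (X * X'))} {w : Tuple (words G (Y * Y'))}
    (s : (R.span (C.tensor f g)).Fiber z w) :
    HEq (R.tensor (R.splitTensor s).1 (R.splitTensor s).2) s :=
  (heq_of_eq ((Equiv.ofBijective _ (R.tensor_bijective f g (fst z) (fst w) (snd z)
    (snd w))).apply_symm_apply _)).trans (cast_heq _ _)

/-- The end points are related by equations because `fst (pair x x')` is only propositionally `x`;
after substitution this is injectivity in `tensor_bijective`. -/
theorem heq_of_tensor_heq {X Y X' Y' : C.Obj} {f : X ⟶ Y} {g : X' ⟶ Y'}
    {x a : Tuple (words G X)} {y b : Tuple (words G Y)} {x' a' : Tuple (words G X')}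
    {y' b' : Tuple (words G Y')} (h₁ : x = a) (h₂ : y = b) (h₃ : x' = a') (h₄ : y' = b')
    {p : (R.span f).Fiber x y} {q : (R.span g).Fiber x' y'} {s : (R.span f).Fiber a b}
    {t : (R.span g).Fiber a' b'} (h : HEq (R.tensor p q) (R.tensor s t)) :
    HEq p s ∧ HEq q t := by
  subst h₁ h₂ h₃ h₄
  have := (R.tensor_bijective f g x y x' y').1 (a₁ := (p, q)) (a₂ := (s, t)) (eq_of_heq h)
  cases this
  exact ⟨HEq.rfl, HEq.rfl⟩

theorem splitTensor_tensor {X Y X' Y' : C.Obj} {f : X ⟶ Y} {g : X' ⟶ Y'}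
    {x : Tuple (words G X)} {y : Tuple (words G Y)} {x' : Tuple (words G X')}
    {y' : Tuple (words G Y')} (s : (R.span f).Fiber x y) (t : (R.span g).Fiber x' y') :
    HEq (R.splitTensor (R.tensor s t)).1 s ∧ HEq (R.splitTensor (R.tensor s t)).2 t :=
  R.heq_of_tensor_heq (fst_pair _ _) (fst_pair _ _) (snd_pair _ _) (snd_pair _ _)
    (R.tensor_splitTensor _)

end SpanCat.ApexChoice

/-! ### Families of objects indexed by the elements of the sets assigned to an object -/

namespace SpanCat.ApexChoice

open Marking

variable {C : StrictSymMonCat.{u, u}} {G : StrictSymMonFunctor C SpanCat.{u}}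

/-- An object of `C` with a family of objects of `T` indexed by its elements. -/
structure Family (G : StrictSymMonFunctor C SpanCat.{u}) (T : StrictSymMonCat.{u, u}) :
    Type u where
  base : C.Obj
  val : Tuple (words G base) → T.Obj

variable {T : StrictSymMonCat.{u, u}}

theorem Family.ext_heq {A B : Family G T} (h : A.base = B.base)
    (h' : ∀ x x', HEq x x' → A.val x = B.val x') : A = B := by
  obtain ⟨X, a⟩ := A
  obtain ⟨Y, b⟩ := B
  obtain rfl : X = Y := h
  congr
  exact funext fun x => h' x x HEq.rfl

theorem Family.val_congr {A B : Family G T} (h : A = B) {x : Tuple (words G A.base)}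
    {y : Tuple (words G B.base)} (hx : HEq x y) : A.val x = B.val y := by
  subst h; cases hx; rfl

instance : Monoid (Family G T) where
  mul A B := ⟨A.base * B.base, fun z => A.val (fst z) * B.val (snd z)⟩
  one := ⟨1, fun _ => 1⟩
  mul_assoc A B D := Family.ext_heq (mul_assoc _ _ _) fun z z' h => by
    obtain ⟨xy, w, rfl⟩ := exists_pair (X := A.base * B.base) z
    obtain ⟨x, y, rfl⟩ := exists_pair xy
    obtain rfl := eq_of_heq ((pair_assoc x y w).symm.trans h)
    change A.val (fst (fst (pair (pair x y) w))) * B.val (snd (fst (pair (pair x y) w))) *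
      D.val (snd (pair (pair x y) w)) = A.val (fst (pair x (pair y w))) *
        (B.val (fst (snd (pair x (pair y w)))) * D.val (snd (snd (pair x (pair y w)))))
    simp only [fst_pair, snd_pair, mul_assoc]
  one_mul A := Family.ext_heq (one_mul _) fun z z' h => by
    obtain ⟨e, x, rfl⟩ := exists_pair (X := (1 : C.Obj)) z
    obtain rfl := eq_point e
    obtain rfl := eq_of_heq ((pair_point_left x).symm.trans h)
    exact (one_mul _).trans (congrArg A.val (snd_pair _ _))
  mul_one A := Family.ext_heq (mul_one _) fun z z' h => by
    obtain ⟨x, e, rfl⟩ := exists_pair (Y := (1 : C.Obj)) z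
    obtain rfl := eq_point e
    obtain rfl := eq_of_heq ((pair_point_right x).symm.trans h)
    exact (mul_one _).trans (congrArg A.val (fst_pair _ _))

variable (R : ApexChoice G)

/-- A morphism of `C` with a family of morphisms of `T` indexed by the elements of its apex. -/
structure FamilyHom (A B : Family G T) : Type u where
  hom : A.base ⟶ B.base
  app : ∀ {x : Tuple (words G A.base)} {y : Tuple (words G B.base)},
    (R.span hom).Fiber x y → (A.val x ⟶ B.val y)

variable {R}

theorem FamilyHom.ext_heq {A B : Family G T} {α β : R.FamilyHom A B} (h : α.hom = β.hom)
    (h' : ∀ {x y} (s : (R.span α.hom).Fiber x y) (s' : (R.span β.hom).Fiber x y),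
      HEq s s' → α.app s = β.app s') : α = β := by
  obtain ⟨f, a⟩ := α
  obtain ⟨g, b⟩ := β
  obtain rfl : f = g := h
  congr
  funext x y s
  exact h' s s HEq.rfl

theorem FamilyHom.heq {A B A' B' : Family G T} (hA : A = A') (hB : B = B')
    {α : R.FamilyHom A B} {β : R.FamilyHom A' B'} (h : HEq α.hom β.hom)
    (h' : ∀ {x y x' y'} (s : (R.span α.hom).Fiber x y) (s' : (R.span β.hom).Fiber x' y'),
      HEq x x' → HEq y y' → HEq s s' → HEq (α.app s) (β.app s')) : HEq α β := by
  subst hA hB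
  exact heq_of_eq (FamilyHom.ext_heq (eq_of_heq h) fun s s' hs =>
    eq_of_heq (h' s s' HEq.rfl HEq.rfl hs))

theorem FamilyHom.app_heq {A B A' B' : Family G T} (hA : A = A') (hB : B = B')
    {α : R.FamilyHom A B} {β : R.FamilyHom A' B'} (h : HEq α β) {x y x' y'}
    {s : (R.span α.hom).Fiber x y} {s' : (R.span β.hom).Fiber x' y'}
    (hx : HEq x x') (hy : HEq y y') (hs : HEq s s') : HEq (α.app s) (β.app s') := by
  subst hA hB; cases h; cases hx; cases hy; cases hs; rfl

theorem FamilyHom.hom_heq {A B A' B' : Family G T} (hA : A = A') (hB : B = B')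
    {α : R.FamilyHom A B} {β : R.FamilyHom A' B'} (h : HEq α β) : HEq α.hom β.hom := by
  subst hA hB; cases h; rfl

variable (R) in
/-- The identity family. -/
def FamilyHom.id (A : Family G T) : R.FamilyHom A A where
  hom := 𝟙 A.base
  app s := eqToHom (congrArg A.val (R.eq_of_fiber_id s))

/-- Composition of families, along the factorizations of elements of apexes. -/
noncomputable def FamilyHom.comp {A B D : Family G T} (α : R.FamilyHom A B)
    (β : R.FamilyHom B D) : R.FamilyHom A D where
  hom := α.hom ≫ β.hom
  app s := α.app (R.splitComp s).2.1 ≫ β.app (R.splitComp s).2.2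

theorem FamilyHom.id_app (A : Family G T) {x : Tuple (words G A.base)}
    (s : (R.span (𝟙 A.base)).Fiber x x) : (FamilyHom.id R A).app s = 𝟙 (A.val x) :=
  eqToHom_refl (A.val x) rfl

/-- Factorizations are unique, so the one picked by `splitComp` is the given one. Together with
surjectivity of `R.comp` and `R.tensor`, this rule and `tensor_app` let every axiom for families be
checked on composite and tensored elements, without unfolding the splittings. -/
theorem FamilyHom.comp_app {A B D : Family G T} (α : R.FamilyHom A B) (β : R.FamilyHom B D)
    {x y z} (s : (R.span α.hom).Fiber x y) (t : (R.span β.hom).Fiber y z) :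
    (α.comp β).app (R.comp s t) = α.app s ≫ β.app t := by
  change α.app (R.splitComp (R.comp s t)).2.1 ≫ β.app (R.splitComp (R.comp s t)).2.2 = _
  rw [R.splitComp_comp]

/-- Tensor product of families. -/
noncomputable def FamilyHom.tensor {A B A' B' : Family G T} (α : R.FamilyHom A B)
    (β : R.FamilyHom A' B') : R.FamilyHom (A * A') (B * B') where
  hom := C.tensor α.hom β.hom
  app s := T.tensor (α.app (R.splitTensor s).1) (β.app (R.splitTensor s).2)

theorem Family.mul_val_pair {A B : Family G T} (x : Tuple (words G A.base))
    (y : Tuple (words G B.base)) : (A * B).val (pair x y) = A.val x * B.val y := by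
  change A.val (fst (pair x y)) * B.val (snd (pair x y)) = _
  rw [fst_pair, snd_pair]

theorem FamilyHom.tensor_app {A B A' B' : Family G T} (α : R.FamilyHom A B)
    (β : R.FamilyHom A' B') {x y x' y'} (s : (R.span α.hom).Fiber x y)
    (t : (R.span β.hom).Fiber x' y') :
    HEq ((α.tensor β).app (R.tensor s t)) (T.tensor (α.app s) (β.app t)) := by
  obtain ⟨h, h'⟩ := R.splitTensor_tensor s t
  refine StrictSymMonCat.tensor_heq (congrArg _ (fst_pair _ _)) (congrArg _ (fst_pair _ _))
    (congrArg _ (snd_pair _ _)) (congrArg _ (snd_pair _ _)) ?_ ?_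
  · exact FamilyHom.app_heq rfl rfl HEq.rfl (heq_of_eq (fst_pair _ _)) (heq_of_eq (fst_pair _ _)) h
  · exact FamilyHom.app_heq rfl rfl HEq.rfl (heq_of_eq (snd_pair _ _)) (heq_of_eq (snd_pair _ _)) h'

/-- `FamilyHom.braid` needs a value at apex elements with arbitrary end points. An element over a
symmetry forces `w` to be the exchange of `z`, which makes the types match. -/
theorem Family.braid_val {A B : Family G T} {z : Tuple (words G (A.base * B.base))}
    {w : Tuple (words G (B.base * A.base))} (s : (R.span (C.braid A.base B.base)).Fiber z w) :
    (B * A).val w = B.val (snd z) * A.val (fst z) := by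
  obtain ⟨x, y, rfl⟩ := exists_pair z
  rw [R.eq_of_fiber_braid s, Family.mul_val_pair, fst_pair, snd_pair]

variable (R) in
/-- Symmetries of families. -/
def FamilyHom.braid (A B : Family G T) : R.FamilyHom (A * B) (B * A) where
  hom := C.braid A.base B.base
  app {z _} s := castHom rfl (Family.braid_val s) (T.braid (A.val (fst z)) (B.val (snd z)))

theorem FamilyHom.braid_app (A B : Family G T) {x : Tuple (words G A.base)}
    {y : Tuple (words G B.base)}
    (s : (R.span (C.braid A.base B.base)).Fiber (pair x y) (pair y x)) :
    HEq ((FamilyHom.braid R A B).app s) (T.braid (A.val x) (B.val y)) :=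
  (castHom_heq rfl (Family.braid_val s) _).trans
    (StrictSymMonCat.braid_heq (congrArg _ (fst_pair _ _)) (congrArg _ (snd_pair _ _)))

variable (R T) in
/-- The category of families. -/
noncomputable abbrev familyCategory : Category.{u} (Family G T) where
  Hom := R.FamilyHom
  id := FamilyHom.id R
  comp := FamilyHom.comp
  id_comp {A B} α := FamilyHom.ext_heq (Category.id_comp _) fun {x y} s s' hs => by
    obtain ⟨x', e, s, rfl⟩ := R.exists_comp s
    obtain rfl := R.eq_of_fiber_id e
    obtain rfl := eq_of_heq ((R.id_comp e s).symm.trans hs)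
    exact (FamilyHom.comp_app _ α e s).trans
      ((congrArg (· ≫ α.app s) (FamilyHom.id_app A e)).trans (Category.id_comp _))
  comp_id {A B} α := FamilyHom.ext_heq (Category.comp_id _) fun {x y} s s' hs => by
    obtain ⟨x', s, e, rfl⟩ := R.exists_comp s
    obtain rfl := R.eq_of_fiber_id e
    obtain rfl := eq_of_heq ((R.comp_id s e).symm.trans hs)
    exact (FamilyHom.comp_app α _ s e).trans
      ((congrArg (α.app s ≫ ·) (FamilyHom.id_app B e)).trans (Category.comp_id _))
  assoc α β γ := FamilyHom.ext_heq (Category.assoc _ _ _) fun {x y} s s' hs => by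
    obtain ⟨z, s, t, rfl⟩ := R.exists_comp s
    obtain ⟨w, r, s, rfl⟩ := R.exists_comp s
    obtain rfl := eq_of_heq ((R.comp_assoc r s t).symm.trans hs)
    have h₁ := (FamilyHom.comp_app (α.comp β) γ (R.comp r s) t).trans
      (congrArg (· ≫ γ.app t) (FamilyHom.comp_app α β r s))
    have h₂ := (FamilyHom.comp_app α (β.comp γ) r (R.comp s t)).trans
      (congrArg (α.app r ≫ ·) (FamilyHom.comp_app β γ s t))
    exact h₁.trans ((Category.assoc _ _ _).trans h₂.symm)

/-- The reverse of the passage in `hexagon_of_heq`: it recovers the hexagon axiom with its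
reassociations from the version without them. -/
theorem eq_comp_eqToHom_of_forall {E : Type u₁} [Category.{v₁} E] {A A' B B' D D' : E}
    {b : A ⟶ D} {t₁ : A' ⟶ B'} {t₂ : B ⟶ D'} (h₁ : A = A') (h₂ : B' = B) (h₃ : D' = D)
    (h : ∀ (p : A ⟶ B) (q : B ⟶ D), HEq p t₁ → HEq q t₂ → b = p ≫ q) :
    b = eqToHom h₁ ≫ t₁ ≫ eqToHom h₂ ≫ t₂ ≫ eqToHom h₃ := by
  subst h₁ h₂ h₃
  simpa using h t₁ t₂ HEq.rfl HEq.rfl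

/-- On underlying morphisms this is the hexagon of `C`, and at each apex element it is the hexagon
of `T`. The element is first written as a composite of canonical elements over the two smaller
symmetries. -/
theorem FamilyHom.hexagon (A B D : Family G T) {p : R.FamilyHom (A * (B * D)) (B * (A * D))}
    {q : R.FamilyHom (B * (A * D)) (B * D * A)}
    (hp : HEq p ((FamilyHom.braid R A B).tensor (FamilyHom.id R D)))
    (hq : HEq q ((FamilyHom.id R B).tensor (FamilyHom.braid R A D))) :
    FamilyHom.braid R A (B * D) = p.comp q := by
  have hb : C.braid A.base (B.base * D.base) = p.hom ≫ q.hom :=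
    C.hexagon_of_heq A.base B.base D.base
      (FamilyHom.hom_heq (mul_assoc _ _ _).symm (mul_assoc _ _ _).symm hp)
      (FamilyHom.hom_heq rfl (mul_assoc _ _ _) hq)
  refine FamilyHom.ext_heq hb fun {z w} s s' hs => ?_
  obtain ⟨x, y, rfl⟩ := exists_pair (X := A.base) (Y := B.base * D.base) z
  obtain ⟨y, d, rfl⟩ := exists_pair y
  obtain rfl := R.eq_of_fiber_braid s
  have e₁ := R.fiber_congr (mul_assoc A.base B.base D.base) (mul_assoc B.base A.base D.base)
    (FamilyHom.hom_heq (mul_assoc _ _ _).symm (mul_assoc _ _ _).symm hp).symm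
    (pair_assoc x y d) (pair_assoc y x d)
  have e₂ := R.fiber_congr rfl (mul_assoc B.base D.base A.base).symm
    (FamilyHom.hom_heq rfl (mul_assoc _ _ _) hq).symm
    (HEq.refl (pair y (pair x d))) (pair_assoc y d x).symm
  let r₁ := R.tensor (R.braid A.base B.base x y) (R.unit D.base d)
  let r₂ := R.tensor (R.unit B.base y) (R.braid A.base D.base x d)
  obtain ⟨b₁, h₁⟩ : ∃ b, HEq b r₁ := ⟨cast e₁ r₁, cast_heq _ _⟩
  obtain ⟨b₂, h₂⟩ : ∃ b, HEq b r₂ := ⟨cast e₂ r₂, cast_heq _ _⟩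
  have hsub : Subsingleton ((R.span (p.hom ≫ q.hom)).Fiber (pair x (pair y d))
      (pair (pair y d) x)) := hb ▸ R.subsingleton_fiber_braid _ _ _ _
  -- The fibre over a symmetry has at most one element, so the given one is the composite just
  -- built.
  obtain rfl : s' = R.comp b₁ b₂ := hsub.elim _ _
  have hbd := Family.mul_val_pair (A := B) (B := D) y d
  have k₁ : HEq (p.app b₁) (T.tensor (T.braid (A.val x) (B.val y)) (𝟙 (D.val d))) := by
    refine (FamilyHom.app_heq (mul_assoc _ _ _).symm (mul_assoc _ _ _).symm hp
      (pair_assoc x y d).symm (pair_assoc y x d).symm h₁).trans ?_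
    refine (FamilyHom.tensor_app _ _ _ _).trans ?_
    exact StrictSymMonCat.tensor_heq (Family.mul_val_pair _ _) (Family.mul_val_pair _ _) rfl rfl
      (FamilyHom.braid_app A B _) (heq_of_eq (FamilyHom.id_app D _))
  have k₂ : HEq (q.app b₂) (T.tensor (𝟙 (B.val y)) (T.braid (A.val x) (D.val d))) := by
    refine (FamilyHom.app_heq rfl (mul_assoc _ _ _) hq HEq.rfl (pair_assoc y d x) h₂).trans ?_
    refine (FamilyHom.tensor_app _ _ _ _).trans ?_
    exact StrictSymMonCat.tensor_heq rfl rfl (Family.mul_val_pair _ _) (Family.mul_val_pair _ _)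
      (heq_of_eq (FamilyHom.id_app B _)) (FamilyHom.braid_app A D _)
  have v₁ : (A * (B * D)).val (pair x (pair y d)) = A.val x * (B.val y * D.val d) :=
    (Family.mul_val_pair _ _).trans (congrArg _ hbd)
  have v₂ : (B * (A * D)).val (pair y (pair x d)) = B.val y * (A.val x * D.val d) :=
    (Family.mul_val_pair _ _).trans (congrArg _ (Family.mul_val_pair _ _))
  have v₃ : (B * D * A).val (pair (pair y d) x) = B.val y * D.val d * A.val x :=
    (Family.mul_val_pair _ _).trans (congrArg (· * _) hbd)
  refine eq_of_heq ((FamilyHom.braid_app A (B * D) s).trans ?_)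
  refine (StrictSymMonCat.braid_heq rfl hbd).trans ?_
  refine (heq_of_eq (T.hexagon_of_heq (A.val x) (B.val y) (D.val d)
    ((castHom_heq v₁.symm v₂.symm _).trans k₁) ((castHom_heq v₂.symm v₃.symm _).trans k₂))).trans ?_
  refine (heq_comp v₁.symm v₂.symm v₃.symm (castHom_heq _ _ _) (castHom_heq _ _ _)).trans ?_
  exact heq_of_eq (FamilyHom.comp_app p q b₁ b₂).symm

variable (R T) in
/-- The strict symmetric monoidal category of families of objects of `T`.  Functors to it over `C`
correspond to functors to `T` from internalizations. -/
noncomputable def families : StrictSymMonCat.{u, u} where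
  Obj := Family G T
  cat := R.familyCategory T
  mon := inferInstance
  tensor := FamilyHom.tensor
  braid := FamilyHom.braid R
  tensor_id A B := FamilyHom.ext_heq (C.tensor_id _ _) fun {x y} s s' hs => by
    obtain ⟨x, x', rfl⟩ := exists_pair (X := A.base) (Y := B.base) x
    obtain rfl := R.eq_of_fiber_id (X := A.base * B.base) s'
    obtain ⟨p, q, rfl⟩ := R.exists_tensor s
    refine eq_of_heq ((FamilyHom.tensor_app _ _ p q).trans ?_)
    refine (StrictSymMonCat.tensor_heq rfl rfl rfl rfl (heq_of_eq (FamilyHom.id_app A p))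
      (heq_of_eq (FamilyHom.id_app B q))).trans ?_
    refine (heq_of_eq (T.tensor_id _ _)).trans ((id_heq (Family.mul_val_pair x x').symm).trans ?_)
    exact heq_of_eq (FamilyHom.id_app (A * B) s').symm
  tensor_comp {A B D A' B' D'} α β α' β' :=
    FamilyHom.ext_heq (C.tensor_comp _ _ _ _) fun {x y} s s' hs => by
    obtain ⟨x, x', rfl⟩ := exists_pair (X := A.base) (Y := A'.base) x
    obtain ⟨z, z', rfl⟩ := exists_pair (X := D.base) (Y := D'.base) y
    obtain ⟨p, q, rfl⟩ := R.exists_tensor s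
    obtain ⟨y, p, r, rfl⟩ := R.exists_comp p
    obtain ⟨y', p', r', rfl⟩ := R.exists_comp q
    obtain rfl := eq_of_heq ((R.tensor_comp p r p' r').symm.trans hs)
    refine eq_of_heq ((FamilyHom.tensor_app (FamilyHom.comp α β) (FamilyHom.comp α' β')
      (R.comp p r) (R.comp p' r')).trans ?_)
    refine (StrictSymMonCat.tensor_heq rfl rfl rfl rfl (heq_of_eq (FamilyHom.comp_app α β p r))
      (heq_of_eq (FamilyHom.comp_app α' β' p' r'))).trans ?_
    refine (heq_of_eq (T.tensor_comp _ _ _ _)).trans ?_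
    refine (heq_comp (Family.mul_val_pair _ _) (Family.mul_val_pair _ _) (Family.mul_val_pair _ _)
      (FamilyHom.tensor_app α α' p p') (FamilyHom.tensor_app β β' r r')).symm.trans ?_
    exact heq_of_eq (FamilyHom.comp_app (α.tensor α') (β.tensor β') (R.tensor p p')
      (R.tensor r r')).symm
  tensor_assoc {A B A' B' A'' B''} α β γ :=
    FamilyHom.heq (mul_assoc _ _ _) (mul_assoc _ _ _) (C.tensor_assoc _ _ _)
      fun {x y x' y'} s s' hx hy hs => by
    obtain ⟨x, x₃, rfl⟩ := exists_pair (X := A.base * A'.base) (Y := A''.base) x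
    obtain ⟨x₁, x₂, rfl⟩ := exists_pair x
    obtain ⟨y, y₃, rfl⟩ := exists_pair (X := B.base * B'.base) (Y := B''.base) y
    obtain ⟨y₁, y₂, rfl⟩ := exists_pair y
    obtain rfl := eq_of_heq ((pair_assoc _ _ _).symm.trans hx)
    obtain rfl := eq_of_heq ((pair_assoc _ _ _).symm.trans hy)
    obtain ⟨p, r, rfl⟩ := R.exists_tensor s
    obtain ⟨p, q, rfl⟩ := R.exists_tensor p
    obtain rfl := eq_of_heq ((R.tensor_assoc p q r).symm.trans hs)
    refine (FamilyHom.tensor_app (α.tensor β) γ (R.tensor p q) r).trans ?_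
    refine (StrictSymMonCat.tensor_heq (Family.mul_val_pair _ _) (Family.mul_val_pair _ _) rfl rfl
      (FamilyHom.tensor_app α β p q) HEq.rfl).trans ?_
    refine (T.tensor_assoc _ _ _).trans ?_
    refine (StrictSymMonCat.tensor_heq rfl rfl (Family.mul_val_pair _ _) (Family.mul_val_pair _ _)
      HEq.rfl (FamilyHom.tensor_app β γ q r)).symm.trans ?_
    exact (FamilyHom.tensor_app α (β.tensor γ) p (R.tensor q r)).symm
  one_tensor {A B} α := FamilyHom.heq (one_mul _) (one_mul _) (C.one_tensor _)
      fun {x y x' y'} s s' hx hy hs => by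
    obtain ⟨e, x, rfl⟩ := exists_pair (X := (1 : C.Obj)) (Y := A.base) x
    obtain ⟨e', y, rfl⟩ := exists_pair (X := (1 : C.Obj)) (Y := B.base) y
    obtain rfl := eq_point e
    obtain rfl := eq_point e'
    obtain rfl := eq_of_heq ((pair_point_left _).symm.trans hx)
    obtain rfl := eq_of_heq ((pair_point_left _).symm.trans hy)
    obtain ⟨p, q, rfl⟩ := R.exists_tensor s
    obtain rfl := eq_of_heq ((R.one_tensor p q).symm.trans hs)
    refine (FamilyHom.tensor_app _ α p q).trans ?_
    refine (StrictSymMonCat.tensor_heq rfl rfl rfl rfl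
      (heq_of_eq (FamilyHom.id_app (1 : Family G T) p)) HEq.rfl).trans (T.one_tensor _)
  tensor_one {A B} α := FamilyHom.heq (mul_one _) (mul_one _) (C.tensor_one _)
      fun {x y x' y'} s s' hx hy hs => by
    obtain ⟨x, e, rfl⟩ := exists_pair (X := A.base) (Y := (1 : C.Obj)) x
    obtain ⟨y, e', rfl⟩ := exists_pair (X := B.base) (Y := (1 : C.Obj)) y
    obtain rfl := eq_point e
    obtain rfl := eq_point e'
    obtain rfl := eq_of_heq ((pair_point_right _).symm.trans hx)
    obtain rfl := eq_of_heq ((pair_point_right _).symm.trans hy)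
    obtain ⟨q, p, rfl⟩ := R.exists_tensor s
    obtain rfl := eq_of_heq ((R.tensor_one q p).symm.trans hs)
    refine (FamilyHom.tensor_app α _ q p).trans ?_
    refine (StrictSymMonCat.tensor_heq rfl rfl rfl rfl HEq.rfl
      (heq_of_eq (FamilyHom.id_app (1 : Family G T) p))).trans (T.tensor_one _)
  braid_naturality {A B A' B'} α β := FamilyHom.ext_heq (C.braid_naturality _ _)
      fun {x y} s s' hs => by
    obtain ⟨x, x', rfl⟩ := exists_pair (X := A.base) (Y := A'.base) x
    obtain ⟨z, s, b, rfl⟩ := R.exists_comp s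
    obtain ⟨z, z', rfl⟩ := exists_pair (X := B.base) (Y := B'.base) z
    obtain ⟨p, q, rfl⟩ := R.exists_tensor s
    obtain rfl := R.eq_of_fiber_braid b
    -- Naturality holds for any elements over the two symmetries; taking `R.braid` for the second
    -- one factors the element on the right-hand side.
    obtain rfl := eq_of_heq ((R.braid_naturality p q b (R.braid _ _ _ _)).symm.trans hs)
    refine eq_of_heq ((heq_of_eq (FamilyHom.comp_app (α.tensor β) _ (R.tensor p q) b)).trans ?_)
    refine (heq_comp (Family.mul_val_pair _ _) (Family.mul_val_pair _ _) (Family.mul_val_pair _ _)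
      (FamilyHom.tensor_app α β p q) (FamilyHom.braid_app B B' b)).trans ?_
    refine (heq_of_eq (T.braid_naturality _ _)).trans ?_
    refine (heq_comp (Family.mul_val_pair _ _) (Family.mul_val_pair _ _) (Family.mul_val_pair _ _)
      (FamilyHom.braid_app A A' (R.braid _ _ _ _)) (FamilyHom.tensor_app β α q p)).symm.trans ?_
    exact heq_of_eq (FamilyHom.comp_app (FamilyHom.braid R A A') (β.tensor α) _
      (R.tensor q p)).symm
  braid_symmetry A B := FamilyHom.ext_heq (C.braid_symmetry _ _) fun {x y} s s' hs => by
    obtain ⟨x, x', rfl⟩ := exists_pair (X := A.base) (Y := B.base) x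
    obtain rfl := R.eq_of_fiber_id (X := A.base * B.base) s'
    obtain ⟨z, b, b', rfl⟩ := R.exists_comp s
    obtain rfl := R.eq_of_fiber_braid b
    refine eq_of_heq ((heq_of_eq (FamilyHom.comp_app (FamilyHom.braid R A B) _ b b')).trans ?_)
    refine (heq_comp (Family.mul_val_pair _ _) (Family.mul_val_pair _ _) (Family.mul_val_pair _ _)
      (FamilyHom.braid_app A B b) (FamilyHom.braid_app B A b')).trans ?_
    refine (heq_of_eq (T.braid_symmetry _ _)).trans
      ((id_heq (Family.mul_val_pair x x').symm).trans ?_)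
    exact heq_of_eq (FamilyHom.id_app (A * B) s').symm
  hexagon A B D :=
    letI := R.familyCategory T
    eq_comp_eqToHom_of_forall (E := Family G T) (b := FamilyHom.braid R A (B * D))
      (t₁ := FamilyHom.tensor (FamilyHom.braid R A B) (FamilyHom.id R D))
      (t₂ := FamilyHom.tensor (FamilyHom.id R B) (FamilyHom.braid R A D))
      (mul_assoc A B D).symm (mul_assoc B A D) (mul_assoc B D A).symm
      fun _ _ hp hq => FamilyHom.hexagon A B D hp hq

end SpanCat.ApexChoice

/-! ### The correspondence between functors out of internalizations and functors to families -/

namespace SpanCat.ApexChoice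

open Marking

variable {C H : StrictSymMonCat.{u, u}} {G : StrictSymMonFunctor C SpanCat.{u}}
  (R : ApexChoice G) (T : StrictSymMonCat.{u, u})

/-- The object of `C` underlying a family. -/
noncomputable def proj : StrictSymMonFunctor (R.families T) C where
  obj A := Family.base A
  map α := FamilyHom.hom α
  map_id _ := rfl
  map_comp _ _ := rfl
  obj_one := rfl
  obj_mul _ _ := rfl
  map_tensor _ _ := HEq.rfl
  map_braid _ _ := HEq.rfl

variable {R T}

/-- A morphism of the internalization. -/
def homMk {X Y : C.Obj} (f : X ⟶ Y) {x : Tuple (words G X)} {y : Tuple (words G Y)}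
    (s : (R.span f).Fiber x y) :
    @Quiver.Hom R.internalization.Obj _ (⟨X, x⟩ : Marking (words G)) (⟨Y, y⟩ : Marking (words G)) :=
  (⟨f, s⟩ : R.IntHom ⟨X, x⟩ ⟨Y, y⟩)

theorem homMk_id {X : C.Obj} {x : Tuple (words G X)} (s : (R.span (𝟙 X)).Fiber x x) :
    R.homMk (𝟙 X) s = 𝟙 (show R.internalization.Obj from (⟨X, x⟩ : Marking (words G))) :=
  R.intHom_ext rfl (heq_of_eq ((R.subsingleton_fiber_id X x x).elim _ _))

theorem homMk_braid {X Y : C.Obj} {x : Tuple (words G X)} {y : Tuple (words G Y)}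
    (s : (R.span (C.braid X Y)).Fiber (pair x y) (pair y x)) :
    R.homMk (C.braid X Y) s = R.internalization.braid (⟨X, x⟩ : Marking (words G))
      (⟨Y, y⟩ : Marking (words G)) :=
  R.intHom_ext rfl (heq_of_eq ((R.subsingleton_fiber_braid X Y x y).elim _ _))

/-- The family of values at the elements of an object. -/
def transposeObj (h : StrictSymMonFunctor H C)
    (a : StrictSymMonFunctor (R.pullback h).internalization T) (X : H.Obj) : Family G T :=
  ⟨h.obj X, fun x => a.obj (⟨X, x⟩ : Marking (words (h.comp G)))⟩

/-- The family of values at the elements of the apex of a morphism. -/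
def transposeMap (h : StrictSymMonFunctor H C)
    (a : StrictSymMonFunctor (R.pullback h).internalization T) {X Y : H.Obj} (f : X ⟶ Y) :
    R.FamilyHom (transposeObj h a X) (transposeObj h a Y) :=
  ⟨h.map f, fun s => a.map ((R.pullback h).homMk f s)⟩

theorem transposeObj_mul (h : StrictSymMonFunctor H C)
    (a : StrictSymMonFunctor (R.pullback h).internalization T) (X Y : H.Obj) :
    transposeObj h a (X * Y) = transposeObj h a X * transposeObj h a Y :=
  Family.ext_heq (h.obj_mul X Y) fun x x' hx => by
    obtain ⟨y, z, rfl⟩ := exists_pair (φ := words (h.comp G)) x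
    obtain rfl := eq_of_heq ((pair_comp_heq h y z).symm.trans hx)
    refine (a.obj_mul (⟨X, y⟩ : Marking (words (h.comp G))) ⟨Y, z⟩).trans ?_
    exact (Family.mul_val_pair (A := transposeObj h a X) (B := transposeObj h a Y) y z).symm

/-- The functor to families given by a functor from an internalization. -/
noncomputable def transpose (h : StrictSymMonFunctor H C)
    (a : StrictSymMonFunctor (R.pullback h).internalization T) :
    StrictSymMonFunctor H (R.families T) where
  obj := transposeObj h a
  map := transposeMap h a
  map_id X := FamilyHom.ext_heq (h.map_id X) fun {x y} s s' hs => by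
    obtain rfl := R.eq_of_fiber_id (X := h.obj X) s'
    refine Eq.trans ?_ (FamilyHom.id_app (R := R) _ s').symm
    exact (congrArg a.map ((R.pullback h).homMk_id (X := X) s)).trans (a.map_id _)
  map_comp {X Y Z} f g := FamilyHom.ext_heq (h.map_comp f g) fun {x z} s s' hs => by
    obtain ⟨y, p, q, rfl⟩ := R.exists_comp (f := h.map f) (g := h.map g) s'
    obtain rfl : s = (R.pullback h).comp (f := f) (g := g) p q :=
      eq_of_heq (hs.trans (cast_heq _ _).symm)
    refine Eq.trans ?_ (FamilyHom.comp_app (transposeMap h a f) (transposeMap h a g) p q).symm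
    exact a.map_comp ((R.pullback h).homMk f p) ((R.pullback h).homMk g q)
  obj_one := Family.ext_heq h.obj_one fun x x' _ =>
    (congrArg a.obj (congrArg (Marking.mk (φ := words (h.comp G)) 1)
      (eq_point (φ := words (h.comp G)) x))).trans a.obj_one
  obj_mul := transposeObj_mul h a
  map_tensor {X Y X' Y'} f g := FamilyHom.heq (transposeObj_mul h a _ _)
      (transposeObj_mul h a _ _) (h.map_tensor f g) fun {x y x' y'} s s' hx hy hs => by
    obtain ⟨x₁, x₂, rfl⟩ := exists_pair (φ := words (h.comp G)) x
    obtain ⟨y₁, y₂, rfl⟩ := exists_pair (φ := words (h.comp G)) y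
    obtain rfl := eq_of_heq ((pair_comp_heq h x₁ x₂).symm.trans hx)
    obtain rfl := eq_of_heq ((pair_comp_heq h y₁ y₂).symm.trans hy)
    obtain ⟨p, q, rfl⟩ := R.exists_tensor (f := h.map f) (g := h.map g) s'
    obtain rfl : s = (R.pullback h).tensor (f := f) (g := g) p q :=
      eq_of_heq (hs.trans (cast_heq _ _).symm)
    refine HEq.trans ?_ (FamilyHom.tensor_app (transposeMap h a f) (transposeMap h a g) p q).symm
    exact a.map_tensor ((R.pullback h).homMk f p) ((R.pullback h).homMk g q)
  map_braid X Y := FamilyHom.heq (transposeObj_mul h a _ _)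
      (transposeObj_mul h a _ _) (h.map_braid X Y) fun {x y x' y'} s s' hx hy hs => by
    obtain ⟨x₁, x₂, rfl⟩ := exists_pair (φ := words (h.comp G)) x
    obtain rfl := (R.pullback h).eq_of_fiber_braid s
    obtain rfl := eq_of_heq ((pair_comp_heq h x₁ x₂).symm.trans hx)
    obtain rfl := eq_of_heq ((pair_comp_heq h x₂ x₁).symm.trans hy)
    refine HEq.trans ?_
      (FamilyHom.braid_app (transposeObj h a X) (transposeObj h a Y) s').symm
    refine (heq_of_eq (congrArg a.map ((R.pullback h).homMk_braid (X := X) (Y := Y) s))).trans ?_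
    exact a.map_braid (⟨X, x₁⟩ : Marking (words (h.comp G))) ⟨Y, x₂⟩

/-- Units are picked from a nonempty fibre, so the two sides do not agree by definition; they agree
because the fibre has only one element. -/
theorem unit_pullback_heq (h : StrictSymMonFunctor H C) (X : H.Obj)
    (x : Tuple (words (h.comp G) X)) :
    HEq ((R.pullback h).unit X x) (R.unit (h.obj X) x) := by
  have e := R.fiber_congr (X := h.obj X) (Y := h.obj X) rfl rfl (heq_of_eq (h.map_id X))
    (x := x) (y := x) HEq.rfl HEq.rfl
  exact (cast_heq e _).symm.trans
    (heq_of_eq ((R.subsingleton_fiber_id (h.obj X) x x).elim _ _))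

theorem braid_pullback_heq (h : StrictSymMonFunctor H C) (X Y : H.Obj)
    (x : Tuple (words (h.comp G) X)) (y : Tuple (words (h.comp G) Y)) :
    HEq ((R.pullback h).braid X Y x y) (R.braid (h.obj X) (h.obj Y) x y) := by
  have e := R.fiber_congr (h.obj_mul X Y) (h.obj_mul Y X) (h.map_braid X Y)
    (pair_comp_heq (G := G) h x y) (pair_comp_heq (G := G) h y x)
  exact (cast_heq e _).symm.trans
    (heq_of_eq ((R.subsingleton_fiber_braid (h.obj X) (h.obj Y) x y).elim _ _))

/-- The functor from an internalization given by a functor to families. -/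
noncomputable def untranspose (b : StrictSymMonFunctor H (R.families T)) :
    StrictSymMonFunctor (R.pullback (b.comp (R.proj T))).internalization T where
  obj X := Family.val (b.obj X.base) X.elem
  map f := FamilyHom.app (b.map (IntHom.hom f)) (IntHom.point f)
  map_id X := (eq_of_heq (FamilyHom.app_heq rfl rfl (heq_of_eq (b.map_id X.base)) HEq.rfl HEq.rfl
    (unit_pullback_heq (b.comp (R.proj T)) X.base X.elem))).trans (FamilyHom.id_app _ _)
  map_comp f g := (eq_of_heq (FamilyHom.app_heq rfl rfl
      (heq_of_eq (b.map_comp (IntHom.hom f) (IntHom.hom g))) HEq.rfl HEq.rfl (cast_heq _ _))).trans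
    (FamilyHom.comp_app (b.map (IntHom.hom f)) (b.map (IntHom.hom g)) (IntHom.point f)
      (IntHom.point g))
  obj_one := Family.val_congr b.obj_one (point_comp_heq (b.comp (R.proj T)))
  obj_mul X Y := (Family.val_congr (b.obj_mul X.base Y.base)
    (pair_comp_heq (b.comp (R.proj T)) X.elem Y.elem)).trans (Family.mul_val_pair _ _)
  map_tensor f g := (FamilyHom.app_heq (b.obj_mul _ _) (b.obj_mul _ _)
      (b.map_tensor (IntHom.hom f) (IntHom.hom g)) (pair_comp_heq (b.comp (R.proj T)) _ _)
      (pair_comp_heq (b.comp (R.proj T)) _ _) (cast_heq _ _)).trans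
    (FamilyHom.tensor_app (b.map (IntHom.hom f)) (b.map (IntHom.hom g)) (IntHom.point f)
      (IntHom.point g))
  map_braid X Y := (FamilyHom.app_heq (b.obj_mul _ _) (b.obj_mul _ _)
      (b.map_braid X.base Y.base) (pair_comp_heq (b.comp (R.proj T)) _ _)
      (pair_comp_heq (b.comp (R.proj T)) _ _)
      (braid_pullback_heq (b.comp (R.proj T)) X.base Y.base X.elem Y.elem)).trans
    (FamilyHom.braid_app (b.obj X.base) (b.obj Y.base) (R.braid _ _ X.elem Y.elem))

/-- Passing to families loses nothing: `a` is read off from the values of its transpose, by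
`untranspose`. -/
theorem transpose_injective (h : StrictSymMonFunctor H C) :
    Function.Injective (transpose (R := R) (T := T) h) := by
  intro a a' e
  -- The domain of `untranspose b` depends on `b`, whence a variable `b` and a heterogeneous
  -- equality. For `b = transpose h a` the two sides coincide definitionally.
  have h₁ : ∀ b : StrictSymMonFunctor H (R.families T), transpose h a = b →
      HEq a (untranspose b) := by
    rintro _ rfl
    rfl
  exact eq_of_heq (h₁ _ e)

/-- Surjectivity of the correspondence onto functors over `C`. Once `h` is replaced by the
projection of `b`, the preimage is `untranspose b` on the nose. -/
theorem exists_transpose_eq (h : StrictSymMonFunctor H C)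
    (b : StrictSymMonFunctor H (R.families T)) (hb : b.comp (R.proj T) = h) :
    ∃ a, transpose h a = b := by
  subst hb
  exact ⟨untranspose b, rfl⟩

end SpanCat.ApexChoice

/-! ### Internalizations over free strict symmetric monoidal categories are free -/

namespace SpanCat

open Marking TensorScheme

variable {S : TensorScheme.{u}} (G : StrictSymMonFunctor S.free SpanCat.{u})

/-- Generating objects of the internalization. -/
abbrev MarkedPlace : Type u := Σ p : S.place, Tuple (words G (S.freePlace p))

/-- The product of a word of generating objects of the internalization. -/
def ofWord : FreeMonoid (MarkedPlace G) →* Marking (words G) :=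
  FreeMonoid.lift fun q => ⟨S.freePlace q.1, q.2⟩

theorem ofWord_of (q : MarkedPlace G) :
    ofWord G (FreeMonoid.of q) = ⟨S.freePlace q.1, q.2⟩ := FreeMonoid.lift_eval_of _ _

theorem ofWord_of_mul (q : MarkedPlace G) (a : FreeMonoid (MarkedPlace G)) :
    ofWord G (FreeMonoid.of q * a) = (⟨S.freePlace q.1, q.2⟩ : Marking (words G)) * ofWord G a := by
  rw [map_mul, ofWord_of]

theorem ofWord_surjective : Function.Surjective (ofWord G) := by
  rintro ⟨X, x⟩
  change FreeMonoid S.place at X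
  induction X using FreeMonoid.inductionOn' with
  | one => exact ⟨1, congrArg (Marking.mk (φ := words G) 1) (eq_point (φ := words G) x).symm⟩
  | of_mul p X ih =>
    obtain ⟨a, x, rfl⟩ := exists_pair (φ := words G) (X := S.freePlace p) (Y := X) x
    obtain ⟨b, hb⟩ := ih x
    exact ⟨FreeMonoid.of ⟨p, a⟩ * b, (ofWord_of_mul G _ _).trans (congrArg _ hb)⟩

/-- The first letter of the underlying word splits off uniquely, and so does its part of the tuple.
This is the cancellation step for uniqueness of words. -/
theorem mk_mul_inj {p p' : S.place} {x : Tuple (words G (S.freePlace p))}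
    {x' : Tuple (words G (S.freePlace p'))} {e e' : Marking (words G)}
    (h : (⟨S.freePlace p, x⟩ * e : Marking (words G)) = ⟨S.freePlace p', x'⟩ * e') :
    (⟨p, x⟩ : MarkedPlace G) = ⟨p', x'⟩ ∧ e = e' := by
  have hb : p :: FreeMonoid.toList e.base = p' :: FreeMonoid.toList e'.base :=
    congrArg Marking.base h
  obtain ⟨X, y⟩ := e
  obtain ⟨X', y'⟩ := e'
  obtain ⟨rfl, hX⟩ := List.cons.inj hb
  obtain rfl : X = X' := hX
  have he : pair x y = pair x' y' := by
    have : ∀ {e e' : Marking (words G)}, e = e' → HEq e.elem e'.elem := by rintro e _ rfl; rfl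
    exact eq_of_heq (this h)
  obtain ⟨rfl, rfl⟩ := pair_inj he
  exact ⟨rfl, rfl⟩

theorem ofWord_injective : Function.Injective (ofWord G) := by
  intro a
  induction a using FreeMonoid.inductionOn' with
  | one =>
    intro b h
    cases b using FreeMonoid.casesOn with
    | one => rfl
    | of_mul q b =>
      rw [ofWord_of_mul] at h
      exact (List.cons_ne_nil q.1 _ (congrArg Marking.base h).symm).elim
  | of_mul q a ih =>
    intro b h
    cases b using FreeMonoid.casesOn with
    | one =>
      rw [ofWord_of_mul] at h
      exact (List.cons_ne_nil q.1 _ (congrArg Marking.base h)).elim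
    | of_mul q' b =>
      rw [ofWord_of_mul, ofWord_of_mul] at h
      obtain ⟨h, h'⟩ := mk_mul_inj G h
      rw [ih h', show q = q' from h]

/-- Marked objects are words of generating objects. -/
noncomputable def word : Marking (words G) ≃* FreeMonoid (MarkedPlace G) :=
  (MulEquiv.ofBijective (ofWord G) ⟨ofWord_injective G, ofWord_surjective G⟩).symm

theorem ofWord_word (e : Marking (words G)) : ofWord G (word G e) = e :=
  (MulEquiv.ofBijective (ofWord G) _).apply_symm_apply e

theorem word_ofWord (a : FreeMonoid (MarkedPlace G)) : word G (ofWord G a) = a :=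
  (MulEquiv.ofBijective (ofWord G) _).symm_apply_apply a

variable {G} (R : ApexChoice G)

/-! ### Freeness of the internalization on marked places and marked transitions -/

namespace ApexChoice

/-- Generating morphisms of the internalization. -/
abbrev MarkedTransition : Type u :=
  Σ (t : S.transition) (x : Tuple (words G (S.source t))) (y : Tuple (words G (S.target t))),
    (R.span (S.freeGen t)).Fiber x y

/-- The generators of the internalization. -/
noncomputable def scheme : TensorScheme.{u} :=
  ⟨MarkedPlace G, R.MarkedTransition, fun t => word G ⟨S.source t.1, t.2.1⟩,
    fun t => word G ⟨S.target t.1, t.2.2.1⟩⟩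

variable {R}

/-- Transposed along the identity of `S.free`, this is `free_hom_ext` for functors to families. The
transposes compare at a generator exactly when the original functors compare at all elements over
it. -/
theorem internalization_hom_ext {T : StrictSymMonCat.{u, u}}
    {a a' : StrictSymMonFunctor R.internalization T}
    (h : ∀ p (x : Tuple (words G (S.freePlace p))), a.obj (⟨S.freePlace p, x⟩ : Marking (words G)) =
      a'.obj (⟨S.freePlace p, x⟩ : Marking (words G)))
    (h' : ∀ t (x : Tuple (words G (S.source t))) (y : Tuple (words G (S.target t)))
      (s : (R.span (S.freeGen t)).Fiber x y),
      HEq (a.map (R.homMk (S.freeGen t) s)) (a'.map (R.homMk (S.freeGen t) s))) : a = a' := by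
  refine transpose_injective (StrictSymMonFunctor.id S.free) ?_
  have hp : ∀ p, (transpose (StrictSymMonFunctor.id S.free) a).obj (S.freePlace p) =
      (transpose (StrictSymMonFunctor.id S.free) a').obj (S.freePlace p) := fun p =>
    Family.ext_heq rfl fun x x' hx => by
      cases hx
      exact h p x
  refine free_hom_ext hp fun t => FamilyHom.heq (free_obj_ext hp _) (free_obj_ext hp _) HEq.rfl
    fun {x y x' y'} s s' hx hy hs => ?_
  cases hx; cases hy; cases hs
  exact h' t x y s

variable (R)

/-- The functor from families of words. -/
noncomputable def toFamilies : StrictSymMonFunctor S.free (R.families R.scheme.free) :=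
  freeLift (N := S) (T := R.families R.scheme.free)
    { toFun X := (⟨X, fun x => word G ⟨X, x⟩⟩ : Family G R.scheme.free)
      map_one' := Family.ext_heq rfl fun x _ _ =>
        (congrArg (fun x => word G ⟨1, x⟩) (eq_point x)).trans (word G).map_one
      map_mul' X Y := Family.ext_heq rfl fun x x' hx => by
        cases hx
        obtain ⟨y, z, rfl⟩ := exists_pair (φ := words G) (X := X) (Y := Y) x
        refine ((word G).map_mul ⟨X, y⟩ ⟨Y, z⟩).trans ?_
        exact (Family.mul_val_pair (A := (⟨X, fun x => word G ⟨X, x⟩⟩ : Family G R.scheme.free))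
          (B := ⟨Y, fun x => word G ⟨Y, x⟩⟩) y z).symm }
    fun t => (⟨S.freeGen t, fun {x y} s => R.scheme.freeGen ⟨t, x, y, s⟩⟩ :
      R.FamilyHom (⟨S.source t, fun x => word G ⟨S.source t, x⟩⟩ : Family G R.scheme.free)
        ⟨S.target t, fun x => word G ⟨S.target t, x⟩⟩)

/-- The functor to the internalization given by its generators. -/
noncomputable def ofScheme : StrictSymMonFunctor R.scheme.free R.internalization :=
  freeLift (N := R.scheme) (T := R.internalization) (ofWord G) fun t =>
    castHom (C := R.internalization.Obj) (ofWord_word G _) (ofWord_word G _)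
      (R.homMk (S.freeGen t.1) t.2.2.2)

theorem exists_toScheme : ∃ L : StrictSymMonFunctor R.internalization R.scheme.free,
    (∀ e, L.obj e = word G e) ∧ ∀ t (x : Tuple (words G (S.source t)))
      (y : Tuple (words G (S.target t))) (s : (R.span (S.freeGen t)).Fiber x y),
      HEq (L.map (R.homMk (S.freeGen t) s)) (R.scheme.freeGen ⟨t, x, y, s⟩) := by
  -- `toFamilies` is a section of the projection to `S.free`, since it is one on generators; it
  -- therefore comes from a functor on the internalization.
  obtain ⟨L, hL⟩ := exists_transpose_eq (StrictSymMonFunctor.id S.free) R.toFamilies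
    (free_hom_ext (fun _ => rfl) fun _ => HEq.rfl)
  refine ⟨L, fun e => ?_, fun t x y s => ?_⟩
  · exact Family.val_congr (StrictSymMonFunctor.obj_congr hL e.base) (HEq.refl e.elem)
  · exact FamilyHom.app_heq (StrictSymMonFunctor.obj_congr hL _)
      (StrictSymMonFunctor.obj_congr hL _) (StrictSymMonFunctor.map_congr hL (S.freeGen t))
      (HEq.refl x) (HEq.refl y) (HEq.refl s)

/-- The internalization is free. -/
theorem exists_iso_scheme : ∃ i : R.internalization ≅ R.scheme.free,
    (∀ e, (StrictSymMonCat.toFun i.hom).obj e = word G e) ∧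
    ∀ a, (StrictSymMonCat.toFun i.inv).obj a = ofWord G a := by
  obtain ⟨L, hL, hL'⟩ := R.exists_toScheme
  refine ⟨⟨L, R.ofScheme, ?_, ?_⟩, hL, fun _ => rfl⟩
  · have ho : ∀ e, R.ofScheme.obj (L.obj e) = e := fun e =>
      (congrArg (ofWord G) (hL e)).trans (ofWord_word G e)
    refine internalization_hom_ext (fun p x => ho _) fun t x y s => ?_
    refine (StrictSymMonFunctor.functor_map_heq R.ofScheme.toFunctor (hL _) (hL _)
      (hL' t x y s)).trans ?_
    exact castHom_heq (C := R.internalization.Obj) (ofWord_word G _) (ofWord_word G _) _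
  · have ho : ∀ a, L.obj (R.ofScheme.obj a) = a := fun a =>
      (hL _).trans (word_ofWord G a)
    refine free_hom_ext (fun p => ho _) fun t => ?_
    refine (StrictSymMonFunctor.functor_map_heq L.toFunctor (ofWord_word G _) (ofWord_word G _)
      (castHom_heq (C := R.internalization.Obj) (ofWord_word G _) (ofWord_word G _) _)).trans ?_
    exact hL' _ _ _ _

theorem nonempty_netPresentation : Nonempty (NetPresentation R.internalization) := by
  obtain ⟨i, -⟩ := R.exists_iso_scheme
  obtain ⟨P⟩ := R.scheme.nonempty_netPresentation
  exact ⟨⟨P.net, P.iso ≪≫ i.symm⟩⟩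

/-- Internalizations for two choices of apexes are isomorphic. -/
theorem exists_iso_of_choices (R R' : ApexChoice G) :
    ∃ i : R.internalization ≅ R'.internalization,
      ∀ e, (StrictSymMonCat.toFun i.hom).obj e = e := by
  obtain ⟨i, hi, -⟩ := R.exists_iso_scheme
  obtain ⟨j, -, hj⟩ := R'.exists_iso_scheme
  -- Both choices represent the same isomorphism class at each generator, so their fibres are in
  -- bijection. By freeness these bijections need no coherence.
  have e : ∀ t (x : Tuple (words G (S.source t))) (y : Tuple (words G (S.target t))),
      Nonempty ((R.span (S.freeGen t)).Fiber x y ≃ (R'.span (S.freeGen t)).Fiber x y) :=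
    fun t x y => SetSpan.fiber_equiv_of_heq rfl rfl
      (heq_of_eq ((R.cls_span _).trans (R'.cls_span _).symm)) HEq.rfl HEq.rfl
  obtain ⟨k, hk⟩ := exists_free_iso (fun t : R.MarkedTransition => word G ⟨S.source t.1, t.2.1⟩)
    (fun t => word G ⟨S.target t.1, t.2.2.1⟩)
    (fun t : R'.MarkedTransition => word G ⟨S.source t.1, t.2.1⟩)
    (fun t => word G ⟨S.target t.1, t.2.2.1⟩)
    (Equiv.sigmaCongrRight fun t => Equiv.sigmaCongrRight fun x => Equiv.sigmaCongrRight fun y =>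
      (e t x y).some) (fun _ => .refl _) (fun _ => .refl _)
  refine ⟨i ≪≫ k ≪≫ j.symm, fun a => ?_⟩
  refine (congrArg _ ((congrArg _ (hi a)).trans (hk _))).trans ((hj _).trans (ofWord_word G a))

theorem exists_iso_of_eq {G' : StrictSymMonFunctor S.free SpanCat.{u}} (h : G = G')
    (R : ApexChoice G) (R' : ApexChoice G') :
    ∃ i : R.internalization ≅ R'.internalization,
      ∀ (X : S.free.Obj) (x : Tuple (words G X)) (x' : Tuple (words G' X)), HEq x x' →
        (StrictSymMonCat.toFun i.hom).obj (⟨X, x⟩ : Marking (words G)) =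
          (⟨X, x'⟩ : Marking (words G')) := by
  subst h
  obtain ⟨i, hi⟩ := exists_iso_of_choices R R'
  refine ⟨i, fun X x x' hx => ?_⟩
  cases hx
  exact hi _

end ApexChoice

end SpanCat

/-! ### Generating objects as indecomposable elements -/

/-- A nontrivial element of a monoid without nontrivial factorizations. -/
def IsIndecomposable {M : Type u} [Monoid M] (a : M) : Prop :=
  a ≠ 1 ∧ ∀ x y, a = x * y → x = 1 ∨ y = 1

theorem isIndecomposable_of {α : Type u} (p : α) : IsIndecomposable (FreeMonoid.of p) := by
  refine ⟨FreeMonoid.of_ne_one p, fun x y h => ?_⟩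
  have := congrArg FreeMonoid.length h
  rw [FreeMonoid.length_mul, FreeMonoid.length_of] at this
  rw [← FreeMonoid.length_eq_zero, ← FreeMonoid.length_eq_zero]
  omega

theorem IsIndecomposable.exists_eq_of {α : Type u} {a : FreeMonoid α} (h : IsIndecomposable a) :
    ∃ p, a = FreeMonoid.of p := by
  cases a using FreeMonoid.casesOn with
  | one => exact (h.1 rfl).elim
  | of_mul p b =>
    rcases h.2 _ _ rfl with h' | h'
    · exact (FreeMonoid.of_ne_one p h').elim
    · exact ⟨p, by rw [h', mul_one]⟩

theorem IsIndecomposable.map {M : Type u₁} {N : Type u₂} [Monoid M] [Monoid N] {a : M}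
    (h : IsIndecomposable a) (m : M →* N) (hm : Function.Bijective m) :
    IsIndecomposable (m a) := by
  refine ⟨fun e => h.1 (hm.1 (e.trans m.map_one.symm)), fun x y e => ?_⟩
  obtain ⟨x, rfl⟩ := hm.2 x
  obtain ⟨y, rfl⟩ := hm.2 y
  refine (h.2 x y (hm.1 (e.trans (m.map_mul x y).symm))).imp ?_ ?_ <;>
  · rintro rfl
    exact m.map_one

namespace Marking

variable {M : Type v₁} [Monoid M] {φ : M →* FreeMonoid (Type u)}

theorem eq_one_of_base {e : Marking φ} (h : e.base = 1) : e = 1 := by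
  obtain ⟨X, x⟩ := e
  obtain rfl : X = 1 := h
  exact congrArg (Marking.mk 1) (eq_point x)

/-- A factorization of the underlying object lifts, because an element of a product is a pair; and
only the unit of marked objects lies over `1`. -/
theorem isIndecomposable_iff {e : Marking φ} : IsIndecomposable e ↔ IsIndecomposable e.base := by
  constructor
  · refine fun h => ⟨fun h' => h.1 (eq_one_of_base h'), fun X Y hXY => ?_⟩
    obtain ⟨Z, z⟩ := e
    obtain rfl : Z = X * Y := hXY
    obtain ⟨x, y, rfl⟩ := exists_pair z
    exact (h.2 ⟨X, x⟩ ⟨Y, y⟩ rfl).imp (congrArg Marking.base) (congrArg Marking.base)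
  · refine fun h => ⟨fun h' => h.1 (congrArg Marking.base h'), fun a b hab => ?_⟩
    exact (h.2 a.base b.base (congrArg Marking.base hab)).imp eq_one_of_base eq_one_of_base

end Marking

namespace StrictSymMonCat

variable {C D : StrictSymMonCat.{v, u}}

theorem iso_inv_obj_hom_obj (i : C ≅ D) (X : C.Obj) :
    (toFun i.inv).obj ((toFun i.hom).obj X) = X :=
  StrictSymMonFunctor.obj_congr i.hom_inv_id X

theorem iso_bijective (i : C ≅ D) : Function.Bijective (toFun i.hom).obj :=
  Function.bijective_iff_has_inverse.2
    ⟨(toFun i.inv).obj, iso_inv_obj_hom_obj i, iso_inv_obj_hom_obj i.symm⟩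

theorem iso_faithful (i : C ≅ D) : (toFun i.hom).toFunctor.Faithful where
  map_injective {X Y} f g h := by
    have h' := fun f : X ⟶ Y => StrictSymMonFunctor.map_congr i.hom_inv_id f
    exact eq_of_heq ((h' f).symm.trans
      ((heq_of_eq (congrArg (toFun i.inv).map h)).trans (h' g)))

end StrictSymMonCat

/-! ### Pushouts of internalizations -/

theorem isPushout_of_existsUnique {C : Type u₁} [Category.{v₁} C] {Z X Y P : C} {f : Z ⟶ X}
    {g : Z ⟶ Y} {i : X ⟶ P} {j : Y ⟶ P} (w : f ≫ i = g ≫ j)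
    (h : ∀ {T : C} (a : X ⟶ T) (b : Y ⟶ T), f ≫ a = g ≫ b → ∃! c : P ⟶ T, i ≫ c = a ∧ j ≫ c = b) :
    IsPushout f g i j := by
  refine ⟨⟨w⟩, ⟨Limits.PushoutCocone.IsColimit.mk w (fun s => (h s.inl s.inr s.condition).choose)
    (fun s => (h s.inl s.inr s.condition).choose_spec.1.1)
    (fun s => (h s.inl s.inr s.condition).choose_spec.1.2) fun s m h₁ h₂ => ?_⟩⟩
  exact (h s.inl s.inr s.condition).choose_spec.2 m ⟨h₁, h₂⟩

/-- Moves a pushout of internalizations to the presenting nets. `v`, `q`, `p` are the presentations,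
while `k` and `l` change the choices of apexes. -/
theorem isPushout_of_isos {C : Type u₁} [Category.{v₁} C] {Z V D B Q A P B' D' : C} (i : Z ⟶ V)
    (v : V ≅ D) (h : D ⟶ B) (q : Q ≅ B) (k : B ≅ B') (l : D ≅ D') (p : P ≅ A) {l₁ : B' ⟶ A}
    {l₂ : D' ⟶ A} (hp : IsPushout ((i ≫ v.hom) ≫ h ≫ k.hom) ((i ≫ v.hom) ≫ l.hom) l₁ l₂) :
    IsPushout (i ≫ (v.hom ≫ h) ≫ q.inv) i (q.hom ≫ k.hom ≫ l₁ ≫ p.inv)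
      (v.hom ≫ l.hom ≫ l₂ ≫ p.inv) :=
  hp.of_iso (Iso.refl _) (k.symm ≪≫ q.symm) (l.symm ≪≫ v.symm) p.symm (by simp) (by simp)
    (by simp) (by simp)

namespace SpanCat.ApexChoice

open Marking TensorScheme StrictSymMonCat

variable {M K W : PetriNet.{u}} {w : StrictSymMonFunctor W.free K.free}
  {ι₁ : StrictSymMonFunctor K.free M.free} {ι₂ : StrictSymMonFunctor W.free M.free}

/-- The pushout property of `M` is applied with target the families of objects of `T`, then
transposed back. The places of `W` are the only overlap, so agreement of `a` and `b` on objects is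
the whole compatibility condition. -/
theorem existsUnique_desc (hp : IsPushout (C := StrictSymMonCat.{u, u}) (W.incl.comp w) W.incl ι₁ ι₂)
    {G : StrictSymMonFunctor M.free SpanCat.{u}} (R : ApexChoice G) {T : StrictSymMonCat.{u, u}}
    (a : StrictSymMonFunctor (R.pullback ι₁).internalization T)
    (b : StrictSymMonFunctor (R.pullback ι₂).internalization T)
    (hab : ∀ (X : W.free.Obj) (x : Tuple (words (ι₁.comp G) (w.obj X)))
      (x' : Tuple (words (ι₂.comp G) X)), HEq x x' →
        a.obj (⟨w.obj X, x⟩ : Marking (words (ι₁.comp G))) =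
          b.obj (⟨X, x'⟩ : Marking (words (ι₂.comp G)))) :
    ∃! c : StrictSymMonFunctor R.internalization T,
      (R.lift ι₁).comp c = a ∧ (R.lift ι₂).comp c = b := by
  have hw : (W.incl.comp w).comp ι₁ = W.incl.comp ι₂ := hp.w
  have ht : (W.incl.comp w).comp (transpose ι₁ a) = W.incl.comp (transpose ι₂ b) :=
    free_hom_ext (N := W.discrete.scheme) (fun p => Family.ext_heq
      (StrictSymMonFunctor.obj_congr hw _) fun x x' hx => hab _ x x' hx) fun t => t.elim
  have h₁ := hp.inl_desc (transpose ι₁ a) (transpose ι₂ b) ht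
  have h₂ := hp.inr_desc (transpose ι₁ a) (transpose ι₂ b) ht
  set m : StrictSymMonFunctor M.free (R.families T) :=
    hp.desc (transpose ι₁ a) (transpose ι₂ b) ht
  -- The transposes lie over `ι₁` and `ι₂`, so uniqueness in the pushout makes the induced functor
  -- lie over the identity.
  have hm : m.comp (R.proj T) = StrictSymMonFunctor.id M.free :=
    hp.hom_ext (congrArg (fun F => StrictSymMonFunctor.comp F (R.proj T)) h₁)
      (congrArg (fun F => StrictSymMonFunctor.comp F (R.proj T)) h₂)
  -- Pulling `R` back along the identity gives `R` by definition, so `c` is a functor on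
  -- `R.internalization`.
  obtain ⟨c, hc⟩ := exists_transpose_eq _ m hm
  refine ⟨c, ⟨transpose_injective ι₁ ?_, transpose_injective ι₂ ?_⟩, fun c' hc' => ?_⟩
  -- Transposition is natural by definition: the transpose of `(R.lift ι₁).comp c` is `ι₁` followed
  -- by the transpose of `c`.
  · exact (congrArg ι₁.comp hc).trans h₁
  · exact (congrArg ι₂.comp hc).trans h₂
  · refine transpose_injective (StrictSymMonFunctor.id M.free) ?_
    refine Eq.trans (hp.hom_ext ?_ ?_) hc.symm
    · exact (congrArg (transpose ι₁) hc'.1).trans h₁.symm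
    · exact (congrArg (transpose ι₂) hc'.2).trans h₂.symm

theorem exists_tuple_heq {C : StrictSymMonCat.{u, u}} {G G' : StrictSymMonFunctor C SpanCat.{u}}
    (h : G = G') (X : C.Obj) (x : Tuple (words G X)) : ∃ x' : Tuple (words G' X), HEq x x' := by
  subst h; exact ⟨x, HEq.rfl⟩

/-! ### Properties that the lift inherits, and the lemma for spans -/

theorem isIndecomposable_lift {C H : PetriNet.{u}} (F : StrictSymMonFunctor H.free C.free)
    (hF : ∀ p : H.place, ∃ q : C.place, F.obj (H.scheme.freePlace p) = C.scheme.freePlace q)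
    {G : StrictSymMonFunctor C.free SpanCat.{u}} (R : ApexChoice G)
    {e : Marking (words (F.comp G))} (h : IsIndecomposable e) :
    IsIndecomposable ((R.lift F).obj e : Marking (words G)) := by
  obtain ⟨p, hp⟩ := (isIndecomposable_iff.1 h).exists_eq_of (α := H.place)
  obtain ⟨q, hq⟩ := hF p
  refine isIndecomposable_iff.2 ?_
  change IsIndecomposable (F.obj e.base)
  rw [hp]
  exact hq ▸ isIndecomposable_of q

theorem lift_obj_injective {C H : PetriNet.{u}} (F : StrictSymMonFunctor H.free C.free)
    (hF : Function.Injective F.obj) {G : StrictSymMonFunctor C.free SpanCat.{u}}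
    (R : ApexChoice G) : Function.Injective (R.lift F).obj := by
  rintro ⟨X, x⟩ ⟨Y, y⟩ h
  obtain rfl : X = Y := hF (congrArg Marking.base h)
  have : ∀ {e e' : Marking (words G)}, e = e' → HEq e.elem e'.elem := by rintro e _ rfl; rfl
  exact Marking.ext_heq rfl (this h)

theorem lift_faithful {C H : PetriNet.{u}} (F : StrictSymMonFunctor H.free C.free)
    (hF : F.toFunctor.Faithful) {G : StrictSymMonFunctor C.free SpanCat.{u}}
    (R : ApexChoice G) : (R.lift F).toFunctor.Faithful where
  map_injective {X Y} f g h := by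
    have h₁ : F.map (IntHom.hom f) = F.map (IntHom.hom g) := congrArg IntHom.hom h
    have : ∀ {e e' : Marking (words G)} {f g : R.IntHom e e'}, f = g → HEq f.point g.point := by
      rintro _ _ f _ rfl; rfl
    exact (R.pullback F).intHom_ext (F.toFunctor.map_injective h₁) (this h)

/-- Internalization preserves additions of generating morphisms. -/
theorem isAddition {M K : NetWithSemantics.{u + 1, u, u + 1} SpanCat.{u}} {W : PetriNet.{u}}
    {w : StrictSymMonFunctor W.free K.net.free} (h : M.IsAddition K W w) (R : ApexChoice M.sem)
    (R' : ApexChoice K.sem) :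
    StrictSymMonCat.IsAddition R.internalization R'.internalization
      (R'.pullback w).internalization (R'.lift w) := by
  refine ⟨ApexChoice.nonempty_netPresentation (S := M.net.scheme) R,
    ApexChoice.nonempty_netPresentation (S := K.net.scheme) R',
    ApexChoice.nonempty_netPresentation (S := W.scheme) (R'.pullback w), fun P Q V => ⟨?_, ?_, ?_, ?_⟩⟩
  · intro p
    -- The presentations are arbitrary isomorphisms, but they preserve indecomposability, and the
    -- indecomposable words are the single letters.
    have h₁ : IsIndecomposable ((toFun V.iso.hom).obj (V.net.scheme.freePlace p)) :=
      (isIndecomposable_of p).map (toFun V.iso.hom).objHom (iso_bijective V.iso)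
    have h₂ := (isIndecomposable_lift w h.map_generator R' h₁).map
      (toFun Q.iso.inv).objHom (iso_bijective Q.iso.symm)
    exact h₂.exists_eq_of (α := Q.net.place)
  · exact (iso_bijective Q.iso.symm).1.comp
      ((lift_obj_injective w h.injective R').comp (iso_bijective V.iso).1)
  · have h₁ : (toFun V.iso.hom).toFunctor.Faithful := iso_faithful V.iso
    have h₂ : (toFun Q.iso.inv).toFunctor.Faithful := iso_faithful Q.iso.symm
    have h₃ := lift_faithful w h.faithful R'
    exact ⟨fun hfg => h₁.map_injective (h₃.map_injective (h₂.map_injective hfg))⟩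
  · obtain ⟨ι₁, ι₂, hp, hι₁, hι₂⟩ := h.exists_pushout
    -- `k` and `l` replace the prescribed choices by those pulled back from `R`. They are obtained
    -- independently and are controlled only on objects.
    obtain ⟨k, hk⟩ := exists_iso_of_eq (S := K.net.scheme) hι₁.symm R' (R.pullback ι₁)
    obtain ⟨l, hl⟩ := exists_iso_of_eq (S := W.scheme) hι₂.symm (R'.pullback w) (R.pullback ι₂)
    have hw : (W.incl.comp w).comp ι₁ = W.incl.comp ι₂ := hp.w
    let e : V.net.discrete.free ⟶ (R'.pullback w).internalization := V.net.incl ≫ V.iso.hom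
    let lw : (R'.pullback w).internalization ⟶ R'.internalization := R'.lift w
    let l₁ : (R.pullback ι₁).internalization ⟶ R.internalization := R.lift ι₁
    let l₂ : (R.pullback ι₂).internalization ⟶ R.internalization := R.lift ι₂
    have hkl : ∀ E, (toFun l₁).obj ((toFun k.hom).obj ((toFun lw).obj E)) =
        (toFun l₂).obj ((toFun l.hom).obj E) := by
      rintro ⟨X, x⟩
      obtain ⟨y, hy⟩ := exists_tuple_heq hι₁.symm (w.obj X) x
      obtain ⟨z, hz⟩ := exists_tuple_heq hι₂.symm X x
      refine (congrArg (toFun l₁).obj (hk (w.obj X) x y hy)).trans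
        (Eq.trans ?_ (congrArg (toFun l₂).obj (hl X x z hz)).symm)
      exact Marking.ext_heq (StrictSymMonFunctor.obj_congr hw X) (hy.symm.trans hz)
    -- The corner has no generating morphisms, so commutation on objects is enough; no relation
    -- between `k` and `l` on morphisms enters.
    have sq : (e ≫ lw ≫ k.hom) ≫ l₁ = (e ≫ l.hom) ≫ l₂ :=
      free_hom_ext (N := V.net.discrete.scheme) (fun p => hkl _) fun t => t.elim
    have hpo : IsPushout (e ≫ lw ≫ k.hom) (e ≫ l.hom) l₁ l₂ := by
      refine isPushout_of_existsUnique sq fun a b hab => existsUnique_desc hp R a b ?_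
      intro X x x' hx
      obtain ⟨z, hz⟩ := exists_tuple_heq hι₂ X x'
      -- Every marked object comes from a word in the places of the presenting net, so `hab` gives
      -- agreement on all objects.
      obtain ⟨E, hE⟩ := (iso_bijective V.iso).2 (⟨X, z⟩ : Marking (words (w.comp K.sem)))
      have := StrictSymMonFunctor.obj_congr hab E
      change (toFun a).obj ((toFun k.hom).obj ((toFun lw).obj ((toFun V.iso.hom).obj E))) =
        (toFun b).obj ((toFun l.hom).obj ((toFun V.iso.hom).obj E)) at this
      rw [hE] at this
      refine (congrArg (toFun a).obj (hk (w.obj X) z x (hx.trans hz).symm)).symm.trans ?_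
      exact this.trans (congrArg (toFun b).obj (hl X z x' hz.symm))
    exact ⟨toFun (Q.iso.hom ≫ k.hom ≫ l₁ ≫ P.iso.inv),
      toFun (V.iso.hom ≫ l.hom ≫ l₂ ≫ P.iso.inv),
      isPushout_of_isos V.net.incl V.iso lw Q.iso k l P.iso hpo, rfl, rfl⟩

end SpanCat.ApexChoice

/-! ### Partial functions as spans -/

/-- Spans whose fibres have at most one element are relations, and such a span is determined up to
isomorphism by the pairs it relates. -/
theorem SetSpan.cls_eq_of_fibers {A B : FreeMonoid (Type u)} {S T : SetSpan A B}
    (hS : ∀ x y, Subsingleton (S.Fiber x y)) (hT : ∀ x y, Subsingleton (T.Fiber x y))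
    (h : ∀ x y, Nonempty (S.Fiber x y) ↔ Nonempty (T.Fiber x y)) : S.cls = T.cls := by
  have hf : ∀ s, ∃ t, T.left t = S.left s ∧ T.right t = S.right s := fun s =>
    ((h _ _).1 ⟨⟨s, rfl, rfl⟩⟩).elim fun t => ⟨t.1, t.2⟩
  choose f hf using hf
  refine SetSpan.cls_eq (Equiv.ofBijective f ⟨fun s s' hs => ?_, fun t => ?_⟩) hf
  · exact congrArg Subtype.val ((hS (S.left s) (S.right s)).elim ⟨s, rfl, rfl⟩
      ⟨s', by rw [← (hf s').1, ← hs, (hf s).1], by rw [← (hf s').2, ← hs, (hf s).2]⟩)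
  · obtain ⟨s⟩ := (h _ _).2 ⟨⟨t, rfl, rfl⟩⟩
    exact ⟨s.1, congrArg Subtype.val ((hT (T.left t) (T.right t)).elim
      ⟨f s.1, (hf s.1).1.trans s.2.1, (hf s.1).2.trans s.2.2⟩ ⟨t, rfl, rfl⟩)⟩

namespace PartialMap

/-- The graph of a partial function. -/
def graph {A B : FreeMonoid (Type u)} (f : PartialMap A B) : SetSpan A B where
  apex := { p : Tuple A × Tuple B // f.Sends p.1 p.2 }
  left p := p.1.1
  right p := p.1.2

theorem sends_unique {A B : FreeMonoid (Type u)} {f : PartialMap A B} {x : Tuple A}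
    {y y' : Tuple B} (h : f.Sends x y) (h' : f.Sends x y') : y = y' := Part.mem_unique h h'

instance subsingleton_fiber_graph {A B : FreeMonoid (Type u)} (f : PartialMap A B) (x : Tuple A)
    (y : Tuple B) : Subsingleton (f.graph.Fiber x y) :=
  ⟨fun s t => Subtype.ext (Subtype.ext
    (Prod.ext (s.2.1.trans t.2.1.symm) (s.2.2.trans t.2.2.symm)))⟩

theorem nonempty_fiber_graph {A B : FreeMonoid (Type u)} {f : PartialMap A B} {x : Tuple A}
    {y : Tuple B} : Nonempty (f.graph.Fiber x y) ↔ f.Sends x y := by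
  constructor
  · rintro ⟨⟨⟨⟨x, y⟩, h⟩, rfl, rfl⟩⟩
    exact h
  · exact fun h => ⟨⟨⟨(x, y), h⟩, rfl, rfl⟩⟩

theorem cls_graph_eq {A B : FreeMonoid (Type u)} {f : PartialMap A B} {S : SetSpan A B}
    (hS : ∀ x y, Subsingleton (S.Fiber x y))
    (h : ∀ x y, f.Sends x y ↔ Nonempty (S.Fiber x y)) : f.graph.cls = S.cls :=
  SetSpan.cls_eq_of_fibers (fun _ _ => inferInstance) hS fun x y =>
    nonempty_fiber_graph.trans (h x y)

theorem cls_graph_id (A : FreeMonoid (Type u)) :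
    (PartialMap.id A).graph.cls = (SetSpan.id A).cls :=
  cls_graph_eq (fun _ _ => ⟨fun s t => Subtype.ext (s.2.1.trans t.2.1.symm)⟩) fun x _ =>
    sends_id.trans ⟨fun h => ⟨⟨x, rfl, h⟩⟩, fun ⟨s⟩ => s.2.1.symm.trans s.2.2⟩

/-- Since `f` is single-valued, the middle element of a composable pair is determined by its source.
The pullback therefore has no multiplicities and is again a relation. -/
theorem cls_graph_comp {A B D : FreeMonoid (Type u)} (f : PartialMap A B) (g : PartialMap B D) :
    (f.comp g).graph.cls = (f.graph.comp g.graph).cls := by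
  refine cls_graph_eq (fun x z => ⟨?_⟩) fun x z => sends_comp.trans ⟨?_, ?_⟩
  · rintro ⟨⟨⟨⟨⟨x₁, y₁⟩, h₁⟩, ⟨⟨y₁', z₁⟩, k₁⟩⟩, e₁⟩, l₁, r₁⟩
      ⟨⟨⟨⟨⟨x₂, y₂⟩, h₂⟩, ⟨⟨y₂', z₂⟩, k₂⟩⟩, e₂⟩, l₂, r₂⟩
    obtain rfl : y₁ = y₁' := e₁
    obtain rfl : y₂ = y₂' := e₂
    obtain rfl : x₁ = x := l₁
    obtain rfl : x₂ = x₁ := l₂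
    obtain rfl : z₁ = z := r₁
    obtain rfl : z₂ = z₁ := r₂
    obtain rfl : y₁ = y₂ := sends_unique h₁ h₂
    rfl
  · rintro ⟨y, h, k⟩
    exact ⟨⟨⟨(⟨(x, y), h⟩, ⟨(y, z), k⟩), rfl⟩, rfl, rfl⟩⟩
  · rintro ⟨⟨⟨⟨⟨⟨x₁, y₁⟩, h₁⟩, ⟨⟨y₁', z₁⟩, k₁⟩⟩, e₁⟩, rfl, rfl⟩⟩
    obtain rfl : y₁ = y₁' := e₁
    exact ⟨y₁, h₁, k₁⟩

theorem cls_graph_prod {A B A' B' : FreeMonoid (Type u)} (f : PartialMap A B)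
    (g : PartialMap A' B') : (f.prod g).graph.cls = (f.graph.prod g.graph).cls := by
  refine cls_graph_eq (fun z w => ⟨?_⟩) fun z w => ?_
  · rintro ⟨⟨⟨⟨x₁, y₁⟩, h₁⟩, ⟨⟨x₁', y₁'⟩, k₁⟩⟩, l₁, r₁⟩ ⟨⟨⟨⟨x₂, y₂⟩, h₂⟩, ⟨⟨x₂', y₂'⟩, k₂⟩⟩, l₂, r₂⟩
    obtain ⟨h, h'⟩ := Tuple.append_inj.1 (l₁.trans l₂.symm)
    obtain ⟨k, k'⟩ := Tuple.append_inj.1 (r₁.trans r₂.symm)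
    obtain rfl : x₁ = x₂ := h
    obtain rfl : x₁' = x₂' := h'
    obtain rfl : y₁ = y₂ := k
    obtain rfl : y₁' = y₂' := k'
    rfl
  · obtain ⟨x, x', rfl⟩ := z.exists_append
    obtain ⟨y, y', rfl⟩ := w.exists_append
    refine sends_prod.trans ⟨?_, ?_⟩
    · rintro ⟨h, k⟩
      exact ⟨⟨(⟨(x, y), h⟩, ⟨(x', y'), k⟩), rfl, rfl⟩⟩
    · rintro ⟨⟨⟨⟨⟨x₁, y₁⟩, h₁⟩, ⟨⟨x₁', y₁'⟩, k₁⟩⟩, l, r⟩⟩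
      obtain ⟨h, h'⟩ := Tuple.append_inj.1 l
      obtain ⟨k, k'⟩ := Tuple.append_inj.1 r
      obtain rfl : x₁ = x := h
      obtain rfl : x₁' = x' := h'
      obtain rfl : y₁ = y := k
      obtain rfl : y₁' = y' := k'
      exact ⟨h₁, k₁⟩

theorem cls_graph_swap (A B : FreeMonoid (Type u)) :
    (swap A B).graph.cls = (SetSpan.swap A B).cls := by
  refine cls_graph_eq (fun z w => ⟨fun s t => Subtype.ext ?_⟩) fun z w => ?_
  · obtain ⟨h, h'⟩ := Tuple.append_inj.1 (s.2.1.trans t.2.1.symm)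
    exact Prod.ext h h'
  · obtain ⟨x, y, rfl⟩ := z.exists_append
    obtain ⟨y', x', rfl⟩ := w.exists_append
    refine sends_swap.trans ⟨?_, ?_⟩
    · rintro ⟨rfl, rfl⟩
      exact ⟨⟨(x, y), rfl, rfl⟩⟩
    · rintro ⟨⟨a, b⟩, l, r⟩
      obtain ⟨rfl, rfl⟩ := Tuple.append_inj.1 l
      obtain ⟨h, h'⟩ := Tuple.append_inj.1 r
      exact ⟨h', h⟩

end PartialMap

/-! ### The graph functor and the comparison of the two internalizations -/

namespace SetPartial

open Marking StrictSymMonCat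

/-- The functor sending a partial function to its graph. -/
def toSpan : StrictSymMonFunctor SetPartial.{u} SpanCat.{u} where
  obj A := A
  map f := (PartialMap.graph f).cls
  map_id A := PartialMap.cls_graph_id A
  map_comp f g := PartialMap.cls_graph_comp f g
  obj_one := rfl
  obj_mul _ _ := rfl
  map_tensor f g := heq_of_eq (PartialMap.cls_graph_prod f g)
  map_braid A B := heq_of_eq (PartialMap.cls_graph_swap A B)

variable {C : StrictSymMonCat.{u, u}} (G : StrictSymMonFunctor C SetPartial.{u})

/-- Fibres of graphs have at most one element, so each coherence law of `graphChoice` reduces to the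
equality of the underlying morphisms and end points. -/
theorem graph_fiber_heq {X Y X' Y' : C.Obj} (hX : X = X') (hY : Y = Y') {f : X ⟶ Y} {f' : X' ⟶ Y'}
    (hf : HEq f f') {x : Tuple (G.obj X)} {y : Tuple (G.obj Y)} {x' : Tuple (G.obj X')}
    {y' : Tuple (G.obj Y')} (hx : HEq x x') (hy : HEq y y')
    (s : (PartialMap.graph (G.map f)).Fiber x y) (s' : (PartialMap.graph (G.map f')).Fiber x' y') :
    HEq s s' := by
  subst hX hY; cases hf; cases hx; cases hy
  exact heq_of_eq ((PartialMap.subsingleton_fiber_graph _ _ _).elim _ _)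

theorem sends_of_fiber {X Y : C.Obj} {f : X ⟶ Y} {x : Tuple (G.obj X)} {y : Tuple (G.obj Y)}
    (s : (PartialMap.graph (G.map f)).Fiber x y) : Sends G f x y :=
  PartialMap.nonempty_fiber_graph.1 ⟨s⟩

/-- The element of the graph given by a pair of related elements. -/
def fiberMk {X Y : C.Obj} {f : X ⟶ Y} {x : Tuple (G.obj X)} {y : Tuple (G.obj Y)}
    (h : Sends G f x y) : (PartialMap.graph (G.map f)).Fiber x y :=
  ⟨⟨(x, y), h⟩, rfl, rfl⟩

/-- The choice of apexes given by graphs. -/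
def graphChoice : SpanCat.ApexChoice (G.comp toSpan) where
  span f := PartialMap.graph (G.map f)
  cls_span _ := rfl
  comp s t := fiberMk G ((sends_comp G).2 ⟨_, sends_of_fiber G s, sends_of_fiber G t⟩)
  comp_bijective {X Y Z} f g x z := by
    constructor
    · rintro ⟨y, s, t⟩ ⟨y', s', t'⟩ -
      obtain rfl : y = y' := PartialMap.sends_unique (sends_of_fiber G s) (sends_of_fiber G s')
      congr 1
      exact Prod.ext ((PartialMap.subsingleton_fiber_graph _ _ _).elim s s')
        ((PartialMap.subsingleton_fiber_graph _ _ _).elim t t')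
    · intro s
      obtain ⟨y, h, k⟩ := (sends_comp G).1 (sends_of_fiber G s)
      exact ⟨⟨y, fiberMk G h, fiberMk G k⟩, (PartialMap.subsingleton_fiber_graph _ _ _).elim _ _⟩
  tensor s t := fiberMk G ((sends_tensor G).2 ⟨sends_of_fiber G s, sends_of_fiber G t⟩)
  tensor_bijective f g x y x' y' := by
    constructor
    · rintro ⟨s, t⟩ ⟨s', t'⟩ -
      exact Prod.ext ((PartialMap.subsingleton_fiber_graph _ _ _).elim s s')
        ((PartialMap.subsingleton_fiber_graph _ _ _).elim t t')
    · intro s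
      obtain ⟨h, k⟩ := (sends_tensor G).1 (sends_of_fiber G s)
      exact ⟨⟨fiberMk G h, fiberMk G k⟩, (PartialMap.subsingleton_fiber_graph _ _ _).elim _ _⟩
  id_comp _ _ := graph_fiber_heq G rfl rfl (heq_of_eq (Category.id_comp _)) HEq.rfl HEq.rfl _ _
  comp_id _ _ := graph_fiber_heq G rfl rfl (heq_of_eq (Category.comp_id _)) HEq.rfl HEq.rfl _ _
  comp_assoc _ _ _ :=
    graph_fiber_heq G rfl rfl (heq_of_eq (Category.assoc _ _ _)) HEq.rfl HEq.rfl _ _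
  tensor_comp _ _ _ _ :=
    graph_fiber_heq G rfl rfl (heq_of_eq (C.tensor_comp _ _ _ _)) HEq.rfl HEq.rfl _ _
  tensor_assoc _ _ _ := graph_fiber_heq G (mul_assoc _ _ _) (mul_assoc _ _ _)
    (C.tensor_assoc _ _ _) (pair_assoc _ _ _) (pair_assoc _ _ _) _ _
  one_tensor _ _ := graph_fiber_heq G (one_mul _) (one_mul _) (C.one_tensor _)
    (pair_point_left _) (pair_point_left _) _ _
  tensor_one _ _ := graph_fiber_heq G (mul_one _) (mul_one _) (C.tensor_one _)
    (pair_point_right _) (pair_point_right _) _ _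
  braid_naturality _ _ _ _ :=
    graph_fiber_heq G rfl rfl (heq_of_eq (C.braid_naturality _ _)) HEq.rfl HEq.rfl _ _

variable {G} (R : SpanCat.ApexChoice (G.comp toSpan))

theorem nonempty_fiber_equiv {X Y : C.Obj} (f : X ⟶ Y) (x : Tuple (G.obj X))
    (y : Tuple (G.obj Y)) :
    Nonempty ((R.span f).Fiber x y ≃ (PartialMap.graph (G.map f)).Fiber x y) :=
  SetSpan.fiber_equiv_of_heq rfl rfl (heq_of_eq (R.cls_span f)) HEq.rfl HEq.rfl

theorem subsingleton_fiber {X Y : C.Obj} (f : X ⟶ Y) (x : Tuple (G.obj X)) (y : Tuple (G.obj Y)) :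
    Subsingleton ((R.span f).Fiber x y) := by
  obtain ⟨e⟩ := nonempty_fiber_equiv R f x y
  exact e.subsingleton_congr.2 (PartialMap.subsingleton_fiber_graph _ _ _)

theorem nonempty_fiber_iff {X Y : C.Obj} {f : X ⟶ Y} {x : Tuple (G.obj X)} {y : Tuple (G.obj Y)} :
    Nonempty ((R.span f).Fiber x y) ↔ Sends G f x y := by
  obtain ⟨e⟩ := nonempty_fiber_equiv R f x y
  exact e.nonempty_congr.trans PartialMap.nonempty_fiber_graph

/-- Any choice of apexes for a graph-valued functor has fibres with at most one element, so apex
elements carry no information beyond definedness. -/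
theorem intHom_eq {X Y : Marking (SpanCat.words (G.comp toSpan))} {f g : R.IntHom X Y}
    (h : f.hom = g.hom) : f = g :=
  R.intHom_ext_of_subsingleton h (subsingleton_fiber R _ _ _)

/-- Internalization of partial functions, as internalization of spans. -/
noncomputable def toSpanInternalization :
    StrictSymMonFunctor (internalization G) R.internalization where
  obj X := X
  map f := ⟨IntHom.hom f, ((nonempty_fiber_iff R).2 (IntHom.sends f)).some⟩
  map_id _ := intHom_eq R rfl
  map_comp _ _ := intHom_eq R rfl
  obj_one := rfl
  obj_mul _ _ := rfl
  map_tensor _ _ := heq_of_eq (intHom_eq R rfl)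
  map_braid _ _ := heq_of_eq (intHom_eq R rfl)

/-- Internalization of spans that are graphs, as internalization of partial functions. -/
noncomputable def ofSpanInternalization :
    StrictSymMonFunctor R.internalization (internalization G) where
  obj X := X
  map f := ⟨SpanCat.ApexChoice.IntHom.hom f,
    (nonempty_fiber_iff R).1 ⟨SpanCat.ApexChoice.IntHom.point f⟩⟩
  map_id _ := rfl
  map_comp _ _ := rfl
  obj_one := rfl
  obj_mul _ _ := rfl
  map_tensor _ _ := HEq.rfl
  map_braid _ _ := HEq.rfl

/-- Internalizations of partial functions and of their graphs agree. -/
noncomputable def internalizationIso : internalization G ≅ R.internalization where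
  hom := toSpanInternalization R
  inv := ofSpanInternalization R
  hom_inv_id := rfl
  inv_hom_id := StrictSymMonFunctor.ext_heq (fun _ => rfl) fun _ => heq_of_eq (intHom_eq R rfl)

theorem lift_comp_toSpanInternalization {D : StrictSymMonCat.{u, u}}
    (F : StrictSymMonFunctor D C) :
    (lift G F).comp (toSpanInternalization R) =
      (toSpanInternalization (G := F.comp G) (R.pullback F)).comp (R.lift F) :=
  StrictSymMonFunctor.ext_heq (fun _ => rfl) fun _ => heq_of_eq (intHom_eq R rfl)

end SetPartial

/-! ### Transport along isomorphisms -/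

theorem StrictSymMonCat.IsAddition.of_iso {A B D A' B' D' : StrictSymMonCat.{u, u}}
    {h : StrictSymMonFunctor D B} {h' : StrictSymMonFunctor D' B'} (H : A.IsAddition B D h)
    (a : A' ≅ A) (b : B' ≅ B) (d : D' ≅ D)
    (hh : StrictSymMonFunctor.comp h' b.hom = StrictSymMonFunctor.comp d.hom h) :
    A'.IsAddition B' D' h' := by
  obtain ⟨⟨P⟩, ⟨Q⟩, ⟨V⟩, H⟩ := H
  refine ⟨⟨⟨P.net, P.iso ≪≫ a.symm⟩⟩, ⟨⟨Q.net, Q.iso ≪≫ b.symm⟩⟩, ⟨⟨V.net, V.iso ≪≫ d.symm⟩⟩,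
    fun P Q V => ?_⟩
  -- A presentation of the primed category presents the other one with the same net; `e` checks that
  -- the functor between the nets is unchanged.
  have key := H ⟨P.net, P.iso ≪≫ a⟩ ⟨Q.net, Q.iso ≪≫ b⟩ ⟨V.net, V.iso ≪≫ d⟩
  have e : ∀ (h₁ : D ⟶ B) (h₂ : D' ⟶ B'), h₂ ≫ b.hom = d.hom ≫ h₁ →
      ((V.iso ≪≫ d).hom ≫ h₁) ≫ (Q.iso ≪≫ b).inv = (V.iso.hom ≫ h₂) ≫ Q.iso.inv := by
    intro h₁ h₂ h₃
    simp [← reassoc_of% h₃]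
  have hc : ∀ F F' : V.net.free ⟶ Q.net.free, F = F' → P.plain.IsAddition Q.plain V.net F →
      P.plain.IsAddition Q.plain V.net F' := by
    rintro F _ rfl
    exact _root_.id
  exact hc _ _ (e h h' hh) key

theorem NetWithSemantics.IsAddition.comp {S : StrictSymMonCat.{v₁, u₁}}
    {S' : StrictSymMonCat.{v₂, u₂}} {M K : NetWithSemantics.{v₁, u, u₁} S} {W : PetriNet.{u}}
    {w : StrictSymMonFunctor W.free K.net.free} (h : M.IsAddition K W w)
    (F : StrictSymMonFunctor S S') :
    NetWithSemantics.IsAddition (⟨M.net, M.sem.comp F⟩ : NetWithSemantics.{v₂, u, u₂} S')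
      ⟨K.net, K.sem.comp F⟩ W w := by
  obtain ⟨ι₁, ι₂, hp, h₁, h₂⟩ := h.exists_pushout
  exact ⟨h.map_generator, h.injective, h.faithful, ι₁, ι₂, hp,
    congrArg (fun E => StrictSymMonFunctor.comp E F) h₁,
    congrArg (fun E => StrictSymMonFunctor.comp E F) h₂⟩

theorem mainTheorem9 :
    (∀ (M K : NetWithSemantics.{u, u, u + 1} SetPartial.{u}) (W : PetriNet.{u})
      (w : StrictSymMonFunctor W.free K.net.free),
      M.IsAddition K W w →
        StrictSymMonCat.IsAddition
          (SetPartial.internalization M.sem)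
          (SetPartial.internalization K.sem)
          (SetPartial.internalization (w.comp K.sem))
          (SetPartial.lift K.sem w)) ∧
    (∀ (M K : NetWithSemantics.{u + 1, u, u + 1} SpanCat.{u}) (W : PetriNet.{u})
      (w : StrictSymMonFunctor W.free K.net.free),
      M.IsAddition K W w →
        ∀ (R : SpanCat.ApexChoice M.sem) (R' : SpanCat.ApexChoice K.sem),
          StrictSymMonCat.IsAddition
            R.internalization
            R'.internalization
            (R'.pullback w).internalization
            (R'.lift w)) := by
  refine ⟨fun M K W w h => ?_, fun M K W w h R R' => SpanCat.ApexChoice.isAddition h R R'⟩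
  let R := SetPartial.graphChoice M.sem
  let R' := SetPartial.graphChoice K.sem
  exact (SpanCat.ApexChoice.isAddition (h.comp SetPartial.toSpan) R R').of_iso
    (SetPartial.internalizationIso R) (SetPartial.internalizationIso R')
    -- The pulled-back choice is for `w.comp (K.sem.comp toSpan)`, which is by definition `(w.comp
    -- K.sem).comp toSpan`; the comparison holds for any choice of apexes.
    (SetPartial.internalizationIso (G := w.comp K.sem) (R'.pullback w))
    (SetPartial.lift_comp_toSpanInternalization R' w)
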